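/- **Setting.** Let $\mathcal X$ be a measurable space, $K\ge 1$, $\mathcal A=\{1,\dots,K\}$, and let $D$ be a probability distribution of pairs $(x,r)\in\mathcal X\times[0,1]^K$ with marginal $D_{\mathcal X}$. Let $\mathcal G$ be a class of measurable functions $\mathcal X\to[0,1]$ and let $\mathcal F=\mathcal G^{\mathcal A}$ be the product class, $f(x,a)=g_a(x)$. Assume realizability: there is $f^\star\in\mathcal F$ with $\mathbb E[r(a)\mid x]=f^\star(x,a)$ for all $a$. For $f\in\mathcal F$ let $\pi_f$ be a measurable policy with $\pi_f(x)\in\arg\max_a f(x,a)$ (ties broken arbitrarily), and $\pi^\star=\pi_{f^\star}$. The class $\mathcal G$ is either finite, or infinite and regular in this sense: it contains a countable subclass whose sequential pointwise limits include all of $\mathcal G$; the maxima and minima in the definition of the algorithm are attained; and the action sets chosen by the algorithm depend measurably on the data. For $\mathcal F'\subseteq\mathcal F$ put $\mathrm{High}_{\mathcal F'}(x,a)=\sup_{f\in\mathcal F'}f(x,a)$, $\mathrm{Low}_{\mathcal F'}(x,a)=\inf_{f\in\mathcal F'}f(x,a)$ and $W_{\mathcal F'}=\mathrm{High}_{\mathcal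 F'}-\mathrm{Low}_{\mathcal F'}$. Let $A_{\mathcal F'}(x)=\bigcup_{f\in\mathcal F'}\arg\max_a f(x,a)$, and let $\mathrm{Dis}(\mathcal F')$ be the set of $x$ at which two elements of $\mathcal F'$ have different argmax sets. With $\mathcal F(\varepsilon)=\{f\in\mathcal F:\mathbb E[r(\pi_f(x))]\ge\mathbb E[r(\pi^\star(x))]-\varepsilon\}$ the disagreement coefficient is $$\theta_0=\sup_{\delta'>0,\varepsilon>0}\frac{\delta'}{\varepsilon}\Pr_{D_{\mathcal X}}\big[x\in\mathrm{Dis}(\mathcal F(\varepsilon))\text{ and }\exists a\in A_{\mathcal F(\varepsilon)}(x):W_{\mathcal F(\varepsilon)}(x,a)>\delta'\big],$$ which is assumed finite. **Algorithm** (RegCB.Elimination, Option I). Let $T\ge2$, $\delta\in(0,1)$, $\tau_m=2^{m-1}$, $M=\lfloor\log_2T\rfloor+1$, and $$C_\delta=\min\Big\{16\log\tfrac{2|\mathcal G|KT^2}{\delta},\ \inf_{\varepsilon>0}\Big(100\varepsilon T+320\log\tfrac{8\,\mathbb E_{x_{1:T}}[\mathcal N_1(\mathcal G,\varepsilon,x_{1:T})]\,KT^2\log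 T}{\delta}\Big)\Big\},$$ where $x_{1:T}$ are i.i.d. from $D_{\mathcal X}$, $\mathcal N_1(\mathcal G,\varepsilon,x_{1:T})$ is the least size of a set $V\subseteq\mathbb R^T$ such that every $g\in\mathcal G$ has some $v\in V$ with $\frac1T\sum_t|g(x_t)-v_t|\le\varepsilon$, and the first term is $+\infty$ for infinite $\mathcal G$. For finite $\mathcal G$ one may instead take $C_\delta=16\log(2|\mathcal G|KT^2/\delta)$. In epoch $m=1,\dots,M$ (rounds $t\le T$ with $\tau_m\le t<\tau_{m+1}$) put $\beta_m=\frac{(M-m+1)C_\delta}{\tau_m-1}$ and $\mathcal F_m=\prod_a\widehat{\mathcal G}_m(\beta_m,a)$. Here $\widehat{\mathcal G}_1(\beta,a)=\mathcal G$ and, for $m\ge2$, $\widehat{\mathcal G}_m(\beta,a)=\{g\in\mathcal G:\widehat{\mathcal R}_m(g,a)-\inf_{g'\in\mathcal G}\widehat{\mathcal R}_m(g',a)\le\beta\}$ with $\widehat{\mathcal R}_m(g,a)=\frac1{\tau_m-1}\sum_{s<\tau_m}(g(x_s)-r_s(a_s))^2\mathbf 1\{a_s=a\}$. In round $t$ of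 epoch $m$ the pair $(x_t,r_t)\sim D$ is drawn independently of the past, and $a_t$ is drawn uniformly from $\{a:\mathrm{High}_{\mathcal F_m}(x_t,a)\ge\max_{a'}\mathrm{Low}_{\mathcal F_m}(x_t,a')\}$. Let $\mathrm{Reg}_T=\sum_{t=1}^Tr_t(\pi^\star(x_t))-\sum_{t=1}^Tr_t(a_t)$. **Theorem.** There are absolute constants (in $O(\cdot)$ and in the exponents of the logarithmic factors hidden by $\tilde O(\cdot)$, which are polynomial in $1+\log T$, $1+\log K$ and $1+\log(1/\delta)$) such that the following holds. 1. With probability at least $1-\delta$, $$\mathrm{Reg}_T=O\Big(T^{3/4}C_\delta^{1/4}\sqrt{\theta_0K\log T}+\sqrt{T\log(2/\delta)}\Big).$$ If $\theta_0K\log T\ge1$, then with probability at least $1-\delta$, $\mathrm{Reg}_T=O\big(T^{3/4}C_\delta^{1/4}\sqrt{\theta_0K\log T}+\log(1/\delta)\big)$. 2. If $\mathcal G$ is finite, then with probability at least $1-\delta$, $\mathrm{Reg}_T=\tilde O\big(T^{3/4}(\log|\mathcal G|)^{1/4}\sqrt{\theta_0K}+\sqrt T\big)$. If moreover $\theta_0K\log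 T\ge1$, then with probability at least $1-\delta$, $\mathrm{Reg}_T=\tilde O\big(T^{3/4}(\log|\mathcal G|)^{1/4}\sqrt{\theta_0K}\big)$. 3. Suppose the Massart condition holds with margin $\gamma>0$: $f^\star(x,\pi^\star(x))\ge f^\star(x,a)+\gamma$ for $D_{\mathcal X}$-almost all $x$ and all $a\ne\pi^\star(x)$. Then the algorithm run with $\delta=1/T$ satisfies $\mathbb E[\mathrm{Reg}_T]=O\big(\theta_0K^2C_{1/T}\log^2T/\gamma^2\big)$, and for finite $\mathcal G$ this gives $\mathbb E[\mathrm{Reg}_T]=\tilde O\big(\theta_0K^2\log(|\mathcal G|T)/\gamma^2\big)$. -/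

import Mathlib

open MeasureTheory ProbabilityTheory Filter Topology
open scoped ENNReal

namespace RegCB

noncomputable section

variable {X : Type*} {K : ℕ}

/-! Product predictor classes. Actions are `Fin K`, a predictor is `f : X → Fin K → ℝ`. -/

/-- The product class `∏ a, S a`: the predictors whose `a`-th component lies in `S a`. -/
def productClass (S : Fin K → Set (X → ℝ)) : Set (X → Fin K → ℝ) :=
  {f | ∀ a, (fun x => f x a) ∈ S a}

/-- Upper reward bound of a class of predictors. -/
def high (F : Set (X → Fin K → ℝ)) (x : X) (a : Fin K) : ℝ := sSup ((fun f => f x a) '' F)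

/-- Lower reward bound of a class of predictors. -/
def low (F : Set (X → Fin K → ℝ)) (x : X) (a : Fin K) : ℝ := sInf ((fun f => f x a) '' F)

/-- Reward width. -/
def width (F : Set (X → Fin K → ℝ)) (x : X) (a : Fin K) : ℝ := high F x a - low F x a

/-- The set of maximizing actions of `f` at `x`. -/
def argmaxSet (f : X → Fin K → ℝ) (x : X) : Set (Fin K) := {a | ∀ b, f x b ≤ f x a}

/-- Disagreement region: two predictors of the class have different argmax sets. -/
def disagreementRegion (F : Set (X → Fin K → ℝ)) : Set X :=
  {x | ∃ f ∈ F, ∃ f' ∈ F, argmaxSet f x ≠ argmaxSet f' x}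

/-- Disagreement set of a class at `x`. -/
def disagreementSet (F : Set (X → Fin K → ℝ)) (x : X) : Set (Fin K) :=
  ⋃ f ∈ F, argmaxSet f x

/-! The algorithm. Rounds are `1, 2, …, T`; `d s` is the observation of round `s`: context, played
action, observed reward. The value `d 0` is never used. -/

/-- First round of epoch `m` (for `m ≥ 1`). -/
def epochStart (m : ℕ) : ℕ := 2 ^ (m - 1)

/-- The epoch of round `t ≥ 1`, i.e. the `m` with `epochStart m ≤ t < epochStart (m + 1)`. -/
def epochOf (t : ℕ) : ℕ := Nat.log 2 t + 1

/-- Empirical square loss of `g` on the rounds before epoch `m` where action `a` was played. -/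
def empLoss (d : ℕ → X × Fin K × ℝ) (m : ℕ) (a : Fin K) (g : X → ℝ) : ℝ :=
  1 / ((epochStart m : ℝ) - 1) *
    ∑ s ∈ Finset.Ico 1 (epochStart m),
      if (d s).2.1 = a then (g (d s).1 - (d s).2.2) ^ 2 else 0

/-- Near-minimizers, up to `β`, of the empirical square loss for action `a`; all of `G` if
`m = 1`. -/
def versionSpace (G : Set (X → ℝ)) (d : ℕ → X × Fin K × ℝ) (m : ℕ) (β : ℝ) (a : Fin K) :
    Set (X → ℝ) :=
  {g ∈ G | m = 1 ∨ empLoss d m a g - sInf (empLoss d m a '' G) ≤ β}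

/-- The actions that are plausibly optimal at `x` in epoch `m`: those whose upper bound is at
least the largest lower bound of an action. -/
def plausibleSet (G : Set (X → ℝ)) (d : ℕ → X × Fin K × ℝ) (m : ℕ) (β : ℝ) (x : X) :
    Set (Fin K) :=
  {a | ∀ a', low (productClass (versionSpace G d m β)) x a'
    ≤ high (productClass (versionSpace G d m β)) x a}

/-- The tolerance `β_m = (M - m + 1) C / (τ_m - 1)` for horizon `T`, where `M` is the epoch of the
last round. -/
def tolerance (T : ℕ) (C : ℝ) (m : ℕ) : ℝ :=
  ((epochOf T : ℝ) - m + 1) * C / ((epochStart m : ℝ) - 1)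

/-- The set of plausible actions in round `t` of a run with observations `d` and context `x`. -/
def activeSet (G : Set (X → ℝ)) (T : ℕ) (C : ℝ) (d : ℕ → X × Fin K × ℝ) (t : ℕ) (x : X) :
    Set (Fin K) :=
  plausibleSet G d (epochOf t) (tolerance T C (epochOf t)) x

section Run

variable {Ω : Type*} [MeasurableSpace X] [MeasurableSpace Ω]

/-- The `σ`-algebra generated by `(x s, a s, r s)` for the rounds `s = 1, …, t - 1`. -/
abbrev history (x : ℕ → Ω → X) (r : ℕ → Ω → Fin K → ℝ) (a : ℕ → Ω → Fin K) (t : ℕ) :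
    MeasurableSpace Ω :=
  ⨆ s ∈ Finset.Ico 1 t,
    MeasurableSpace.comap (fun ω => (x s ω, a s ω, r s ω)) inferInstance

/-- `x`, `r`, `a` are the contexts, reward vectors and actions of a run over rounds `1, …, T` of
the elimination algorithm with base class `G` and confidence radius `C`, when context-reward
pairs are drawn independently from `D`. -/
structure IsRun (D : Measure (X × (Fin K → ℝ))) (G : Set (X → ℝ)) (T : ℕ) (C : ℝ)
    (P : Measure Ω) (x : ℕ → Ω → X) (r : ℕ → Ω → Fin K → ℝ) (a : ℕ → Ω → Fin K) : Prop where
  measurable_context : ∀ t, Measurable (x t)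
  measurable_reward : ∀ t, Measurable (r t)
  measurable_action : ∀ t, Measurable (a t)
  /-- the pair of round `t` has law `D` -/
  law : ∀ t ∈ Finset.Icc 1 T, P.map (fun ω => (x t ω, r t ω)) = D
  /-- and is independent of the past -/
  indep : ∀ t ∈ Finset.Icc 1 T,
    Indep (history x r a t)
      (MeasurableSpace.comap (fun ω => (x t ω, r t ω)) inferInstance) P
  /-- given the past and the pair of round `t`, the action is uniform on the plausible set -/
  action_uniform : ∀ t ∈ Finset.Icc 1 T, ∀ b : Fin K,
    P[Set.indicator {ω | a t ω = b} (fun _ => (1 : ℝ)) |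
        history x r a t ⊔ MeasurableSpace.comap (fun ω => (x t ω, r t ω)) inferInstance]
      =ᵐ[P] fun ω =>
        Set.indicator (activeSet G T C (fun s => (x s ω, a s ω, r s ω (a s ω))) t (x t ω))
          (fun _ =>
            (((activeSet G T C (fun s => (x s ω, a s ω, r s ω (a s ω))) t (x t ω)).ncard : ℝ))⁻¹)
          b

/-- Realized regret against the policy `π`. -/
def regret (T : ℕ) (π : X → Fin K) (x : ℕ → Ω → X) (r : ℕ → Ω → Fin K → ℝ) (a : ℕ → Ω → Fin K)
    (ω : Ω) : ℝ :=
  ∑ t ∈ Finset.Icc 1 T, r t ω (π (x t ω)) - ∑ t ∈ Finset.Icc 1 T, r t ω (a t ω)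

end Run

section Distribution

variable [MeasurableSpace X]

/-- The rewards lie in `[0,1]`. -/
def BoundedRewards (D : Measure (X × (Fin K → ℝ))) : Prop :=
  ∀ᵐ z ∂D, ∀ a, z.2 a ∈ Set.Icc (0 : ℝ) 1

/-- `fstar` belongs to the product class of `G` and is the conditional mean of the rewards. -/
def Realizes (D : Measure (X × (Fin K → ℝ))) (G : Set (X → ℝ)) (fstar : X → Fin K → ℝ) : Prop :=
  fstar ∈ productClass (fun _ => G) ∧
    ∀ a, D[fun z => z.2 a | MeasurableSpace.comap Prod.fst inferInstance]
      =ᵐ[D] fun z => fstar z.1 a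

/-- A tie-breaking rule: it assigns to every `f` in the product class of `G` a (measurable) policy
that picks a maximizing action of `f`. -/
def IsGreedyRule (G : Set (X → ℝ)) (pol : (X → Fin K → ℝ) → X → Fin K) : Prop :=
  ∀ f ∈ productClass (fun _ : Fin K => G), Measurable (pol f) ∧ ∀ x, pol f x ∈ argmaxSet f x

/-- The policy-regret ball of radius `ε` of the product class of `G`. -/
def regretBall (D : Measure (X × (Fin K → ℝ))) (G : Set (X → ℝ)) (fstar : X → Fin K → ℝ)
    (pol : (X → Fin K → ℝ) → X → Fin K) (ε : ℝ) : Set (X → Fin K → ℝ) :=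
  {f ∈ productClass (fun _ => G) |
    ∫ z, z.2 (pol f z.1) ∂D ≥ ∫ z, z.2 (pol fstar z.1) ∂D - ε}

/-- The disagreement coefficient. -/
def disagreementCoeff (D : Measure (X × (Fin K → ℝ))) (G : Set (X → ℝ))
    (fstar : X → Fin K → ℝ) (pol : (X → Fin K → ℝ) → X → Fin K) : ℝ≥0∞ :=
  ⨆ (δ : ℝ) (_ : 0 < δ) (ε : ℝ) (_ : 0 < ε),
    ENNReal.ofReal (δ / ε) *
      D.fst {x | x ∈ disagreementRegion (regretBall D G fstar pol ε) ∧
        ∃ a ∈ disagreementSet (regretBall D G fstar pol ε) x,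
          δ < width (regretBall D G fstar pol ε) x a}

/-- Massart noise condition with margin `γ`. -/
def Massart (D : Measure (X × (Fin K → ℝ))) (fstar : X → Fin K → ℝ) (π : X → Fin K) (γ : ℝ) :
    Prop :=
  ∀ᵐ x ∂D.fst, ∀ a, a ≠ π x → fstar x a + γ ≤ fstar x (π x)

/-- `V` is an empirical `L₁` cover of `G` at scale `ε` on the points `xs`. -/
def IsL1Cover {T : ℕ} (G : Set (X → ℝ)) (ε : ℝ) (xs : Fin T → X) (V : Finset (Fin T → ℝ)) :
    Prop :=
  ∀ g ∈ G, ∃ v ∈ V, 1 / (T : ℝ) * ∑ t, |g (xs t) - v t| ≤ ε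

/-- Empirical `L₁` covering number. -/
def coverNum {T : ℕ} (G : Set (X → ℝ)) (ε : ℝ) (xs : Fin T → X) : ℝ≥0∞ :=
  ⨅ (V : Finset (Fin T → ℝ)) (_ : IsL1Cover G ε xs V), (V.card : ℝ≥0∞)

/-- Expected covering number on `T` independent contexts. -/
def expCoverNum (D : Measure (X × (Fin K → ℝ))) (G : Set (X → ℝ)) (T : ℕ) (ε : ℝ) : ℝ :=
  (∫⁻ xs, coverNum G ε xs ∂Measure.pi (fun _ : Fin T => D.fst)).toReal

/-- The confidence radius of a finite class. -/
def radiusFinite (K : ℕ) (G : Set (X → ℝ)) (T : ℕ) (δ : ℝ) : ℝ :=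
  16 * Real.log (2 * (G.ncard : ℝ) * K * (T : ℝ) ^ 2 / δ)

/-- The confidence radius through covering numbers. -/
def radiusCover (D : Measure (X × (Fin K → ℝ))) (G : Set (X → ℝ)) (T : ℕ) (δ : ℝ) : ℝ :=
  ⨅ ε : Set.Ioi (0 : ℝ), (100 * (ε : ℝ) * T +
    320 * Real.log (8 * expCoverNum D G T ε * K * (T : ℝ) ^ 2 * Real.log T / δ))

open Classical in
/-- The confidence radius of a general class: the minimum of the two expressions, where the first
one counts as infinite if `G` is infinite. -/
def radius (D : Measure (X × (Fin K → ℝ))) (G : Set (X → ℝ)) (T : ℕ) (δ : ℝ) : ℝ :=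
  if G.Finite then min (radiusFinite K G T δ) (radiusCover D G T δ) else radiusCover D G T δ

/-- `G` is a class of measurable functions with values in `[0,1]`. -/
def IsBaseClass (G : Set (X → ℝ)) : Prop :=
  ∀ g ∈ G, Measurable g ∧ ∀ x, g x ∈ Set.Icc (0 : ℝ) 1

/-- Pointwise separability: a countable subclass is sequentially dense for pointwise limits. -/
def PointwiseSeparable (G : Set (X → ℝ)) : Prop :=
  ∃ G₀ ⊆ G, G₀.Countable ∧ ∀ g ∈ G, ∃ u : ℕ → X → ℝ, (∀ n, u n ∈ G₀) ∧
    ∀ x, Tendsto (fun n => u n x) atTop (𝓝 (g x))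

/-- The maxima and minima that define the reward bounds of a version space are attained. -/
def ExtremaAttained (K : ℕ) (G : Set (X → ℝ)) : Prop :=
  ∀ (d : ℕ → X × Fin K × ℝ), (∀ s, (d s).2.2 ∈ Set.Icc (0 : ℝ) 1) →
    ∀ (m : ℕ) (β : ℝ), 1 ≤ m → (m = 1 ∨ 0 < β) → ∀ (a : Fin K) (x : X),
      (∃ g ∈ versionSpace G d m β a, ∀ g' ∈ versionSpace G d m β a, g' x ≤ g x) ∧
      (∃ g ∈ versionSpace G d m β a, ∀ g' ∈ versionSpace G d m β a, g x ≤ g' x)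

/-- The set of plausible actions is a measurable function of the observations and the context. -/
def MeasurableElimination (K : ℕ) (G : Set (X → ℝ)) : Prop :=
  ∀ (m : ℕ) (β : ℝ), 1 ≤ m → (m = 1 ∨ 0 < β) → ∀ a : Fin K,
    MeasurableSet {q : (ℕ → X × Fin K × ℝ) × X | a ∈ plausibleSet G q.1 m β q.2}

/-- The regularity that is taken for granted when `G` is infinite; a finite class has it
automatically, so nothing is required of it. -/
def RegularClass (K : ℕ) (G : Set (X → ℝ)) : Prop :=
  G.Finite ∨ (PointwiseSeparable G ∧ ExtremaAttained K G ∧ MeasurableElimination K G)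

end Distribution

end

end RegCB

namespace RegCB

/-! ### Elementary inequalities -/

/-! The statistical core is a one-round inequality. For a fixed prediction `v` of the mean reward
`f` of an action, the excess square loss of `v` over `f`, counted when the action is played, has
conditional mean `p (v - f)²` and conditional second moment at most `4 p (v - f)²`, with `p` the
playing probability. A plausible action is played with probability at least `1/K`. Hence the
exponential of minus a quarter of the excess loss, plus `(v - f)² / (10 K)` when the action is
plausible, has mean at most one given the past and the current context (`isStepWeight_excess`).
Products of such factors control all excess losses of one sequence of predictions.

Uniformity over the class comes from an empirical L₁ cover, which depends on all `T` contexts,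
future ones included. This is harmless because the one-round bound holds given the context as well:
rounds can be integrated out from the last to the first, each context becoming an independent copy
(`IsRun.lintegral_telescope`). Summing over the cover then costs exactly the expected covering
number. Covers are chosen measurably among countably many rational ones (`exists_cover_partition`).
The passage from empirical to mean squared distances is a ghost-sample argument with random swaps
(`lintegral_meanGap_le`), applied inside an epoch, where the plausible sets are frozen.

On the resulting good event (`IsRun.measure_not_goodEvent_le`) the rest is deterministic. No
predictor beats `fstar` by more than `C/2` in total loss, so `fstar` survives. A survivor of epoch
`m` has excess at most `(M - m + 1) C`, and the last epoch contributed at least `-C/2`, so the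
survivor already satisfied the constraint of epoch `m - 1`; the decreasing factor in the tolerance
pays for this. The version spaces are therefore nested, the greedy actions of `f` and of `fstar`
were both plausible one epoch earlier, and the weighted squared distances there dominate the squared
policy gap (`GoodEvent.integral_policyGap_sq_le`). The version space thus lies in a regret ball
whose radius is of order `K log T √(C/t)` by Jensen, or `K² C log T / (γ t)` under Massart, where
the gap is at most its square over `γ`.

The disagreement coefficient turns a radius `ε` into mean regret. Off a set of contexts of measure
`θ ε / s`, every plausible action loses at most `2 s`. Taking `s = √(θ ε)` gives `3 √(θ ε)`
(`meanRegret_le_sqrt`), which sums to `T^{3/4}`; under Massart, `s = γ/4` forces the loss to vanish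
off the set and leaves `4 θ ε / γ` (`meanRegret_le_of_massart`), which sums harmonically. An
exponential supermartingale (`IsRun.regret_concentration`) passes from mean to realized regret, and
deviations too large for it are covered by the trivial bound `T`. -/

lemma exp_le_one_add_add_sq {u : ℝ} (hu : |u| ≤ 1) : Real.exp u ≤ 1 + u + u ^ 2 := by
  have := (abs_le.1 (Real.abs_exp_sub_one_sub_id_le hu)).2
  linarith

lemma exp_le_of_abs_le_quarter {u : ℝ} (hu : |u| ≤ 1 / 4) :
    Real.exp u ≤ 1 + u + 3 / 5 * u ^ 2 := by
  have h := Real.exp_bound (x := u) (by linarith) (n := 3) (by norm_num)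
  have h1 := (abs_le.1 h).2
  simp only [Finset.sum_range_succ, Finset.sum_range_zero] at h1
  have h2 : |u| ^ 3 ≤ 1 / 4 * u ^ 2 := by
    rw [← sq_abs u]
    nlinarith [sq_nonneg |u|, abs_nonneg u]
  norm_num [Nat.factorial] at h1
  nlinarith

/-! ### Integrals against conditional expectations -/

/-- The densities `R` and `R'` define the same measure on `m`, and an `m`-measurable weight sees
nothing else. Working with lower integrals spares any integrability of `B`. -/
lemma lintegral_mul_ofReal_condExp {Ω : Type*} {m m0 : MeasurableSpace Ω} (hm : m ≤ m0)
    {P : Measure Ω} [IsFiniteMeasure P] {R R' : Ω → ℝ} (hR : Integrable R P)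
    (hR0 : 0 ≤ᵐ[P] R) (h : P[R | m] =ᵐ[P] R') {B : Ω → ℝ≥0∞} (hB : Measurable[m] B) :
    ∫⁻ ω, B ω * ENNReal.ofReal (R ω) ∂P = ∫⁻ ω, B ω * ENNReal.ofReal (R' ω) ∂P := by
  have hR'i : Integrable R' P := integrable_condExp.congr h
  have hR'0 : 0 ≤ᵐ[P] R' := by
    filter_upwards [condExp_nonneg (m := m) hR0, h] with ω h1 h2
    rwa [← h2]
  have key : (P.withDensity fun ω => ENNReal.ofReal (R ω)).trim hm
      = (P.withDensity fun ω => ENNReal.ofReal (R' ω)).trim hm := by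
    refine @Measure.ext _ m _ _ fun s hs => ?_
    rw [trim_measurableSet_eq hm hs, trim_measurableSet_eq hm hs,
      withDensity_apply _ (hm s hs), withDensity_apply _ (hm s hs),
      ← ofReal_integral_eq_lintegral_ofReal hR.integrableOn (ae_restrict_of_ae hR0),
      ← ofReal_integral_eq_lintegral_ofReal hR'i.integrableOn (ae_restrict_of_ae hR'0),
      ← setIntegral_condExp hm hR hs]
    congr 1
    exact setIntegral_congr_ae (hm s hs) (h.mono fun ω hω _ => hω)
  have e : ∀ Q : Ω → ℝ, Integrable Q P → ∫⁻ ω, B ω * ENNReal.ofReal (Q ω) ∂P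
      = ∫⁻ ω, B ω ∂((P.withDensity fun ω => ENNReal.ofReal (Q ω)).trim hm) := by
    intro Q hQ
    rw [lintegral_trim hm hB, lintegral_withDensity_eq_lintegral_mul₀
      hQ.aestronglyMeasurable.aemeasurable.ennreal_ofReal (hB.mono hm le_rfl).aemeasurable]
    simp [mul_comm]
  rw [e R hR, e R' hR'i, key]

/-! ### Resampling one coordinate of a product measure -/

/-- A coordinate overwritten by a fresh draw from `μ` keeps its law and its independence of the
others; both integrands have the same marginal in `k`. -/
lemma lintegral_pi_update {ι X : Type*} [Fintype ι] [DecidableEq ι] [MeasurableSpace X]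
    (μ : Measure X) [IsProbabilityMeasure μ] (k : ι) {f : (ι → X) → ℝ≥0∞} (hf : Measurable f) :
    ∫⁻ y, ∫⁻ u, f (Function.update y k u) ∂μ ∂Measure.pi (fun _ : ι => μ)
      = ∫⁻ y, f y ∂Measure.pi (fun _ : ι => μ) := by
  have hmeas : Measurable fun y : ι → X => ∫⁻ u, f (Function.update y k u) ∂μ := by
    have := hf.lmarginal (fun _ : ι => μ) (s := {k})
    rwa [lmarginal_singleton] at this
  refine lintegral_eq_of_lmarginal_eq {k} hmeas hf ?_
  funext x
  simp only [lmarginal_singleton, Function.update_idem]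
  simp

/-- Exponential Markov inequality for nonnegative extended reals, in the form "with probability at
least `1 - η`, the value is below `N / η`". -/
lemma measure_gt_div_le {Ω : Type*} [MeasurableSpace Ω] {P : Measure Ω} {f : Ω → ℝ≥0∞}
    (hf : AEMeasurable f P) {N η : ℝ} (hN : 0 < N) (hη : 0 < η)
    (h : ∫⁻ ω, f ω ∂P ≤ ENNReal.ofReal N) :
    P {ω | ENNReal.ofReal (N / η) ≤ f ω} ≤ ENNReal.ofReal η := by
  refine (meas_ge_le_lintegral_div hf ?_ ENNReal.ofReal_ne_top).trans ?_
  · simpa using div_pos hN hη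
  · refine (ENNReal.div_le_div_right h _).trans ?_
    rw [← ENNReal.ofReal_div_of_pos (div_pos hN hη)]
    refine ENNReal.ofReal_le_ofReal (le_of_eq ?_)
    field_simp

end RegCB

namespace RegCB

/-! ### Rational covers -/

/-- The points `xs` on which the rational vectors in `V`, all of them with entries in `[0,1]`,
cover `G` up to the total deviation `ρ`. -/
def ratCover {X : Type*} {T : ℕ} (G : Set (X → ℝ)) (ρ : ℝ) (V : Finset (Fin T → ℚ)) :
    Set (Fin T → X) :=
  {xs | (∀ v ∈ V, ∀ t, (v t : ℝ) ∈ Set.Icc (0 : ℝ) 1) ∧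
    ∀ g ∈ G, ∃ v ∈ V, ∑ t, |g (xs t) - v t| ≤ ρ}

/-- The cover is finite, so along an approximating sequence one of its vectors works infinitely
often, and the inequality is closed under limits. A countable subclass thus decides whether a set
covers, which gives measurability. -/
lemma ratCover_eq_of_dense {X : Type*} {T : ℕ} {G G₀ : Set (X → ℝ)} (hsub : G₀ ⊆ G)
    (hdense : ∀ g ∈ G, ∃ u : ℕ → X → ℝ, (∀ n, u n ∈ G₀) ∧
      ∀ x, Tendsto (fun n => u n x) atTop (𝓝 (g x)))
    (ρ : ℝ) (V : Finset (Fin T → ℚ)) : ratCover G ρ V = ratCover G₀ ρ V := by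
  ext xs
  refine ⟨fun h => ⟨h.1, fun g hg => h.2 g (hsub hg)⟩, fun h => ⟨h.1, fun g hg => ?_⟩⟩
  obtain ⟨u, hu, hlim⟩ := hdense g hg
  have hfreq : ∃ᶠ n in atTop, ∃ v ∈ V, ∑ t, |u n (xs t) - v t| ≤ ρ :=
    (Eventually.of_forall fun n => h.2 _ (hu n)).frequently
  have : ∃ v ∈ V, ∃ᶠ n in atTop, ∑ t, |u n (xs t) - v t| ≤ ρ := by
    by_contra hcon
    push Not at hcon
    refine hfreq ?_
    have : ∀ᶠ n in atTop, ∀ v ∈ V, ¬ ∑ t, |u n (xs t) - v t| ≤ ρ := by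
      rw [Finset.eventually_all]
      intro v hv
      simpa using hcon v hv
    filter_upwards [this] with n hn ⟨v, hv, h'⟩
    exact hn v hv h'
  obtain ⟨v, hv, hf⟩ := this
  refine ⟨v, hv, ?_⟩
  have ht : Tendsto (fun n => ∑ t, |u n (xs t) - v t|) atTop (𝓝 (∑ t, |g (xs t) - v t|)) :=
    tendsto_finsetSum _ fun t _ => ((hlim (xs t)).sub_const _).abs
  exact le_of_tendsto_of_frequently ht hf

lemma measurableSet_ratCover {X : Type*} [MeasurableSpace X] {T : ℕ} {G₀ : Set (X → ℝ)}
    (hc : G₀.Countable) (hm : ∀ g ∈ G₀, Measurable g) (ρ : ℝ) (V : Finset (Fin T → ℚ)) :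
    MeasurableSet (ratCover G₀ ρ V) := by
  have : ratCover G₀ ρ V = {_xs | ∀ v ∈ V, ∀ t, (v t : ℝ) ∈ Set.Icc (0 : ℝ) 1} ∩
      ⋂ g ∈ G₀, ⋃ v ∈ V, {xs : Fin T → X | ∑ t, |g (xs t) - v t| ≤ ρ} := by
    ext xs; simp [ratCover]
  rw [this]
  refine (MeasurableSet.const _).inter (MeasurableSet.biInter hc fun g hg => ?_)
  refine Finset.measurableSet_biUnion _ fun v _ => measurableSet_le ?_ measurable_const
  refine Finset.measurable_sum _ fun t _ => ?_
  exact (((hm g hg).comp (measurable_pi_apply t)).sub_const _).abs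

lemma exists_rat_near {r η : ℝ} (hr : r ∈ Set.Icc (0 : ℝ) 1) (hη : 0 < η) :
    ∃ q : ℚ, (q : ℝ) ∈ Set.Icc (0 : ℝ) 1 ∧ |r - q| ≤ η := by
  obtain ⟨h0, h1⟩ := hr
  -- Approximating from below keeps the rational in the unit interval; only `r = 0` leaves no room
  -- for it.
  rcases h0.eq_or_lt with h | h
  · exact ⟨0, by simp, by simp [← h, hη.le]⟩
  · obtain ⟨q, hq1, hq2⟩ := exists_rat_btwn (show max 0 (r - η) < r by simp [h, hη])
    have hq3 := max_lt_iff.1 hq1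
    refine ⟨q, ⟨hq3.1.le, hq2.le.trans h1⟩, ?_⟩
    rw [abs_le]
    constructor <;> linarith [hq3.2]

/-- Clipping a cover vector to the unit interval brings it no further from a function with values
there, and rounding to rationals costs `ε` per coordinate; hence the factor `2`. Rational covers
form a countable family. -/
lemma exists_ratCover_of_isL1Cover {X : Type*} {T : ℕ} (hT : 0 < T) {G : Set (X → ℝ)}
    (h01 : ∀ g ∈ G, ∀ x, g x ∈ Set.Icc (0 : ℝ) 1) {ε : ℝ} (hε : 0 < ε) {xs : Fin T → X}
    {V : Finset (Fin T → ℝ)} (hV : IsL1Cover G ε xs V) :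
    ∃ W : Finset (Fin T → ℚ), xs ∈ ratCover G (2 * ε * T) W ∧ W.card ≤ V.card := by
  classical
  have hclip : ∀ r : ℝ, max 0 (min r 1) ∈ Set.Icc (0 : ℝ) 1 := fun r => by simp
  choose q hq01 hq using fun r : ℝ => exists_rat_near (hclip r) hε
  refine ⟨V.image fun v t => q (v t), ⟨?_, fun g hg => ?_⟩, Finset.card_image_le⟩
  · intro v hv t
    obtain ⟨w, -, rfl⟩ := Finset.mem_image.1 hv
    exact hq01 _
  · obtain ⟨v, hv, hle⟩ := hV g hg
    refine ⟨_, Finset.mem_image_of_mem _ hv, ?_⟩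
    have hT' : (0 : ℝ) < T := by exact_mod_cast hT
    have h1 : ∑ t, |g (xs t) - v t| ≤ ε * T := by
      rw [one_div, inv_mul_le_iff₀ hT'] at hle
      linarith
    have h2 : ∀ t, |g (xs t) - q (v t)| ≤ |g (xs t) - v t| + ε := by
      intro t
      have h3 : |g (xs t) - max 0 (min (v t) 1)| ≤ |g (xs t) - v t| := by
        obtain ⟨ha, hb⟩ := h01 g hg (xs t)
        rcases le_total (v t) 1 with h | h <;> rcases le_total 0 (v t) with h' | h'
        · simp [h, h']
        · rw [min_eq_left h, max_eq_left h', abs_of_nonneg (by linarith),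
            abs_of_nonneg (by linarith)]
          linarith
        · rw [min_eq_right h, max_eq_right zero_le_one, abs_of_nonpos (by linarith),
            abs_of_nonpos (by linarith)]
          linarith
        · linarith
      calc |g (xs t) - q (v t)|
          ≤ |g (xs t) - max 0 (min (v t) 1)| + |max 0 (min (v t) 1) - q (v t)| :=
            abs_sub_le _ _ _
        _ ≤ _ := add_le_add h3 (hq _)
    calc ∑ t, |g (xs t) - q (v t)| ≤ ∑ t, (|g (xs t) - v t| + ε) :=
          Finset.sum_le_sum fun t _ => h2 t
      _ = ∑ t, |g (xs t) - v t| + T * ε := by simp [Finset.sum_add_distrib]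
      _ ≤ 2 * ε * T := by linarith

/-- A finite set of vectors covers every class of `[0,1]`-valued functions, at every scale and on
all points. -/
lemma exists_uniform_l1Cover {X : Type*} {T : ℕ} {G : Set (X → ℝ)}
    (h01 : ∀ g ∈ G, ∀ x, g x ∈ Set.Icc (0 : ℝ) 1) {ε : ℝ} (hε : 0 < ε) :
    ∃ V : Finset (Fin T → ℝ), ∀ xs : Fin T → X, IsL1Cover G ε xs V := by
  classical
  obtain ⟨F, hF⟩ := Metric.totallyBounded_iff.1
    (isCompact_Icc (a := (0 : ℝ)) (b := 1)).totallyBounded ε hε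
  refine ⟨Fintype.piFinset fun _ => hF.1.toFinset, fun xs g hg => ?_⟩
  have : ∀ t, ∃ y ∈ F, |g (xs t) - y| ≤ ε := by
    intro t
    have := hF.2 (h01 g hg (xs t))
    simp only [Set.mem_iUnion, Metric.mem_ball, Real.dist_eq] at this
    obtain ⟨y, hy, h⟩ := this
    exact ⟨y, hy, h.le⟩
  choose v hv hle using this
  refine ⟨v, by simpa using hv, ?_⟩
  rcases Nat.eq_zero_or_pos T with rfl | hT
  · simpa using hε.le
  · have hT' : (0 : ℝ) < T := by exact_mod_cast hT
    rw [one_div, inv_mul_le_iff₀ hT']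
    exact (Finset.sum_le_sum fun t _ => hle t).trans (by simp)

lemma one_le_coverNum {X : Type*} {T : ℕ} {G : Set (X → ℝ)} (hne : G.Nonempty) (ε : ℝ)
    (xs : Fin T → X) : 1 ≤ coverNum G ε xs := by
  refine le_iInf₂ fun V hV => ?_
  obtain ⟨g, hg⟩ := hne
  obtain ⟨v, hv, -⟩ := hV g hg
  exact_mod_cast Finset.card_pos.2 ⟨v, hv⟩

lemma coverNum_le_ncard {X : Type*} {T : ℕ} {G : Set (X → ℝ)} (hG : G.Finite) {ε : ℝ}
    (hε : 0 ≤ ε) (xs : Fin T → X) : coverNum G ε xs ≤ G.ncard := by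
  classical
  have hcov : IsL1Cover G ε xs (hG.toFinset.image fun (g : X → ℝ) t => g (xs t)) :=
    fun g hg => ⟨fun t => g (xs t),
      Finset.mem_image_of_mem (fun (g : X → ℝ) t => g (xs t)) (by simpa using hg),
      by simpa using hε⟩
  refine (iInf₂_le _ hcov).trans ?_
  rw [Set.ncard_eq_toFinset_card G hG]
  exact_mod_cast Finset.card_image_le

lemma lintegral_coverNum_ne_top {X : Type*} {T : ℕ} [MeasurableSpace X] {G : Set (X → ℝ)}
    (h01 : ∀ g ∈ G, ∀ x, g x ∈ Set.Icc (0 : ℝ) 1) {ε : ℝ} (hε : 0 < ε)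
    (ν : Measure (Fin T → X)) [IsFiniteMeasure ν] : ∫⁻ xs, coverNum G ε xs ∂ν ≠ ⊤ := by
  obtain ⟨V, hV⟩ := exists_uniform_l1Cover (T := T) h01 hε
  refine ne_top_of_le_ne_top (b := ∫⁻ _, (V.card : ℝ≥0∞) ∂ν) ?_
    (lintegral_mono fun xs => iInf₂_le V (hV xs))
  simp [ENNReal.mul_eq_top]

/-- The points space splits measurably into countably many pieces, each of which comes with a
rational cover, so that the expected size of the cover is at most the expected covering number. -/
lemma exists_cover_partition {X : Type*} [MeasurableSpace X] {T : ℕ} (hT : 0 < T)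
    {G : Set (X → ℝ)} (hG : IsBaseClass G) (hsep : PointwiseSeparable G) {ε : ℝ} (hε : 0 < ε) :
    ∃ B : Finset (Fin T → ℚ) → Set (Fin T → X), (∀ V, MeasurableSet (B V)) ∧
      (∀ xs, ∃ V, xs ∈ B V) ∧ (∀ V, B V ⊆ ratCover G (2 * ε * T) V) ∧
      ∀ xs, ∑' V, (B V).indicator (fun _ => (V.card : ℝ≥0∞)) xs ≤ coverNum G ε xs := by
  classical
  have h01 : ∀ g ∈ G, ∀ x, g x ∈ Set.Icc (0 : ℝ) 1 := fun g hg => (hG g hg).2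
  obtain ⟨G₀, hsub, hcount, hdense⟩ := hsep
  let _ : Encodable (Finset (Fin T → ℚ)) := Encodable.ofCountable _
  -- Lexicographic order: cardinality first, so that the selected cover is a smallest one, then an
  -- encoding, so that it is unique. The piece of `V` consists of the points where `V` is the least
  -- cover in this order.
  let key : Finset (Fin T → ℚ) → ℕ ×ₗ ℕ := fun V => toLex (V.card, Encodable.encode V)
  have hinj : Function.Injective key := fun V W h =>
    Encodable.encode_injective (Prod.ext_iff.1 (toLex.injective h)).2
  let R : Finset (Fin T → ℚ) → Set (Fin T → X) := ratCover G (2 * ε * T)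
  have hR : ∀ V, MeasurableSet (R V) := fun V => by
    simp only [R, ratCover_eq_of_dense hsub hdense]
    exact measurableSet_ratCover hcount (fun g hg => (hG g (hsub hg)).1) _ _
  refine ⟨fun V => R V \ ⋃ W ∈ {W | key W < key V}, R W, fun V => ?_, fun xs => ?_,
    fun V => Set.sdiff_subset, fun xs => ?_⟩
  · exact (hR V).diff (MeasurableSet.biUnion (Set.to_countable _) fun W _ => hR W)
  · obtain ⟨V₀, hV₀⟩ := exists_uniform_l1Cover (T := T) h01 hε
    obtain ⟨W₀, hW₀, -⟩ := exists_ratCover_of_isL1Cover hT h01 hε (hV₀ xs)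
    have hwf : WellFounded fun V W : Finset (Fin T → ℚ) => key V < key W :=
      InvImage.wf key wellFounded_lt
    obtain ⟨V, hV, hmin⟩ := hwf.has_min {V | xs ∈ R V} ⟨W₀, hW₀⟩
    refine ⟨V, hV, ?_⟩
    simp only [Set.mem_iUnion, Set.mem_ofPred_eq, not_exists]
    exact fun W hlt hW => hmin W hW hlt
  · refine le_iInf₂ fun U hU => ?_
    obtain ⟨W, hW, hcard⟩ := exists_ratCover_of_isL1Cover hT h01 hε hU
    have hmem : ∀ V, xs ∈ R V \ ⋃ W ∈ {W | key W < key V}, R W →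
        ∀ W, xs ∈ R W → key V ≤ key W := by
      intro V hV W hW
      by_contra hlt
      refine hV.2 ?_
      simp only [Set.mem_iUnion, Set.mem_ofPred_eq]
      exact ⟨W, not_le.1 hlt, hW⟩
    by_cases hex : ∃ V, xs ∈ R V \ ⋃ W ∈ {W | key W < key V}, R W
    · obtain ⟨V, hV⟩ := hex
      rw [tsum_eq_single V]
      · rw [Set.indicator_of_mem hV]
        have h1 : V.card ≤ W.card := by
          have := hmem V hV W hW
          rcases Prod.Lex.toLex_le_toLex.1 this with h | h
          · exact h.le
          · exact h.1.le
        exact_mod_cast h1.trans hcard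
      · intro V' hne
        refine Set.indicator_of_notMem (fun hV' => hne (hinj ?_)) _
        exact le_antisymm (hmem V' hV' V hV.1) (hmem V hV V' hV'.1)
    · push Not at hex
      rw [ENNReal.tsum_eq_zero.2 fun V => Set.indicator_of_notMem (hex V) _]
      exact zero_le

lemma mul_abs_le_of_mem_Icc {a b p : ℝ} (ha : a ∈ Set.Icc (0 : ℝ) 1) (hb : b ∈ Set.Icc (0 : ℝ) 1)
    (hp : p ∈ Set.Icc (0 : ℝ) 1) : |(a - p) ^ 2 - (b - p) ^ 2| ≤ 2 * |a - b| := by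
  have : (a - p) ^ 2 - (b - p) ^ 2 = (a + b - 2 * p) * (a - b) := by ring
  rw [this, abs_mul]
  refine mul_le_mul_of_nonneg_right ?_ (abs_nonneg _)
  obtain ⟨a0, a1⟩ := ha
  obtain ⟨b0, b1⟩ := hb
  obtain ⟨p0, p1⟩ := hp
  rw [abs_le]
  constructor <;> linarith

end RegCB

namespace RegCB

/-! ### Symmetrization -/

/-- Averaging over all swaps of the two samples kills the exponential moment. -/
lemma sum_swap_exp_le {T : ℕ} (I : Finset (Fin T)) (A B : Fin T → ℝ)
    (hA : ∀ i, A i ∈ Set.Icc (0 : ℝ) 1) (hB : ∀ i, B i ∈ Set.Icc (0 : ℝ) 1) :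
    ∑ σ : Fin T → Bool,
      Real.exp (1 / 8 * ∑ i ∈ I, (if σ i then A i - 3 * B i else B i - 3 * A i)) ≤ 2 ^ T := by
  classical
  let f : Fin T → Bool → ℝ := fun i b =>
    if i ∈ I then Real.exp (1 / 8 * (if b then A i - 3 * B i else B i - 3 * A i)) else 1
  have h1 : ∀ σ : Fin T → Bool,
      Real.exp (1 / 8 * ∑ i ∈ I, (if σ i then A i - 3 * B i else B i - 3 * A i))
        = ∏ i, f i (σ i) := by
    intro σ
    rw [Finset.mul_sum, Real.exp_sum, Finset.prod_ite_mem, Finset.univ_inter]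
  simp only [h1]
  rw [← Fintype.prod_sum]
  have h2 : ∀ i, ∑ b, f i b ≤ 2 := by
    intro i
    simp only [f, Fintype.sum_bool]
    by_cases hi : i ∈ I
    · obtain ⟨a0, a1⟩ := hA i
      obtain ⟨b0, b1⟩ := hB i
      simp only [hi, if_true, Bool.false_eq_true, if_false]
      -- The factor `3` creates a negative drift: the two linear terms add up to `-(A i + B i) / 4`,
      -- while the two squares add up to at most `10 (A i + B i) / 64`, because the values lie in
      -- the unit interval.
      have e1 := exp_le_one_add_add_sq (u := 1 / 8 * (A i - 3 * B i))
        (by rw [abs_le]; constructor <;> linarith)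
      have e2 := exp_le_one_add_add_sq (u := 1 / 8 * (B i - 3 * A i))
        (by rw [abs_le]; constructor <;> linarith)
      nlinarith [mul_nonneg a0 b0]
    · simp only [hi, if_false]; norm_num
  have h3 : ∀ i, 0 ≤ ∑ b, f i b := fun i => Finset.sum_nonneg fun b _ => by
    simp only [f]; split_ifs <;> positivity
  calc ∏ i, ∑ b, f i b ≤ ∏ _i : Fin T, (2 : ℝ) :=
        Finset.prod_le_prod (fun i _ => h3 i) fun i _ => h2 i
    _ = 2 ^ T := by simp

/-- The coordinatewise swap of two samples along `σ`. -/
def swapAlong {X : Type*} {T : ℕ} (σ : Fin T → Bool) (z : Fin T → X × X) : Fin T → X × X :=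
  fun i => if σ i then (z i).swap else z i

lemma measurePreserving_swapAlong {X : Type*} [MeasurableSpace X] {T : ℕ} (μ : Measure X)
    [IsProbabilityMeasure μ] (σ : Fin T → Bool) :
    MeasurePreserving (swapAlong (X := X) σ) (Measure.pi fun _ => μ.prod μ)
      (Measure.pi fun _ => μ.prod μ) := by
  refine measurePreserving_pi (fun _ => μ.prod μ) (fun _ => μ.prod μ)
    (f := fun i (w : X × X) => if σ i then w.swap else w) fun i => ?_
  by_cases h : σ i
  · simpa [h] using Measure.measurePreserving_swap (μ := μ) (ν := μ)
  · simp only [h, Bool.false_eq_true, if_false]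
    exact MeasurePreserving.id _

/-- The exponential gap between the sums of `h g` over a ghost sample and over the sample. -/
noncomputable def ghostGap {X : Type*} {T : ℕ} (I : Finset (Fin T)) (h : (X → ℝ) → X → ℝ)
    (G₀ : Set (X → ℝ)) (z : Fin T → X × X) : ℝ≥0∞ :=
  ⨆ g ∈ G₀, ENNReal.ofReal (Real.exp
    (1 / 8 * (∑ i ∈ I, h g (z i).2 - 3 * ∑ i ∈ I, h g (z i).1)))

/-- Replacing `g` by one cover vector per sample costs `exp (3ρ/2)`, and the supremum becomes a sum
over pairs of vectors. The covers belong to the unswapped samples, so for each pair the sum over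
swaps can be taken first and falls under `sum_swap_exp_le`. -/
lemma sum_ghostGap_swapAlong_le {X : Type*} {T : ℕ} (I : Finset (Fin T)) {G₀ : Set (X → ℝ)}
    (h01 : ∀ g ∈ G₀, ∀ x, g x ∈ Set.Icc (0 : ℝ) 1) {q φ : X → ℝ}
    (hq : ∀ x, q x ∈ Set.Icc (0 : ℝ) 1) (hφ : ∀ x, φ x ∈ Set.Icc (0 : ℝ) 1) {ρ : ℝ}
    (z : Fin T → X × X) {V W : Finset (Fin T → ℚ)}
    (hV : (fun i => (z i).1) ∈ ratCover G₀ ρ V) (hW : (fun i => (z i).2) ∈ ratCover G₀ ρ W) :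
    ∑ σ : Fin T → Bool, ghostGap I (fun g x => q x * (g x - φ x) ^ 2) G₀ (swapAlong σ z)
      ≤ 2 ^ T * (ENNReal.ofReal (Real.exp (3 / 2 * ρ)) * (V.card * W.card)) := by
  classical
  let A : (Fin T → ℚ) → Fin T → ℝ := fun v i => q (z i).1 * (v i - φ (z i).1) ^ 2
  let B : (Fin T → ℚ) → Fin T → ℝ := fun w i => q (z i).2 * (w i - φ (z i).2) ^ 2
  have unit : ∀ {a b c : ℝ}, a ∈ Set.Icc (0 : ℝ) 1 → b ∈ Set.Icc (0 : ℝ) 1 →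
      c ∈ Set.Icc (0 : ℝ) 1 → a * (b - c) ^ 2 ∈ Set.Icc (0 : ℝ) 1 := by
    rintro a b c ⟨a0, a1⟩ ⟨b0, b1⟩ ⟨c0, c1⟩
    have : (b - c) ^ 2 ≤ 1 := by
      rw [sq_le_one_iff_abs_le_one, abs_le]; constructor <;> linarith
    exact ⟨by positivity, mul_le_one₀ a1 (sq_nonneg _) this⟩
  have pt : ∀ σ : Fin T → Bool,
      ghostGap I (fun g x => q x * (g x - φ x) ^ 2) G₀ (swapAlong σ z)
        ≤ ∑ v ∈ V, ∑ w ∈ W, ENNReal.ofReal (Real.exp (3 / 2 * ρ)) * ENNReal.ofReal (Real.exp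
          (1 / 8 * ∑ i ∈ I, (if σ i then A v i - 3 * B w i else B w i - 3 * A v i))) := by
    intro σ
    refine iSup₂_le fun g hg => ?_
    obtain ⟨v, hv, hvρ⟩ := hV.2 g hg
    obtain ⟨w, hw, hwρ⟩ := hW.2 g hg
    refine le_trans ?_ (Finset.single_le_sum (f := fun v => ∑ w ∈ W, _) (fun _ _ => zero_le) hv)
    refine le_trans ?_ (Finset.single_le_sum (f := fun w => _) (fun _ _ => zero_le) hw)
    rw [← ENNReal.ofReal_mul (Real.exp_pos _).le, ← Real.exp_add]
    refine ENNReal.ofReal_le_ofReal (Real.exp_le_exp.2 ?_)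
    have hqle : ∀ {a b p c : ℝ}, c ∈ Set.Icc (0 : ℝ) 1 → a ∈ Set.Icc (0 : ℝ) 1 →
        b ∈ Set.Icc (0 : ℝ) 1 → p ∈ Set.Icc (0 : ℝ) 1 →
        |c * (a - p) ^ 2 - c * (b - p) ^ 2| ≤ 2 * |a - b| := by
      intro a b p c hc ha hb hp
      rw [← mul_sub, abs_mul, abs_of_nonneg hc.1]
      exact (mul_le_of_le_one_left (abs_nonneg _) hc.2).trans (mul_abs_le_of_mem_Icc ha hb hp)
    -- Each weighted square moves by at most twice the cover deviation, and one of the two carries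
    -- the factor `3`; hence `6`.
    have hterm : ∀ i, q (swapAlong σ z i).2 * (g (swapAlong σ z i).2 - φ (swapAlong σ z i).2) ^ 2
        - 3 * (q (swapAlong σ z i).1 * (g (swapAlong σ z i).1 - φ (swapAlong σ z i).1) ^ 2)
        ≤ (if σ i then A v i - 3 * B w i else B w i - 3 * A v i)
          + 6 * (|g (z i).1 - v i| + |g (z i).2 - w i|) := by
      intro i
      have h1 := abs_le.1 (hqle (hq (z i).1) (h01 g hg (z i).1) (hV.1 v hv i) (hφ (z i).1))
      have h2 := abs_le.1 (hqle (hq (z i).2) (h01 g hg (z i).2) (hW.1 w hw i) (hφ (z i).2))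
      have n1 := abs_nonneg (g (z i).1 - v i)
      have n2 := abs_nonneg (g (z i).2 - w i)
      by_cases h : σ i
      · simp only [swapAlong, h, if_true, Prod.fst_swap, Prod.snd_swap, A, B]
        linarith [h1.1, h1.2, h2.1, h2.2]
      · simp only [swapAlong, h, A, B, Bool.false_eq_true, if_false]
        linarith [h1.1, h1.2, h2.1, h2.2]
    rw [Finset.mul_sum, ← Finset.sum_sub_distrib]
    have hsum := Finset.sum_le_sum fun i (_ : i ∈ I) => hterm i
    rw [Finset.sum_add_distrib, ← Finset.mul_sum, Finset.sum_add_distrib] at hsum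
    have hI1 : ∑ i ∈ I, |g (z i).1 - v i| ≤ ρ :=
      (Finset.sum_le_sum_of_subset_of_nonneg (Finset.subset_univ I)
        fun _ _ _ => abs_nonneg _).trans hvρ
    have hI2 : ∑ i ∈ I, |g (z i).2 - w i| ≤ ρ :=
      (Finset.sum_le_sum_of_subset_of_nonneg (Finset.subset_univ I)
        fun _ _ _ => abs_nonneg _).trans hwρ
    linarith
  calc ∑ σ : Fin T → Bool, ghostGap I (fun g x => q x * (g x - φ x) ^ 2) G₀ (swapAlong σ z)
      ≤ ∑ σ : Fin T → Bool, ∑ v ∈ V, ∑ w ∈ W, ENNReal.ofReal (Real.exp (3 / 2 * ρ)) *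
          ENNReal.ofReal (Real.exp
          (1 / 8 * ∑ i ∈ I, (if σ i then A v i - 3 * B w i else B w i - 3 * A v i))) :=
        Finset.sum_le_sum fun σ _ => pt σ
    _ = ∑ v ∈ V, ∑ w ∈ W, ENNReal.ofReal (Real.exp (3 / 2 * ρ)) * ENNReal.ofReal
          (∑ σ : Fin T → Bool, Real.exp
          (1 / 8 * ∑ i ∈ I, (if σ i then A v i - 3 * B w i else B w i - 3 * A v i))) := by
        rw [Finset.sum_comm]
        refine Finset.sum_congr rfl fun v _ => ?_
        rw [Finset.sum_comm]
        refine Finset.sum_congr rfl fun w _ => ?_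
        rw [← Finset.mul_sum, ENNReal.ofReal_sum_of_nonneg fun _ _ => (Real.exp_pos _).le]
    _ ≤ ∑ v ∈ V, ∑ w ∈ W, ENNReal.ofReal (Real.exp (3 / 2 * ρ)) * 2 ^ T := by
        refine Finset.sum_le_sum fun v hv => Finset.sum_le_sum fun w hw => ?_
        gcongr
        have := sum_swap_exp_le I (A v) (B w) (fun i => unit (hq _) (hV.1 v hv i) (hφ _))
          (fun i => unit (hq _) (hW.1 w hw i) (hφ _))
        refine (ENNReal.ofReal_le_ofReal this).trans ?_
        simp [ENNReal.ofReal_pow]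
    _ = _ := by
        simp only [Finset.sum_const, nsmul_eq_mul]
        ring

lemma measurable_ghostGap {X : Type*} [MeasurableSpace X] {T : ℕ} (I : Finset (Fin T))
    {h : (X → ℝ) → X → ℝ} {G₀ : Set (X → ℝ)} (hc : G₀.Countable)
    (hm : ∀ g ∈ G₀, Measurable (h g)) : Measurable (ghostGap (T := T) I h G₀) := by
  refine Measurable.biSup _ hc fun g hg => ?_
  refine ((Measurable.const_mul ?_ _).exp).ennreal_ofReal
  have h1 : ∀ i, Measurable fun z : Fin T → X × X => (z i) := fun i => measurable_pi_apply i
  exact (Finset.measurable_sum _ fun i _ => (hm g hg).comp (h1 i).snd).sub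
    ((Finset.measurable_sum _ fun i _ => (hm g hg).comp (h1 i).fst).const_mul _)

/-- Swaps preserve the joint law of the two samples, so the integral equals its average over all `2
^ T` swaps. That average is bounded by the product of the cover sizes of two independent samples,
whence the square. -/
lemma lintegral_ghostGap_le {X : Type*} [MeasurableSpace X] {T : ℕ} (hT : 0 < T)
    (μ : Measure X) [IsProbabilityMeasure μ] (I : Finset (Fin T)) {G G₀ : Set (X → ℝ)}
    (hG : IsBaseClass G) (hsep : PointwiseSeparable G) (hsub : G₀ ⊆ G) (hc : G₀.Countable)
    {q φ : X → ℝ} (hqm : Measurable q) (hφm : Measurable φ)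
    (hq : ∀ x, q x ∈ Set.Icc (0 : ℝ) 1) (hφ : ∀ x, φ x ∈ Set.Icc (0 : ℝ) 1) {ε : ℝ}
    (hε : 0 < ε) :
    ∫⁻ z, ghostGap I (fun g x => q x * (g x - φ x) ^ 2) G₀ z ∂Measure.pi (fun _ => μ.prod μ)
      ≤ ENNReal.ofReal (Real.exp (3 * ε * T)) *
        (∫⁻ xs, coverNum G ε xs ∂Measure.pi (fun _ : Fin T => μ)) ^ 2 := by
  classical
  obtain ⟨B, hBm, hBex, hBcov, hBsum⟩ := exists_cover_partition hT hG hsep hε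
  let Nh : (Fin T → X) → ℝ≥0∞ := fun xs =>
    ∑' V, (B V).indicator (fun _ => (V.card : ℝ≥0∞)) xs
  have hNm : Measurable Nh := Measurable.tsum fun V =>
    (measurable_const.indicator (hBm V))
  set h : (X → ℝ) → X → ℝ := fun g x => q x * (g x - φ x) ^ 2
  have hhm : ∀ g ∈ G₀, Measurable (h g) := fun g hg =>
    hqm.mul (((hG g (hsub hg)).1.sub hφm).pow_const _)
  have hΦ := measurable_ghostGap (T := T) I hc hhm
  have hpow : ∀ z, ∑ σ : Fin T → Bool, ghostGap I h G₀ (swapAlong σ z)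
      ≤ 2 ^ T * (ENNReal.ofReal (Real.exp (3 * ε * T)) *
        (Nh (fun i => (z i).1) * Nh (fun i => (z i).2))) := by
    intro z
    obtain ⟨V, hV⟩ := hBex fun i => (z i).1
    obtain ⟨W, hW⟩ := hBex fun i => (z i).2
    have hr : ∀ {xs V}, xs ∈ B V → xs ∈ ratCover G₀ (2 * ε * T) V := fun {xs V} hx =>
      ⟨(hBcov V hx).1, fun g hg => (hBcov V hx).2 g (hsub hg)⟩
    have hcard : ∀ {xs V}, xs ∈ B V → (V.card : ℝ≥0∞) ≤ Nh xs := fun {xs V} hx => by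
      refine le_trans ?_ (ENNReal.le_tsum V)
      rw [Set.indicator_of_mem hx]
    refine (sum_ghostGap_swapAlong_le I (fun g hg => (hG g (hsub hg)).2) hq hφ z
      (hr hV) (hr hW)).trans ?_
    rw [show 3 / 2 * (2 * ε * T) = 3 * ε * T by ring]
    gcongr
    · exact hcard hV
    · exact hcard hW
  have havg : 2 ^ T * ∫⁻ z, ghostGap I h G₀ z ∂Measure.pi (fun _ => μ.prod μ)
      = ∫⁻ z, ∑ σ : Fin T → Bool, ghostGap I h G₀ (swapAlong σ z)
        ∂Measure.pi (fun _ => μ.prod μ) := by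
    rw [lintegral_finsetSum (f := fun σ z => ghostGap I h G₀ (swapAlong σ z)) _
      fun σ _ => hΦ.comp (measurePreserving_swapAlong μ σ).measurable]
    simp only [(measurePreserving_swapAlong μ _).lintegral_comp hΦ]
    simp
  have hfub : ∫⁻ z : Fin T → X × X, Nh (fun i => (z i).1) * Nh (fun i => (z i).2)
      ∂Measure.pi (fun _ => μ.prod μ)
      = (∫⁻ xs, Nh xs ∂Measure.pi (fun _ : Fin T => μ)) ^ 2 := by
    have hmp := measurePreserving_arrowProdEquivProdArrow X X (Fin T) (fun _ => μ) (fun _ => μ)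
    rw [sq, ← lintegral_prod_mul hNm.aemeasurable hNm.aemeasurable]
    exact hmp.lintegral_comp ((hNm.comp measurable_fst).mul (hNm.comp measurable_snd))
  have htwo : (2 : ℝ≥0∞) ^ T ≠ 0 := by simp
  have htwo' : (2 : ℝ≥0∞) ^ T ≠ ⊤ := by simp
  rw [← ENNReal.mul_le_mul_iff_right htwo htwo', havg]
  have hmul : Measurable fun z : Fin T → X × X =>
      Nh (fun i => (z i).1) * Nh (fun i => (z i).2) := by
    refine (hNm.comp ?_).mul (hNm.comp ?_) <;>
    exact measurable_pi_lambda _ fun i => by fun_prop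
  calc _ ≤ ∫⁻ z, 2 ^ T * (ENNReal.ofReal (Real.exp (3 * ε * T)) *
        (Nh (fun i => (z i).1) * Nh (fun i => (z i).2))) ∂Measure.pi (fun _ => μ.prod μ) :=
        lintegral_mono hpow
    _ = 2 ^ T * (ENNReal.ofReal (Real.exp (3 * ε * T)) *
        (∫⁻ xs, Nh xs ∂Measure.pi (fun _ : Fin T => μ)) ^ 2) := by
        rw [lintegral_const_mul _ (hmul.const_mul _), lintegral_const_mul _ hmul, hfub]
    _ ≤ _ := by
        gcongr with xs
        exact hBsum xs

/-- The exponential gap between the means of `h g` and the sums over a sample. -/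
noncomputable def meanGap {X : Type*} [MeasurableSpace X] {T : ℕ} (μ : Measure X)
    (I : Finset (Fin T)) (h : (X → ℝ) → X → ℝ) (G₀ : Set (X → ℝ)) (xs : Fin T → X) : ℝ≥0∞ :=
  ⨆ g ∈ G₀, ENNReal.ofReal (Real.exp
    (1 / 8 * ((I.card : ℝ) * ∫ x, h g x ∂μ - 3 * ∑ i ∈ I, h g (xs i))))

lemma ofReal_integral_le_lintegral_ofReal {Ω : Type*} [MeasurableSpace Ω] {P : Measure Ω}
    {Z : Ω → ℝ} (hZ : Integrable Z P) :
    ENNReal.ofReal (∫ ω, Z ω ∂P) ≤ ∫⁻ ω, ENNReal.ofReal (Z ω) ∂P := by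
  rw [integral_eq_lintegral_pos_part_sub_lintegral_neg_part hZ]
  exact (ENNReal.ofReal_le_ofReal (sub_le_self _ ENNReal.toReal_nonneg)).trans
    ENNReal.ofReal_toReal_le

/-- Jensen through the tangent line of the exponential at the mean; the lower integral on the right
may be infinite. -/
lemma exp_integral_le {Ω : Type*} [MeasurableSpace Ω] {P : Measure Ω} [IsProbabilityMeasure P]
    {Z : Ω → ℝ} (hZ : Integrable Z P) :
    ENNReal.ofReal (Real.exp (∫ ω, Z ω ∂P)) ≤ ∫⁻ ω, ENNReal.ofReal (Real.exp (Z ω)) ∂P := by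
  set m := ∫ ω, Z ω ∂P
  have h1 : ∀ ω, Real.exp m * (1 + (Z ω - m)) ≤ Real.exp (Z ω) := by
    intro ω
    have h := Real.add_one_le_exp (Z ω - m)
    calc Real.exp m * (1 + (Z ω - m)) ≤ Real.exp m * Real.exp (Z ω - m) := by
          gcongr; linarith
      _ = Real.exp (Z ω) := by rw [← Real.exp_add]; ring_nf
  have h2 : Integrable (fun ω => Real.exp m * (1 + (Z ω - m))) P :=
    ((integrable_const _).add (hZ.sub (integrable_const _))).const_mul _
  have h3 : ∫ ω, Real.exp m * (1 + (Z ω - m)) ∂P = Real.exp m := by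
    have : (fun ω => 1 + (Z ω - m)) = fun ω => Z ω + (1 - m) := by funext ω; ring
    rw [integral_const_mul, this, integral_add hZ (integrable_const _)]
    simp [m]
  calc ENNReal.ofReal (Real.exp m)
      = ENNReal.ofReal (∫ ω, Real.exp m * (1 + (Z ω - m)) ∂P) := by rw [h3]
    _ ≤ ∫⁻ ω, ENNReal.ofReal (Real.exp m * (1 + (Z ω - m))) ∂P :=
        ofReal_integral_le_lintegral_ofReal h2
    _ ≤ _ := lintegral_mono fun ω => ENNReal.ofReal_le_ofReal (h1 ω)

/-- For each `g` the mean is an expectation over the ghost sample. Jensen moves it out of the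
exponential, and the supremum of integrals is at most the integral of the supremum. -/
lemma lintegral_meanGap_le {X : Type*} [MeasurableSpace X] {T : ℕ} (hT : 0 < T)
    (μ : Measure X) [IsProbabilityMeasure μ] (I : Finset (Fin T)) {G G₀ : Set (X → ℝ)}
    (hG : IsBaseClass G) (hsep : PointwiseSeparable G) (hsub : G₀ ⊆ G) (hc : G₀.Countable)
    {q φ : X → ℝ} (hqm : Measurable q) (hφm : Measurable φ)
    (hq : ∀ x, q x ∈ Set.Icc (0 : ℝ) 1) (hφ : ∀ x, φ x ∈ Set.Icc (0 : ℝ) 1) {ε : ℝ}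
    (hε : 0 < ε) :
    ∫⁻ xs, meanGap μ I (fun g x => q x * (g x - φ x) ^ 2) G₀ xs ∂Measure.pi (fun _ => μ)
      ≤ ENNReal.ofReal (Real.exp (3 * ε * T)) *
        (∫⁻ xs, coverNum G ε xs ∂Measure.pi (fun _ : Fin T => μ)) ^ 2 := by
  refine le_trans ?_ (lintegral_ghostGap_le hT μ I hG hsep hsub hc hqm hφm hq hφ hε)
  set h : (X → ℝ) → X → ℝ := fun g x => q x * (g x - φ x) ^ 2
  have hhm : ∀ g ∈ G₀, Measurable (h g) := fun g hg =>
    hqm.mul (((hG g (hsub hg)).1.sub hφm).pow_const _)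
  have hh01 : ∀ g ∈ G₀, ∀ x, ‖h g x‖ ≤ 1 := by
    intro g hg x
    obtain ⟨q0, q1⟩ := hq x
    obtain ⟨g0, g1⟩ := (hG g (hsub hg)).2 x
    obtain ⟨p0, p1⟩ := hφ x
    have : (g x - φ x) ^ 2 ≤ 1 := by
      rw [sq_le_one_iff_abs_le_one, abs_le]; constructor <;> linarith
    rw [Real.norm_eq_abs, abs_of_nonneg (by positivity)]
    exact mul_le_one₀ q1 (sq_nonneg _) this
  have hmp := measurePreserving_arrowProdEquivProdArrow X X (Fin T) (fun _ => μ) (fun _ => μ)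
  let Φ : (Fin T → X) × (Fin T → X) → ℝ≥0∞ := fun p => ghostGap I h G₀ fun i => (p.1 i, p.2 i)
  have hΦ : Measurable Φ := (measurable_ghostGap (T := T) I hc hhm).comp
    (measurable_pi_lambda _ fun i => by fun_prop)
  have e1 : ∫⁻ z, ghostGap I h G₀ z ∂Measure.pi (fun _ => μ.prod μ)
      = ∫⁻ p, Φ p ∂(Measure.pi fun _ => μ).prod (Measure.pi fun _ => μ) :=
    hmp.lintegral_comp hΦ
  rw [e1, lintegral_prod _ hΦ.aemeasurable]
  refine lintegral_mono fun xs => ?_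
  refine iSup₂_le fun g hg => ?_
  have hint : ∀ i, Integrable (fun y : Fin T → X => h g (y i)) (Measure.pi fun _ => μ) := fun i =>
    Integrable.of_bound ((hhm g hg).comp (measurable_pi_apply i)).aestronglyMeasurable 1
      (Eventually.of_forall fun y => hh01 g hg _)
  let Z : (Fin T → X) → ℝ := fun y => 1 / 8 * (∑ i ∈ I, h g (y i) - 3 * ∑ i ∈ I, h g (xs i))
  have hZ : Integrable Z (Measure.pi fun _ => μ) :=
    ((integrable_finsetSum _ fun i _ => hint i).sub (integrable_const _)).const_mul _
  have hZm : ∫ y, Z y ∂Measure.pi (fun _ => μ)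
      = 1 / 8 * ((I.card : ℝ) * ∫ x, h g x ∂μ - 3 * ∑ i ∈ I, h g (xs i)) := by
    rw [integral_const_mul, integral_sub (integrable_finsetSum _ fun i _ => hint i)
      (integrable_const _), integral_finsetSum _ fun i _ => hint i]
    simp only [integral_comp_eval (μ := fun _ : Fin T => μ) (hhm g hg).aestronglyMeasurable]
    simp
  rw [← hZm]
  refine (exp_integral_le hZ).trans (lintegral_mono fun y => ?_)
  exact le_iSup₂_of_le g hg le_rfl

end RegCB

namespace RegCB

/-! ### Product classes with attained extrema -/

section ProductClass

variable {X : Type*} {K : ℕ} {S : Fin K → Set (X → ℝ)}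

/-- In a product class one component can be prescribed freely as long as the other factors are
nonempty. -/
lemma image_productClass (hne : ∀ c, (S c).Nonempty) (x : X) (a : Fin K) :
    (fun f : X → Fin K → ℝ => f x a) '' productClass S = (fun g => g x) '' S a := by
  classical
  ext y
  constructor
  · rintro ⟨f, hf, rfl⟩
    exact ⟨_, hf a, rfl⟩
  · rintro ⟨g, hg, rfl⟩
    choose e he using hne
    refine ⟨fun x c => if c = a then g x else e c x, fun c => ?_, by simp⟩
    by_cases h : c = a
    · subst h; simpa using hg
    · simpa [h] using he c

lemma bddAbove_image_productClass (h01 : ∀ c, ∀ g ∈ S c, ∀ x, g x ∈ Set.Icc (0 : ℝ) 1) (x : X)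
    (a : Fin K) : BddAbove ((fun f : X → Fin K → ℝ => f x a) '' productClass S) := by
  refine ⟨1, ?_⟩
  rintro _ ⟨f, hf, rfl⟩
  exact (h01 a _ (hf a) x).2

lemma bddBelow_image_productClass (h01 : ∀ c, ∀ g ∈ S c, ∀ x, g x ∈ Set.Icc (0 : ℝ) 1) (x : X)
    (a : Fin K) : BddBelow ((fun f : X → Fin K → ℝ => f x a) '' productClass S) := by
  refine ⟨0, ?_⟩
  rintro _ ⟨f, hf, rfl⟩
  exact (h01 a _ (hf a) x).1

lemma low_le_high_iff (h01 : ∀ c, ∀ g ∈ S c, ∀ x, g x ∈ Set.Icc (0 : ℝ) 1) {x : X}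
    (hatt : ∀ c, (∃ g ∈ S c, ∀ g' ∈ S c, g' x ≤ g x) ∧ ∃ g ∈ S c, ∀ g' ∈ S c, g x ≤ g' x)
    (a a' : Fin K) :
    low (productClass S) x a' ≤ high (productClass S) x a ↔
      ∃ g ∈ S a, ∃ g' ∈ S a', g' x ≤ g x := by
  have hne : ∀ c, (S c).Nonempty := fun c => (hatt c).1.imp fun g h => h.1
  have hA := bddAbove_image_productClass h01 x a
  have hB := bddBelow_image_productClass h01 x a'
  unfold low high
  rw [image_productClass hne] at hA hB ⊢
  rw [image_productClass hne]
  constructor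
  · intro h
    obtain ⟨g, hg, hmax⟩ := (hatt a).1
    obtain ⟨g', hg', hmin⟩ := (hatt a').2
    refine ⟨g, hg, g', hg', ?_⟩
    calc g' x ≤ sInf ((fun g => g x) '' S a') :=
          le_csInf ((hne a').image _) (by rintro _ ⟨k, hk, rfl⟩; exact hmin k hk)
      _ ≤ sSup ((fun g => g x) '' S a) := h
      _ ≤ g x := csSup_le ((hne a).image _) (by rintro _ ⟨k, hk, rfl⟩; exact hmax k hk)
  · rintro ⟨g, hg, g', hg', hle⟩
    exact (csInf_le hB ⟨g', hg', rfl⟩).trans (hle.trans (le_csSup hA ⟨g, hg, rfl⟩))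

/-- The plausible actions are the maximizing actions of the members of the product class. -/
lemma forall_low_le_high_iff_exists_argmax
    (h01 : ∀ c, ∀ g ∈ S c, ∀ x, g x ∈ Set.Icc (0 : ℝ) 1) {x : X}
    (hatt : ∀ c, (∃ g ∈ S c, ∀ g' ∈ S c, g' x ≤ g x) ∧ ∃ g ∈ S c, ∀ g' ∈ S c, g x ≤ g' x)
    (a : Fin K) :
    (∀ a', low (productClass S) x a' ≤ high (productClass S) x a) ↔
      ∃ f ∈ productClass S, a ∈ argmaxSet f x := by
  classical
  simp only [low_le_high_iff h01 hatt]
  constructor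
  · intro h
    obtain ⟨gmax, hgmax, hmax⟩ := (hatt a).1
    choose gmin hgmin hmin using fun c => (hatt c).2
    -- The member most favourable to `a`: largest at `a`, smallest at every other action.
    refine ⟨fun x c => if c = a then gmax x else gmin c x, fun c => ?_, fun b => ?_⟩
    · by_cases hc : c = a
      · subst hc; simpa using hgmax
      · simpa [hc] using hgmin c
    · obtain ⟨g, hg, g', hg', hle⟩ := h b
      by_cases hb : b = a
      · simp [hb]
      · simpa [hb] using (hmin b g' hg').trans (hle.trans (hmax g hg))
  · rintro ⟨f, hf, hmem⟩ a'
    exact ⟨_, hf a, _, hf a', hmem a'⟩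

end ProductClass

/-! ### Version spaces -/

section VersionSpace

variable {X : Type*} {K : ℕ} {G : Set (X → ℝ)}

lemma epochStart_epochOf_le {t : ℕ} (ht : 1 ≤ t) : epochStart (epochOf t) ≤ t := by
  simpa [epochStart, epochOf] using Nat.pow_log_le_self 2 (by omega : t ≠ 0)

lemma empLoss_congr {d d' : ℕ → X × Fin K × ℝ} {m : ℕ}
    (h : ∀ s ∈ Finset.Ico 1 (epochStart m), d s = d' s) (a : Fin K) :
    empLoss d m a = empLoss d' m a := by
  funext g
  unfold empLoss
  congr 1
  exact Finset.sum_congr rfl fun s hs => by rw [h s hs]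

lemma versionSpace_congr {d d' : ℕ → X × Fin K × ℝ} {m : ℕ}
    (h : ∀ s ∈ Finset.Ico 1 (epochStart m), d s = d' s) (β : ℝ) :
    versionSpace G d m β = versionSpace G d' m β := by
  funext a
  unfold versionSpace
  rw [empLoss_congr h]

lemma activeSet_congr {T : ℕ} {C : ℝ} {d d' : ℕ → X × Fin K × ℝ} {t : ℕ}
    (h : ∀ s ∈ Finset.Ico 1 (epochStart (epochOf t)), d s = d' s) (x : X) :
    activeSet G T C d t x = activeSet G T C d' t x := by
  unfold activeSet plausibleSet
  rw [versionSpace_congr h]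

lemma activeSet_eq_of_epochOf_eq {T : ℕ} {C : ℝ} {d : ℕ → X × Fin K × ℝ} {t t' : ℕ}
    (h : epochOf t = epochOf t') (x : X) : activeSet G T C d t x = activeSet G T C d t' x := by
  unfold activeSet
  rw [h]

lemma epochOf_mono {t T : ℕ} (h : t ≤ T) : epochOf t ≤ epochOf T := by
  unfold epochOf
  have := Nat.log_mono_right (b := 2) h
  omega

lemma one_lt_epochStart {m : ℕ} (hm : 2 ≤ m) : 1 < epochStart m :=
  Nat.one_lt_two_pow (by omega)

lemma tolerance_pos {T m : ℕ} {C : ℝ} (hC : 0 < C) (hm : 2 ≤ m) (hmT : m ≤ epochOf T) :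
    0 < tolerance T C m := by
  unfold tolerance
  have h1 : (m : ℝ) ≤ epochOf T := by exact_mod_cast hmT
  have h2 : (1 : ℝ) < epochStart m := by exact_mod_cast one_lt_epochStart hm
  refine div_pos (mul_pos ?_ hC) ?_ <;> linarith

lemma epoch_cases {T t : ℕ} {C : ℝ} (hC : 0 < C) (htT : t ≤ T) :
    1 ≤ epochOf t ∧ (epochOf t = 1 ∨ 0 < tolerance T C (epochOf t)) := by
  have h1 : 1 ≤ epochOf t := by simp [epochOf]
  refine ⟨h1, ?_⟩
  rcases h1.eq_or_lt with h | h
  · exact Or.inl h.symm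
  · exact Or.inr (tolerance_pos hC h (epochOf_mono htT))

/-- With the infimum written as an attained minimum, membership becomes a finite combination of
comparisons between losses, which is visibly measurable in the data. -/
lemma mem_versionSpace_iff_of_finite (hG : G.Finite) {d : ℕ → X × Fin K × ℝ} {m : ℕ} {β : ℝ}
    {a : Fin K} {g : X → ℝ} :
    g ∈ versionSpace G d m β a ↔
      g ∈ G ∧ (m = 1 ∨ ∃ g' ∈ G, empLoss d m a g - empLoss d m a g' ≤ β ∧
        ∀ k ∈ G, empLoss d m a g' ≤ empLoss d m a k) := by
  refine and_congr_right fun hg => or_congr_right ?_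
  obtain ⟨g₀, hg₀, hmin⟩ := Set.exists_min_image G (empLoss d m a) hG ⟨g, hg⟩
  have hinf : sInf (empLoss d m a '' G) = empLoss d m a g₀ :=
    IsLeast.csInf_eq ⟨⟨g₀, hg₀, rfl⟩, by rintro _ ⟨k, hk, rfl⟩; exact hmin k hk⟩
  rw [hinf]
  constructor
  · exact fun h => ⟨g₀, hg₀, h, hmin⟩
  · rintro ⟨g', hg', h, hmin'⟩
    have := hmin' g₀ hg₀
    linarith

lemma versionSpace_nonempty_of_finite (hG : G.Finite) (hne : G.Nonempty)
    (d : ℕ → X × Fin K × ℝ) {m : ℕ} {β : ℝ} (h : m = 1 ∨ 0 < β) (a : Fin K) :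
    (versionSpace G d m β a).Nonempty := by
  obtain ⟨g₀, hg₀, hmin⟩ := Set.exists_min_image G (empLoss d m a) hG hne
  refine ⟨g₀, (mem_versionSpace_iff_of_finite hG).2 ⟨hg₀, h.imp id fun hβ => ?_⟩⟩
  exact ⟨g₀, hg₀, by simpa using hβ.le, hmin⟩

lemma attained_of_finite (hG : G.Finite) (hne : G.Nonempty)
    (d : ℕ → X × Fin K × ℝ) {m : ℕ} {β : ℝ} (h : m = 1 ∨ 0 < β) (a : Fin K) (x : X) :
    (∃ g ∈ versionSpace G d m β a, ∀ g' ∈ versionSpace G d m β a, g' x ≤ g x) ∧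
      (∃ g ∈ versionSpace G d m β a, ∀ g' ∈ versionSpace G d m β a, g x ≤ g' x) := by
  have hfin : (versionSpace G d m β a).Finite := hG.subset fun g hg => hg.1
  have hne' := versionSpace_nonempty_of_finite hG hne d h a
  obtain ⟨g, hg, h1⟩ := Set.exists_max_image _ (fun g : X → ℝ => g x) hfin hne'
  obtain ⟨g', hg', h2⟩ := Set.exists_min_image _ (fun g : X → ℝ => g x) hfin hne'
  exact ⟨⟨g, hg, h1⟩, ⟨g', hg', h2⟩⟩

variable [MeasurableSpace X]

lemma measurable_empLoss {g : X → ℝ} (hg : Measurable g) (m : ℕ) (a : Fin K) :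
    Measurable fun d : ℕ → X × Fin K × ℝ => empLoss d m a g := by
  unfold empLoss
  refine Measurable.const_mul (Finset.measurable_sum _ fun s _ => ?_) _
  have h1 : Measurable fun d : ℕ → X × Fin K × ℝ => d s := measurable_pi_apply s
  refine Measurable.ite (h1.snd.fst (measurableSet_singleton a)) ?_ measurable_const
  exact ((hg.comp h1.fst).sub h1.snd.snd).pow_const _

lemma measurableElimination_of_finite (hG : G.Finite) (hne : G.Nonempty) (hbase : IsBaseClass G) :
    MeasurableElimination K G := by
  intro m β hm hβ a
  have heq : {q : (ℕ → X × Fin K × ℝ) × X | a ∈ plausibleSet G q.1 m β q.2}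
      = ⋂ a', ⋃ g ∈ G, ⋃ g' ∈ G, {q | g ∈ versionSpace G q.1 m β a} ∩
        {q | g' ∈ versionSpace G q.1 m β a'} ∩ {q | g' q.2 ≤ g q.2} := by
    ext q
    simp only [Set.mem_ofPred_eq, plausibleSet, Set.mem_iInter, Set.mem_iUnion, Set.mem_inter_iff]
    refine forall_congr' fun a' => ?_
    rw [low_le_high_iff (fun c g hg => (hbase g hg.1).2)
      (fun c => attained_of_finite hG hne q.1 hβ c q.2)]
    constructor
    · rintro ⟨g, hg, g', hg', h⟩
      exact ⟨g, hg.1, g', hg'.1, ⟨hg, hg'⟩, h⟩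
    · rintro ⟨g, -, g', -, ⟨hg, hg'⟩, h⟩
      exact ⟨g, hg, g', hg', h⟩
  have hV : ∀ c : Fin K, ∀ g ∈ G,
      MeasurableSet {q : (ℕ → X × Fin K × ℝ) × X | g ∈ versionSpace G q.1 m β c} := by
    intro c g hg
    have : {q : (ℕ → X × Fin K × ℝ) × X | g ∈ versionSpace G q.1 m β c}
        = {_q | m = 1} ∪ ⋃ g' ∈ G, ({q | empLoss q.1 m c g - empLoss q.1 m c g' ≤ β} ∩
          ⋂ k ∈ G, {q | empLoss q.1 m c g' ≤ empLoss q.1 m c k}) := by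
      ext q
      simp [mem_versionSpace_iff_of_finite hG, hg, and_left_comm]
    rw [this]
    have hE : ∀ k ∈ G, Measurable fun q : (ℕ → X × Fin K × ℝ) × X => empLoss q.1 m c k :=
      fun k hk => (measurable_empLoss (hbase k hk).1 m c).comp measurable_fst
    refine (MeasurableSet.const _).union (MeasurableSet.biUnion hG.countable fun g' hg' => ?_)
    refine (measurableSet_le ((hE g hg).sub (hE g' hg')) measurable_const).inter ?_
    exact MeasurableSet.biInter hG.countable fun k hk => measurableSet_le (hE g' hg') (hE k hk)
  rw [heq]
  refine MeasurableSet.iInter fun a' => MeasurableSet.biUnion hG.countable fun g hg =>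
    MeasurableSet.biUnion hG.countable fun g' hg' => ?_
  refine ((hV a g hg).inter (hV a' g' hg')).inter (measurableSet_le ?_ ?_)
  · exact (hbase g' hg').1.comp measurable_snd
  · exact (hbase g hg).1.comp measurable_snd

/-- A finite class is its own countable dense subclass and attains all extrema, so finite and
infinite classes need not be distinguished afterwards. -/
lemma RegularClass.regular (h : RegularClass K G) (hne : G.Nonempty) (hbase : IsBaseClass G) :
    PointwiseSeparable G ∧ ExtremaAttained K G ∧ MeasurableElimination K G := by
  rcases h with hG | h
  · refine ⟨⟨G, subset_rfl, hG.countable, fun g hg => ⟨fun _ => g, fun _ => hg, fun x =>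
      tendsto_const_nhds⟩⟩, fun d _ m β _ hβ a x => attained_of_finite hG hne d hβ a x,
      measurableElimination_of_finite hG hne hbase⟩
  · exact h

end VersionSpace

end RegCB

namespace RegCB

/-! ### Histories as explicit sequences -/

/-- The data of a round: context, action, reward vector. -/
abbrev Round (X : Type*) (K : ℕ) := X × Fin K × (Fin K → ℝ)

/-- The data of the rounds `1, …, t - 1`, padded by `z₀`. -/
def past {X Ω : Type*} {K : ℕ} (z₀ : Round X K) (x : ℕ → Ω → X) (r : ℕ → Ω → Fin K → ℝ)
    (a : ℕ → Ω → Fin K) (t : ℕ) (ω : Ω) : ℕ → Round X K :=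
  fun s => if s ∈ Finset.Ico 1 t then (x s ω, a s ω, r s ω) else z₀

/-- What the algorithm sees of the data. -/
def obs {X : Type*} {K : ℕ} (h : ℕ → Round X K) : ℕ → X × Fin K × ℝ :=
  fun s => ((h s).1, (h s).2.1, (h s).2.2 (h s).2.1)

open Classical in
/-- The probability of playing `b` in round `t` on the context `x`, given the data `h`. -/
noncomputable def playProb {X : Type*} {K : ℕ} (G : Set (X → ℝ)) (T : ℕ) (C : ℝ)
    (h : ℕ → Round X K) (t : ℕ) (x : X) (b : Fin K) : ℝ :=
  Set.indicator (activeSet G T C (obs h) t x)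
    (fun _ => ((activeSet G T C (obs h) t x).ncard : ℝ)⁻¹) b

/-! ### Playing probabilities as functions of data and context -/

section PlayProb

variable {X : Type*} {K : ℕ} {G : Set (X → ℝ)} {T : ℕ} {C : ℝ}

lemma playProb_nonneg (h : ℕ → Round X K) (t : ℕ) (x : X) (b : Fin K) :
    0 ≤ playProb G T C h t x b :=
  Set.indicator_nonneg (fun _ _ => by positivity) _

/-- The sum is one unless the plausible set is empty, which is not excluded for arbitrary data; the
inequality suffices throughout. -/
lemma sum_playProb_le_one (h : ℕ → Round X K) (t : ℕ) (x : X) :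
    ∑ b, playProb G T C h t x b ≤ 1 := by
  classical
  unfold playProb
  set S := activeSet G T C (obs h) t x
  have : ∑ b, Set.indicator S (fun _ => ((S.ncard : ℝ))⁻¹) b
      = S.ncard * ((S.ncard : ℝ))⁻¹ := by
    simp only [Set.indicator_apply]
    rw [← Finset.sum_filter, Finset.sum_const, nsmul_eq_mul]
    congr
    rw [Set.ncard_eq_toFinset_card' S]
    congr 1
    ext b; simp
  rw [this]
  exact mul_inv_le_one

lemma playProb_le_one (h : ℕ → Round X K) (t : ℕ) (x : X) (b : Fin K) :
    playProb G T C h t x b ≤ 1 :=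
  (Finset.single_le_sum (fun c _ => playProb_nonneg h t x c) (Finset.mem_univ b)).trans
    (sum_playProb_le_one h t x)

lemma inv_le_playProb {h : ℕ → Round X K} {t : ℕ} {x : X} {b : Fin K}
    (hb : b ∈ activeSet G T C (obs h) t x) : (K : ℝ)⁻¹ ≤ playProb G T C h t x b := by
  unfold playProb
  rw [Set.indicator_of_mem hb]
  have h1 : (activeSet G T C (obs h) t x).ncard ≤ K := by
    simpa using Set.ncard_le_card (activeSet G T C (obs h) t x)
  have h2 : 0 < (activeSet G T C (obs h) t x).ncard := (Set.ncard_pos (Set.toFinite _)).2 ⟨b, hb⟩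
  exact inv_anti₀ (by exact_mod_cast h2) (by exact_mod_cast h1)

lemma playProb_of_notMem {h : ℕ → Round X K} {t : ℕ} {x : X} {b : Fin K}
    (hb : b ∉ activeSet G T C (obs h) t x) : playProb G T C h t x b = 0 :=
  Set.indicator_of_notMem hb _

variable [MeasurableSpace X]

lemma measurable_eval_action : Measurable fun p : Fin K × (Fin K → ℝ) => p.2 p.1 :=
  measurable_from_prod_countable_right fun b => measurable_pi_apply b

lemma measurable_obs : Measurable (obs : (ℕ → Round X K) → ℕ → X × Fin K × ℝ) := by
  refine measurable_pi_lambda _ fun s => ?_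
  have h1 : Measurable fun h : ℕ → Round X K => h s := measurable_pi_apply s
  exact h1.fst.prodMk (h1.snd.fst.prodMk (measurable_eval_action.comp h1.snd))

lemma measurableSet_mem_activeSet (hel : MeasurableElimination K G) (hC : 0 < C) {t : ℕ}
    (htT : t ≤ T) (b : Fin K) :
    MeasurableSet {q : (ℕ → Round X K) × X | b ∈ activeSet G T C (obs q.1) t q.2} := by
  have h := hel (epochOf t) (tolerance T C (epochOf t)) (epoch_cases hC htT).1
    (epoch_cases hC htT).2 b
  have hm : Measurable fun q : (ℕ → Round X K) × X => (obs q.1, q.2) :=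
    (measurable_obs.comp measurable_fst).prodMk measurable_snd
  have heq : {q : (ℕ → Round X K) × X | b ∈ activeSet G T C (obs q.1) t q.2}
      = (fun q : (ℕ → Round X K) × X => (obs q.1, q.2)) ⁻¹'
        {q | b ∈ plausibleSet G q.1 (epochOf t) (tolerance T C (epochOf t)) q.2} := by
    ext q
    simp only [activeSet, Set.mem_ofPred_eq, Set.mem_preimage]
  rw [heq]
  exact hm h

lemma measurable_playProb (hel : MeasurableElimination K G) (hC : 0 < C) {t : ℕ}
    (htT : t ≤ T) (b : Fin K) :
    Measurable fun q : (ℕ → Round X K) × X => playProb G T C q.1 t q.2 b := by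
  classical
  have hcard : Measurable fun q : (ℕ → Round X K) × X =>
      ((activeSet G T C (obs q.1) t q.2).ncard : ℝ) := by
    have : (fun q : (ℕ → Round X K) × X => ((activeSet G T C (obs q.1) t q.2).ncard : ℝ))
        = fun q => ∑ c, if c ∈ activeSet G T C (obs q.1) t q.2 then (1 : ℝ) else 0 := by
      funext q
      rw [Finset.sum_boole, Set.ncard_eq_toFinset_card']
      congr 2
      ext c; simp
    rw [this]
    exact Finset.measurable_sum _ fun c _ =>
      Measurable.ite (measurableSet_mem_activeSet hel hC htT c) measurable_const measurable_const
  unfold playProb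
  simp only [Set.indicator_apply]
  exact Measurable.ite (measurableSet_mem_activeSet hel hC htT b) hcard.inv measurable_const

end PlayProb

/-! ### The law of a round of a run -/

section Past

variable {X Ω : Type*} {K : ℕ} {z₀ : Round X K} {x : ℕ → Ω → X} {r : ℕ → Ω → Fin K → ℝ}
  {a : ℕ → Ω → Fin K}

lemma past_apply_of_mem {t s : ℕ} (hs : s ∈ Finset.Ico 1 t) (ω : Ω) :
    past z₀ x r a t ω s = (x s ω, a s ω, r s ω) := if_pos hs

lemma past_apply_of_notMem {t s : ℕ} (hs : s ∉ Finset.Ico 1 t) (ω : Ω) :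
    past z₀ x r a t ω s = z₀ := if_neg hs

/-- Data of earlier rounds, read off from the data of later ones. -/
lemma past_eq_past {t t' s : ℕ} (hs : s ∈ Finset.Ico 1 t) (htt' : t ≤ t') (ω : Ω) :
    past z₀ x r a t ω s = past z₀ x r a t' ω s := by
  have hs' : s ∈ Finset.Ico 1 t' := by
    rw [Finset.mem_Ico] at hs ⊢; omega
  rw [past_apply_of_mem hs, past_apply_of_mem hs']

/-- The plausible set reads only rounds before the start of the epoch of `t`, which is at most `t`,
so the padding is never seen. -/
lemma activeSet_obs_past {G : Set (X → ℝ)} {T : ℕ} {C : ℝ} {t : ℕ} (ht : 1 ≤ t) (ω : Ω)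
    (y : X) :
    activeSet G T C (obs (past z₀ x r a t ω)) t y
      = activeSet G T C (fun s => (x s ω, a s ω, r s ω (a s ω))) t y := by
  refine activeSet_congr (fun s hs => ?_) y
  have : s ∈ Finset.Ico 1 t := by
    have := epochStart_epochOf_le ht
    rw [Finset.mem_Ico] at hs ⊢; omega
  simp [obs, past_apply_of_mem this]

variable [MeasurableSpace X]

lemma measurable_past_history (t : ℕ) : Measurable[history x r a t] (past z₀ x r a t) := by
  refine @measurable_pi_lambda _ _ _ (history x r a t) _ _ fun s => ?_
  by_cases hs : s ∈ Finset.Ico 1 t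
  · have h1 : (fun ω => past z₀ x r a t ω s) = fun ω => (x s ω, a s ω, r s ω) :=
      funext fun ω => past_apply_of_mem hs ω
    rw [h1]
    refine Measurable.mono (comap_measurable _) ?_ le_rfl
    exact le_iSup₂_of_le (f := fun s (_ : s ∈ Finset.Ico 1 t) => MeasurableSpace.comap
      (fun ω => (x s ω, a s ω, r s ω)) inferInstance) s hs le_rfl
  · have h1 : (fun ω => past z₀ x r a t ω s) = fun _ => z₀ :=
      funext fun ω => past_apply_of_notMem hs ω
    rw [h1]
    exact measurable_const

variable [MeasurableSpace Ω] {D : Measure (X × (Fin K → ℝ))} {G : Set (X → ℝ)} {T : ℕ} {C : ℝ}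
  {P : Measure Ω}

lemma IsRun.history_le (hrun : IsRun D G T C P x r a) (t : ℕ) :
    history x r a t ≤ ‹MeasurableSpace Ω› :=
  iSup₂_le fun s _ => ((hrun.measurable_context s).prodMk
    ((hrun.measurable_action s).prodMk (hrun.measurable_reward s))).comap_le

lemma IsRun.measurable_past (hrun : IsRun D G T C P x r a) (t : ℕ) :
    Measurable (past z₀ x r a t) :=
  (measurable_past_history t).mono (hrun.history_le t) le_rfl

lemma IsRun.measurable_pair (hrun : IsRun D G T C P x r a) (t : ℕ) :
    Measurable fun ω => (x t ω, r t ω) :=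
  (hrun.measurable_context t).prodMk (hrun.measurable_reward t)

/-- The conditional law of the action, tested against nonnegative functions of the past and the
current pair; both generate the conditioning algebra up to which `B` is measurable. -/
lemma IsRun.lintegral_action_eq [IsProbabilityMeasure P] (hrun : IsRun D G T C P x r a) {t : ℕ}
    (ht : t ∈ Finset.Icc 1 T) {B : (ℕ → Round X K) × (X × (Fin K → ℝ)) → ℝ≥0∞}
    (hB : Measurable B) (b : Fin K) :
    ∫⁻ ω, B (past z₀ x r a t ω, (x t ω, r t ω)) *
        ENNReal.ofReal (Set.indicator {ω | a t ω = b} (fun _ => (1 : ℝ)) ω) ∂P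
      = ∫⁻ ω, B (past z₀ x r a t ω, (x t ω, r t ω)) *
        ENNReal.ofReal (playProb G T C (past z₀ x r a t ω) t (x t ω) b) ∂P := by
  have ht' := Finset.mem_Icc.1 ht
  have hset : MeasurableSet {ω | a t ω = b} :=
    hrun.measurable_action t (measurableSet_singleton b)
  have hpast : Measurable[history x r a t ⊔
      MeasurableSpace.comap (fun ω => (x t ω, r t ω)) inferInstance] (past z₀ x r a t) :=
    (measurable_past_history t).mono le_sup_left le_rfl
  have hxr : Measurable[history x r a t ⊔
      MeasurableSpace.comap (fun ω => (x t ω, r t ω)) inferInstance] fun ω => (x t ω, r t ω) :=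
    (comap_measurable _).mono le_sup_right le_rfl
  refine lintegral_mul_ofReal_condExp
    (sup_le (hrun.history_le t) (hrun.measurable_pair t).comap_le)
    ((integrable_const (1 : ℝ)).indicator hset)
    (Eventually.of_forall fun ω => Set.indicator_nonneg (fun _ _ => zero_le_one) _) ?_
    (hB.comp (hpast.prodMk hxr))
  filter_upwards [hrun.action_uniform t ht b] with ω hω
  rw [hω, playProb, activeSet_obs_past ht'.1]

/-- The data of a round, integrated against the past, the law `D` and the uniform choice of the
action. -/
lemma IsRun.lintegral_round [IsProbabilityMeasure P] [IsProbabilityMeasure D]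
    (hrun : IsRun D G T C P x r a) (hel : MeasurableElimination K G) (hC : 0 < C) {t : ℕ}
    (ht : t ∈ Finset.Icc 1 T)
    {B : (ℕ → Round X K) → X × (Fin K → ℝ) → Fin K → ℝ≥0∞}
    (hB : ∀ b, Measurable fun q : (ℕ → Round X K) × (X × (Fin K → ℝ)) => B q.1 q.2 b) :
    ∫⁻ ω, B (past z₀ x r a t ω) (x t ω, r t ω) (a t ω) ∂P
      = ∫⁻ ω, ∫⁻ z, ∑ b, B (past z₀ x r a t ω) z b *
          ENNReal.ofReal (playProb G T C (past z₀ x r a t ω) t z.1 b) ∂D ∂P := by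
  classical
  have ht' := Finset.mem_Icc.1 ht
  have hmxr : Measurable fun ω => (x t ω, r t ω) := hrun.measurable_pair t
  have hset : ∀ b, MeasurableSet {ω | a t ω = b} := fun b =>
    hrun.measurable_action t (measurableSet_singleton b)
  have e1 := fun b => hrun.lintegral_action_eq (z₀ := z₀) ht (hB b) b
  have hjoint : Measurable fun ω => (past z₀ x r a t ω, (x t ω, r t ω)) :=
    (hrun.measurable_past t).prodMk hmxr
  have e2 : ∀ ω, B (past z₀ x r a t ω) (x t ω, r t ω) (a t ω)
      = ∑ b, B (past z₀ x r a t ω) (x t ω, r t ω) b *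
        ENNReal.ofReal (Set.indicator {ω | a t ω = b} (fun _ => (1 : ℝ)) ω) := by
    intro ω
    rw [Finset.sum_eq_single (a t ω)]
    · simp
    · intro b _ hb
      rw [Set.indicator_of_notMem (by simpa using hb.symm)]
      simp
    · simp
  have hmeas1 : ∀ b, Measurable fun ω => B (past z₀ x r a t ω) (x t ω, r t ω) b *
      ENNReal.ofReal (Set.indicator {ω | a t ω = b} (fun _ => (1 : ℝ)) ω) := fun b =>
    ((hB b).comp hjoint).mul (measurable_const.indicator (hset b)).ennreal_ofReal
  let Φ : (ℕ → Round X K) × (X × (Fin K → ℝ)) → ℝ≥0∞ := fun q =>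
    ∑ b, B q.1 q.2 b * ENNReal.ofReal (playProb G T C q.1 t q.2.1 b)
  have hΦb : ∀ b, Measurable fun q : (ℕ → Round X K) × (X × (Fin K → ℝ)) =>
      B q.1 q.2 b * ENNReal.ofReal (playProb G T C q.1 t q.2.1 b) := fun b =>
    (hB b).mul ((measurable_playProb hel hC ht'.2 b).comp
      (measurable_fst.prodMk measurable_snd.fst)).ennreal_ofReal
  have hΦ : Measurable Φ := Finset.measurable_sum _ fun b _ => hΦb b
  -- Past and current pair are independent, so their joint law is a product and the pair can be
  -- integrated out first.
  have hind : IndepFun (past z₀ x r a t) (fun ω => (x t ω, r t ω)) P := by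
    have := hrun.indep t ht
    rw [IndepFun_iff_Indep]
    exact indep_of_indep_of_le_left this (measurable_past_history t).comap_le
  have hlaw := (indepFun_iff_map_prod_eq_prod_map_map (hrun.measurable_past t).aemeasurable
    hmxr.aemeasurable).1 hind
  rw [hrun.law t ht] at hlaw
  have : IsProbabilityMeasure (P.map (past z₀ x r a t)) :=
    Measure.isProbabilityMeasure_map (hrun.measurable_past t).aemeasurable
  calc ∫⁻ ω, B (past z₀ x r a t ω) (x t ω, r t ω) (a t ω) ∂P
      = ∑ b, ∫⁻ ω, B (past z₀ x r a t ω) (x t ω, r t ω) b *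
        ENNReal.ofReal (Set.indicator {ω | a t ω = b} (fun _ => (1 : ℝ)) ω) ∂P := by
        simp only [e2]
        exact lintegral_finsetSum _ fun b _ => hmeas1 b
    _ = ∑ b, ∫⁻ ω, B (past z₀ x r a t ω) (x t ω, r t ω) b *
        ENNReal.ofReal (playProb G T C (past z₀ x r a t ω) t (x t ω) b) ∂P :=
        Finset.sum_congr rfl fun b _ => e1 b
    _ = ∫⁻ ω, Φ (past z₀ x r a t ω, (x t ω, r t ω)) ∂P :=
        (lintegral_finsetSum _ fun b _ => (hΦb b).comp hjoint).symm
    _ = ∫⁻ q, Φ q ∂(P.map fun ω => (past z₀ x r a t ω, (x t ω, r t ω))) :=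
        (lintegral_map hΦ hjoint).symm
    _ = ∫⁻ h, ∫⁻ z, Φ (h, z) ∂D ∂(P.map (past z₀ x r a t)) := by
        rw [hlaw, lintegral_prod _ hΦ.aemeasurable]
    _ = _ := lintegral_map hΦ.lintegral_prod_right' (hrun.measurable_past t)

end Past

/-! ### Conditional means of rewards -/

section Reward

variable {X : Type*} [MeasurableSpace X] {K : ℕ} {D : Measure (X × (Fin K → ℝ))}
  [IsProbabilityMeasure D] {G : Set (X → ℝ)} {fstar : X → Fin K → ℝ}

lemma BoundedRewards.integrable_reward (hD : BoundedRewards D) (b : Fin K) :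
    Integrable (fun z : X × (Fin K → ℝ) => z.2 b) D := by
  refine Integrable.of_bound (by fun_prop) 1 ?_
  filter_upwards [hD] with z hz
  rw [Real.norm_eq_abs, abs_of_nonneg (hz b).1]
  exact (hz b).2

lemma integrable_affine_reward (hD : BoundedRewards D) {u : X → ℝ} {c : X → Fin K → ℝ}
    (hu : Measurable u) (hc : ∀ b, Measurable fun x => c x b) {M : ℝ} (huM : ∀ x, |u x| ≤ M)
    (hcM : ∀ x b, |c x b| ≤ M) :
    Integrable (fun z : X × (Fin K → ℝ) => u z.1 + ∑ b, c z.1 b * z.2 b) D := by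
  refine (Integrable.of_bound (hu.comp measurable_fst).aestronglyMeasurable M
    (Eventually.of_forall fun z => huM _)).add (integrable_finsetSum _ fun b _ => ?_)
  exact (hD.integrable_reward b).bdd_mul ((hc b).comp measurable_fst).aestronglyMeasurable
    (Eventually.of_forall fun z => hcM _ b)

/-- All averages over rewards in the analysis are brought to integrands affine in the reward vector,
with coefficients depending on the context; realizability then just replaces rewards by `fstar`.
Differences of square losses qualify because the squared reward cancels. -/
lemma condExp_affine_reward (hD : BoundedRewards D) (hreal : Realizes D G fstar) {u : X → ℝ}
    {c : X → Fin K → ℝ} (hu : Measurable u) (hc : ∀ b, Measurable fun x => c x b) {M : ℝ}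
    (huM : ∀ x, |u x| ≤ M) (hcM : ∀ x b, |c x b| ≤ M) :
    D[fun z => u z.1 + ∑ b, c z.1 b * z.2 b | MeasurableSpace.comap Prod.fst inferInstance]
      =ᵐ[D] fun z => u z.1 + ∑ b, c z.1 b * fstar z.1 b := by
  set m : MeasurableSpace (X × (Fin K → ℝ)) := MeasurableSpace.comap Prod.fst inferInstance
  have hm : m ≤ Prod.instMeasurableSpace := measurable_fst.comap_le
  have hfst : Measurable[m] (Prod.fst : X × (Fin K → ℝ) → X) := comap_measurable _
  have hui : Integrable (fun z : X × (Fin K → ℝ) => u z.1) D :=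
    Integrable.of_bound (hu.comp measurable_fst).aestronglyMeasurable M
      (Eventually.of_forall fun z => huM _)
  have hci : ∀ b, Integrable (fun z : X × (Fin K → ℝ) => c z.1 b * z.2 b) D := fun b =>
    (hD.integrable_reward b).bdd_mul ((hc b).comp measurable_fst).aestronglyMeasurable
      (Eventually.of_forall fun z => hcM _ b)
  have h1 : D[fun z => u z.1 | m] = fun z => u z.1 :=
    condExp_of_stronglyMeasurable hm (hu.comp hfst).stronglyMeasurable hui
  have h2 : ∀ b, D[fun z => c z.1 b * z.2 b | m] =ᵐ[D] fun z => c z.1 b * fstar z.1 b := by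
    intro b
    have := condExp_mul_of_stronglyMeasurable_left (m := m)
      (((hc b).comp hfst).stronglyMeasurable) (hci b) (hD.integrable_reward b)
    filter_upwards [this, hreal.2 b] with z hz1 hz2
    have hz1' : D[fun z => c z.1 b * z.2 b | m] z = c z.1 b * D[fun z => z.2 b | m] z := hz1
    rw [hz1', hz2]
  have h3 : D[fun z => u z.1 + ∑ b, c z.1 b * z.2 b | m]
      =ᵐ[D] D[fun z => u z.1 | m] + D[fun z => ∑ b, c z.1 b * z.2 b | m] :=
    condExp_add hui (integrable_finsetSum _ fun b _ => hci b) m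
  have h4 : D[fun z => ∑ b, c z.1 b * z.2 b | m]
      =ᵐ[D] ∑ b, D[fun z => c z.1 b * z.2 b | m] := by
    have := condExp_finsetSum (μ := D) (s := Finset.univ)
      (f := fun b (z : X × (Fin K → ℝ)) => c z.1 b * z.2 b) (fun b _ => hci b) m
    refine EventuallyEq.trans (Eventually.of_forall fun z => ?_) this
    congr 2
    funext z
    simp
  have h5 := ae_all_iff.2 h2
  filter_upwards [h3, h4, h5] with z hz3 hz4 hz5
  rw [hz3, Pi.add_apply, hz4, h1, Finset.sum_apply]
  simp only [hz5]

lemma lintegral_affine_reward (hD : BoundedRewards D) (hreal : Realizes D G fstar) {u : X → ℝ}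
    {c : X → Fin K → ℝ} (hu : Measurable u) (hc : ∀ b, Measurable fun x => c x b) {M : ℝ}
    (huM : ∀ x, |u x| ≤ M) (hcM : ∀ x b, |c x b| ≤ M)
    (hnn : ∀ x, ∀ s : Fin K → ℝ, (∀ b, s b ∈ Set.Icc (0 : ℝ) 1) → 0 ≤ u x + ∑ b, c x b * s b)
    {B : X → ℝ≥0∞} (hB : Measurable B) :
    ∫⁻ z, B z.1 * ENNReal.ofReal (u z.1 + ∑ b, c z.1 b * z.2 b) ∂D
      = ∫⁻ z, B z.1 * ENNReal.ofReal (u z.1 + ∑ b, c z.1 b * fstar z.1 b) ∂D := by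
  refine lintegral_mul_ofReal_condExp (B := fun z : X × (Fin K → ℝ) => B z.1)
    measurable_fst.comap_le (integrable_affine_reward hD hu hc huM hcM) ?_
    (condExp_affine_reward hD hreal hu hc huM hcM) (hB.comp (comap_measurable _))
  filter_upwards [hD] with z hz
  exact hnn _ _ hz

lemma integral_reward_policy (hD : BoundedRewards D) (hreal : Realizes D G fstar)
    {π : X → Fin K} (hπ : Measurable π) :
    ∫ z, z.2 (π z.1) ∂D = ∫ z, fstar z.1 (π z.1) ∂D := by
  classical
  have key : ∀ s : X → Fin K → ℝ, ∀ x, ∑ b, (if π x = b then (1 : ℝ) else 0) * s x b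
      = s x (π x) := by intro s x; simp
  have hc : ∀ b, Measurable fun x => (if π x = b then (1 : ℝ) else 0) := fun b =>
    Measurable.ite (hπ (measurableSet_singleton b)) measurable_const measurable_const
  have h := condExp_affine_reward hD hreal (u := fun _ => 0) measurable_const hc (M := 1)
    (by simp) (by intro x b; split_ifs <;> simp)
  simp only [zero_add, ite_mul, one_mul, zero_mul, Finset.sum_ite_eq, Finset.mem_univ,
    if_true] at h
  rw [← integral_condExp (measurable_fst (β := Fin K → ℝ) (α := X)).comap_le]
  exact integral_congr_ae h

end Reward

end RegCB

namespace RegCB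

/-! ### Replacing contexts by independent copies -/

/-- The data `h`, forgotten from round `t` on. -/
def truncate {X : Type*} {K : ℕ} (z₀ : Round X K) (t : ℕ) (h : ℕ → Round X K) : ℕ → Round X K :=
  fun s => if s ∈ Finset.Ico 1 t then h s else z₀

/-- The vector `y` with the entries of the rounds `k₀ + 1, …, k` replaced by the contexts
in `h`. -/
def mixContexts {X : Type*} {K T : ℕ} (k₀ k : ℕ) (h : ℕ → Round X K) (y : Fin T → X) : Fin T → X :=
  fun i => if k₀ ≤ i.val ∧ i.val < k then (h (i.val + 1)).1 else y i

lemma measurable_truncate {X : Type*} [MeasurableSpace X] {K : ℕ} (z₀ : Round X K) (t : ℕ) :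
    Measurable (truncate z₀ t) := by
  refine measurable_pi_lambda _ fun s => ?_
  by_cases hs : s ∈ Finset.Ico 1 t
  · simpa only [truncate, hs, if_true] using measurable_pi_apply s
  · simpa only [truncate, hs, if_false] using measurable_const

lemma measurable_mixContexts {X : Type*} [MeasurableSpace X] {K T : ℕ} (k₀ k : ℕ) :
    Measurable fun q : (ℕ → Round X K) × (Fin T → X) => mixContexts k₀ k q.1 q.2 := by
  refine measurable_pi_lambda _ fun i => ?_
  by_cases hs : k₀ ≤ i.val ∧ i.val < k
  · simp only [mixContexts, hs, and_self, if_true]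
    exact ((measurable_pi_apply (i.val + 1)).comp measurable_fst).fst
  · simp only [mixContexts, hs, if_false]
    exact (measurable_pi_apply i).comp measurable_snd

section Telescope

variable {X Ω : Type*} {K : ℕ} {z₀ : Round X K} {x : ℕ → Ω → X} {r : ℕ → Ω → Fin K → ℝ}
  {a : ℕ → Ω → Fin K}

lemma truncate_past {t t' : ℕ} (h : t ≤ t') (ω : Ω) :
    truncate z₀ t (past z₀ x r a t' ω) = past z₀ x r a t ω := by
  funext s
  unfold truncate
  split_ifs with hs
  · exact (past_eq_past hs h ω).symm
  · exact (past_apply_of_notMem hs ω).symm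

variable [MeasurableSpace X] [MeasurableSpace Ω] {D : Measure (X × (Fin K → ℝ))}
  {G : Set (X → ℝ)} {T : ℕ} {C : ℝ} {P : Measure Ω}

/-- One-step weights whose conditional mean, given the past and the context, is at most `1`. -/
def IsStepWeight (D : Measure (X × (Fin K → ℝ))) (G : Set (X → ℝ)) (T : ℕ) (C : ℝ) (t : ℕ)
    (η : (ℕ → Round X K) → X × (Fin K → ℝ) → Fin K → ℝ≥0∞) : Prop :=
  (∀ b, Measurable fun q : (ℕ → Round X K) × (X × (Fin K → ℝ)) => η q.1 q.2 b) ∧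
    ∀ h, ∀ B : X → ℝ≥0∞, Measurable B →
      ∫⁻ z, ∑ b, B z.1 * η h z b * ENNReal.ofReal (playProb G T C h t z.1 b) ∂D
        ≤ ∫⁻ y, B y ∂D.fst

lemma isStepWeight_one (t : ℕ) : IsStepWeight D G T C t fun _ _ _ => 1 := by
  refine ⟨fun b => measurable_const, fun h B hB => ?_⟩
  rw [Measure.fst, lintegral_map hB measurable_fst]
  refine lintegral_mono fun z => ?_
  simp only [mul_one]
  rw [← Finset.mul_sum, ← ENNReal.ofReal_sum_of_nonneg fun b _ => playProb_nonneg h t z.1 b]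
  exact mul_le_of_le_one_right' (ENNReal.ofReal_le_one.2 (sum_playProb_le_one h t z.1))

variable [IsProbabilityMeasure D] [IsProbabilityMeasure P]

lemma IsRun.lintegral_stepWeight_le (hrun : IsRun D G T C P x r a)
    (hel : MeasurableElimination K G) (hC : 0 < C) {t : ℕ} (ht : t ∈ Finset.Icc 1 T)
    {η : (ℕ → Round X K) → X × (Fin K → ℝ) → Fin K → ℝ≥0∞} (hη : IsStepWeight D G T C t η)
    {B : (ℕ → Round X K) × X → ℝ≥0∞} (hB : Measurable B) :
    ∫⁻ ω, B (past z₀ x r a t ω, x t ω) * η (past z₀ x r a t ω) (x t ω, r t ω) (a t ω) ∂P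
      ≤ ∫⁻ ω, ∫⁻ y, B (past z₀ x r a t ω, y) ∂D.fst ∂P := by
  have hm : ∀ b, Measurable fun q : (ℕ → Round X K) × (X × (Fin K → ℝ)) =>
      B (q.1, q.2.1) * η q.1 q.2 b := fun b =>
    (hB.comp (measurable_fst.prodMk measurable_snd.fst)).mul (hη.1 b)
  have := hrun.lintegral_round (z₀ := z₀) hel hC ht (B := fun h z b => B (h, z.1) * η h z b) hm
  rw [this]
  exact lintegral_mono fun ω => hη.2 _ (fun y => B (past z₀ x r a t ω, y))
    (hB.comp measurable_prodMk_left)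

/-- The product of the step weights of the rounds `k₀ + 1, …, k`. -/
noncomputable def weightProd (z₀ : Round X K)
    (η : ℕ → (ℕ → Round X K) → X × (Fin K → ℝ) → Fin K → ℝ≥0∞)
    (k₀ k : ℕ) (h : ℕ → Round X K) : ℝ≥0∞ :=
  ∏ s ∈ Finset.Ico k₀ k,
    η (s + 1) (truncate z₀ (s + 1) h) ((h (s + 1)).1, (h (s + 1)).2.2) (h (s + 1)).2.1

lemma measurable_weightProd {η : ℕ → (ℕ → Round X K) → X × (Fin K → ℝ) → Fin K → ℝ≥0∞}
    (hη : ∀ t b, Measurable fun q : (ℕ → Round X K) × (X × (Fin K → ℝ)) => η t q.1 q.2 b)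
    (k₀ k : ℕ) : Measurable (weightProd z₀ η k₀ k) := by
  refine Finset.measurable_prod _ fun s _ => ?_
  have h1 : Measurable fun h : ℕ → Round X K => h (s + 1) := measurable_pi_apply _
  have h2 : Measurable fun p : ((ℕ → Round X K) × (X × (Fin K → ℝ))) × Fin K =>
      η (s + 1) p.1.1 p.1.2 p.2 := measurable_from_prod_countable_left fun b => hη (s + 1) b
  exact h2.comp (((measurable_truncate z₀ (s + 1)).prodMk
    (h1.fst.prodMk h1.snd.snd)).prodMk h1.snd.fst)

/-- `F` may look at all contexts, including those later than the weighted rounds, so a plain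
supermartingale argument does not apply. The last round is removed first: given the past and its
context, its weight has mean at most one and is dropped; the context that remains is a fresh draw
from `D.fst`, which `lintegral_pi_update` merges with the independent copy `y`. -/
lemma IsRun.lintegral_telescope (hrun : IsRun D G T C P x r a)
    (hel : MeasurableElimination K G) (hC : 0 < C)
    {η : ℕ → (ℕ → Round X K) → X × (Fin K → ℝ) → Fin K → ℝ≥0∞}
    (hη : ∀ t, IsStepWeight D G T C t (η t)) {F : (ℕ → Round X K) × (Fin T → X) → ℝ≥0∞}
    (hF : Measurable F) {k₀ k : ℕ} (h0 : k₀ ≤ k) (hk : k ≤ T) :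
    ∫⁻ ω, ∫⁻ y, F (past z₀ x r a (k₀ + 1) ω, mixContexts k₀ k (past z₀ x r a (k + 1) ω) y) *
        weightProd z₀ η k₀ k (past z₀ x r a (k + 1) ω) ∂Measure.pi (fun _ => D.fst) ∂P
      ≤ ∫⁻ ω, ∫⁻ y, F (past z₀ x r a (k₀ + 1) ω, y) ∂Measure.pi (fun _ => D.fst) ∂P := by
  induction k, h0 using Nat.le_induction with
  | base =>
    refine le_of_eq ?_
    simp only [weightProd, Finset.Ico_self, Finset.prod_empty, mul_one]
    refine lintegral_congr fun ω => lintegral_congr fun y => ?_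
    congr 2
    funext i
    exact if_neg (by omega)
  | succ k h0 ih =>
    refine le_trans ?_ (ih (by omega))
    -- Rounds count from `1` and coordinates from `0`: coordinate `k` holds the context of round `k
    -- + 1`.
    let ι : Fin T := ⟨k, hk⟩
    let J : (ℕ → Round X K) × (Fin T → X) → ℝ≥0∞ := fun q =>
      F (truncate z₀ (k₀ + 1) q.1, mixContexts k₀ k q.1 q.2) * weightProd z₀ η k₀ k q.1
    have hJ : Measurable J := by
      refine (hF.comp (((measurable_truncate z₀ _).comp measurable_fst).prodMk
        (measurable_mixContexts k₀ k))).mul ?_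
      exact (measurable_weightProd (fun t => (hη t).1) k₀ k).comp measurable_fst
    have hJup : Measurable fun q : ((ℕ → Round X K) × X) × (Fin T → X) =>
        J (q.1.1, Function.update q.2 ι q.1.2) := by
      refine hJ.comp (measurable_fst.fst.prodMk (measurable_pi_lambda _ fun i => ?_))
      by_cases hi : i = ι
      · subst hi
        simpa only [Function.update_self] using measurable_fst.snd
      · simp only [Function.update_of_ne hi]
        exact (measurable_pi_apply i).comp measurable_snd
    let B : (ℕ → Round X K) × X → ℝ≥0∞ := fun p =>
      ∫⁻ y, J (p.1, Function.update y ι p.2) ∂Measure.pi (fun _ => D.fst)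
    have hB : Measurable B := hJup.lintegral_prod_right'
    -- The newest round splits off: its context moves from the data into `y`, and its weight becomes
    -- a separate factor.
    have hpt : ∀ ω y,
        F (past z₀ x r a (k₀ + 1) ω,
          mixContexts k₀ (k + 1) (past z₀ x r a (k + 1 + 1) ω) y) *
          weightProd z₀ η k₀ (k + 1) (past z₀ x r a (k + 1 + 1) ω)
        = J (past z₀ x r a (k + 1) ω, Function.update y ι (x (k + 1) ω)) *
          η (k + 1) (past z₀ x r a (k + 1) ω) (x (k + 1) ω, r (k + 1) ω) (a (k + 1) ω) := by
      intro ω y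
      have hmix : mixContexts k₀ (k + 1) (past z₀ x r a (k + 1 + 1) ω) y
          = mixContexts k₀ k (past z₀ x r a (k + 1) ω) (Function.update y ι (x (k + 1) ω)) := by
        funext i
        unfold mixContexts
        by_cases hi : i = ι
        · subst hi
          have h1 : k₀ ≤ ι.val ∧ ι.val < k + 1 := ⟨h0, Nat.lt_succ_self k⟩
          have h2 : ¬ (k₀ ≤ ι.val ∧ ι.val < k) := fun h => lt_irrefl _ h.2
          rw [if_pos h1, if_neg h2, Function.update_self,
            past_apply_of_mem (by simp [ι] : ι.val + 1 ∈ Finset.Ico 1 (k + 1 + 1))]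
        · have hne : i.val ≠ k := fun h => hi (Fin.ext h)
          rw [Function.update_of_ne hi]
          by_cases h : k₀ ≤ i.val ∧ i.val < k
          · rw [if_pos h, if_pos ⟨h.1, by omega⟩, past_eq_past (t := k + 1) (t' := k + 1 + 1)]
            · simp; omega
            · omega
          · rw [if_neg h, if_neg (by omega)]
      have hw : weightProd z₀ η k₀ (k + 1) (past z₀ x r a (k + 1 + 1) ω)
          = weightProd z₀ η k₀ k (past z₀ x r a (k + 1) ω) *
          η (k + 1) (past z₀ x r a (k + 1) ω) (x (k + 1) ω, r (k + 1) ω) (a (k + 1) ω) := by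
        unfold weightProd
        rw [Finset.prod_Ico_succ_top h0]
        congr 1
        · refine Finset.prod_congr rfl fun s hs => ?_
          have hs' := Finset.mem_Ico.1 hs
          rw [truncate_past (by omega), truncate_past (by omega),
            ← past_eq_past (t := k + 1) (t' := k + 1 + 1) (by simp; omega) (by omega)]
        · rw [truncate_past (by omega),
            past_apply_of_mem (by simp : k + 1 ∈ Finset.Ico 1 (k + 1 + 1))]
      simp only [J]
      rw [hmix, hw, truncate_past (by omega), mul_assoc]
    have hstep := hrun.lintegral_stepWeight_le (z₀ := z₀) hel hC
      (Finset.mem_Icc.2 ⟨by omega, hk⟩) (hη (k + 1)) hB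
    calc _ = ∫⁻ ω, B (past z₀ x r a (k + 1) ω, x (k + 1) ω) *
          η (k + 1) (past z₀ x r a (k + 1) ω) (x (k + 1) ω, r (k + 1) ω) (a (k + 1) ω) ∂P := by
          refine lintegral_congr fun ω => ?_
          simp only [hpt]
          have hm : Measurable fun y =>
              J (past z₀ x r a (k + 1) ω, Function.update y ι (x (k + 1) ω)) :=
            hJup.comp (measurable_prodMk_left (x := (past z₀ x r a (k + 1) ω, x (k + 1) ω)))
          exact lintegral_mul_const _ hm
      _ ≤ ∫⁻ ω, ∫⁻ u, B (past z₀ x r a (k + 1) ω, u) ∂D.fst ∂P := hstep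
      _ = _ := by
          refine lintegral_congr fun ω => ?_
          simp only [B]
          rw [lintegral_lintegral_swap]
          · have hJω : Measurable fun y => J (past z₀ x r a (k + 1) ω, y) :=
              hJ.comp measurable_prodMk_left
            rw [lintegral_pi_update D.fst ι hJω]
            simp only [J]
            rw [truncate_past (by omega)]
          · refine (hJup.comp (f := fun p : X × (Fin T → X) =>
              ((past z₀ x r a (k + 1) ω, p.1), p.2)) ?_).aemeasurable
            exact (measurable_const.prodMk measurable_fst).prodMk measurable_snd

end Telescope

end RegCB

namespace RegCB

/-! ### Concentration of the excess losses -/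

/-- A multiple of the weighted squared distance of the predictions `v` and `f` of the mean reward
of the action `act`, minus a multiple of the excess square loss of `v` over `f` when the action
`b` is played and the reward of `act` is `s`. -/
noncomputable def excess {K : ℕ} (w f v s : ℝ) (b act : Fin K) : ℝ :=
  w * (v - f) ^ 2 / (10 * K) - 1 / 4 * (if b = act then (v - s) ^ 2 - (f - s) ^ 2 else 0)

/-- Both squares are `2`-Lipschitz in the prediction on the unit interval, so the constant is `2/10
+ 2/4 = 7/10`. -/
lemma abs_excess_sub_le {K : ℕ} (hK : 1 ≤ K) {w f v v' s : ℝ} (hw : w ∈ Set.Icc (0 : ℝ) 1)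
    (hf : f ∈ Set.Icc (0 : ℝ) 1) (hv : v ∈ Set.Icc (0 : ℝ) 1) (hv' : v' ∈ Set.Icc (0 : ℝ) 1)
    (hs : s ∈ Set.Icc (0 : ℝ) 1) (b act : Fin K) :
    excess w f v s b act ≤ excess w f v' s b act + 7 / 10 * |v - v'| := by
  have hK' : (1 : ℝ) ≤ K := by exact_mod_cast hK
  have h1 := abs_le.1 (mul_abs_le_of_mem_Icc hv hv' hf)
  have h2 := abs_le.1 (mul_abs_le_of_mem_Icc hv hv' hs)
  have h3 := abs_nonneg (v - v')
  have h4 : w * (v - f) ^ 2 / (10 * K) ≤ w * (v' - f) ^ 2 / (10 * K) + 2 / 10 * |v - v'| := by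
    have : w * (v - f) ^ 2 / (10 * K) - w * (v' - f) ^ 2 / (10 * K)
        = w / (10 * K) * ((v - f) ^ 2 - (v' - f) ^ 2) := by ring
    have h5 : w / (10 * K) ≤ 1 / 10 := by
      rw [div_le_div_iff₀ (by positivity) (by norm_num)]
      nlinarith [hw.2]
    have h6 : 0 ≤ w / (10 * K) := div_nonneg hw.1 (by positivity)
    have : w / (10 * K) * ((v - f) ^ 2 - (v' - f) ^ 2) ≤ w / (10 * K) * (2 * |v - v'|) :=
      mul_le_mul_of_nonneg_left h1.2 h6
    nlinarith
  unfold excess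
  split_ifs <;> linarith [h2.1]

/-- The excess loss factors as `(v + f - 2s)(v - f)`, with first factor at most `2` in absolute
value; the quadratic term of `exp_le_of_abs_le_quarter` then has constant `3/5 · 1/16 · 4 = 3/20`.
-/
lemma exp_excess_le {v f s : ℝ} (hv : v ∈ Set.Icc (0 : ℝ) 1) (hf : f ∈ Set.Icc (0 : ℝ) 1)
    (hs : s ∈ Set.Icc (0 : ℝ) 1) :
    Real.exp (-(1 / 4 * ((v - s) ^ 2 - (f - s) ^ 2)))
      ≤ 1 + (-(1 / 4) * ((v - s) ^ 2 - (f - s) ^ 2) + 3 / 20 * (v - f) ^ 2) := by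
  obtain ⟨v0, v1⟩ := hv
  obtain ⟨f0, f1⟩ := hf
  obtain ⟨s0, s1⟩ := hs
  have a1 : (v - s) ^ 2 ≤ 1 := by
    rw [sq_le_one_iff_abs_le_one, abs_le]; constructor <;> linarith
  have a2 : (f - s) ^ 2 ≤ 1 := by
    rw [sq_le_one_iff_abs_le_one, abs_le]; constructor <;> linarith
  have h := exp_le_of_abs_le_quarter (u := -(1 / 4 * ((v - s) ^ 2 - (f - s) ^ 2))) (by
    rw [abs_le]
    constructor <;> nlinarith [sq_nonneg (v - s), sq_nonneg (f - s)])
  have h2 : ((v - s) ^ 2 - (f - s) ^ 2) ^ 2 ≤ 4 * (v - f) ^ 2 := by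
    have : ((v - s) ^ 2 - (f - s) ^ 2) ^ 2 = (v + f - 2 * s) ^ 2 * (v - f) ^ 2 := by ring
    rw [this]
    have : (v + f - 2 * s) ^ 2 ≤ 4 := by nlinarith
    exact mul_le_mul_of_nonneg_right this (sq_nonneg _)
  nlinarith

/-- Only the play of `act` incurs a loss. The bound is affine in `s`, which makes its conditional
mean computable. -/
lemma sum_exp_excess_le {K : ℕ} {p : Fin K → ℝ} (hp : ∀ b, 0 ≤ p b) (hp1 : ∑ b, p b ≤ 1)
    {w v f s : ℝ} (hv : v ∈ Set.Icc (0 : ℝ) 1) (hf : f ∈ Set.Icc (0 : ℝ) 1)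
    (hs : s ∈ Set.Icc (0 : ℝ) 1) (act : Fin K) :
    ∑ b, Real.exp (excess w f v s b act) * p b
      ≤ Real.exp (w * (v - f) ^ 2 / (10 * K)) *
        (1 + p act * (-(1 / 4) * ((v - s) ^ 2 - (f - s) ^ 2) + 3 / 20 * (v - f) ^ 2)) := by
  classical
  have h1 : ∀ b, Real.exp (excess w f v s b act) * p b
      ≤ Real.exp (w * (v - f) ^ 2 / (10 * K)) * (p b + if b = act then
        p act * (-(1 / 4) * ((v - s) ^ 2 - (f - s) ^ 2) + 3 / 20 * (v - f) ^ 2) else 0) := by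
    intro b
    unfold excess
    rw [sub_eq_add_neg, Real.exp_add, mul_assoc]
    refine mul_le_mul_of_nonneg_left ?_ (Real.exp_pos _).le
    by_cases hb : b = act
    · subst hb
      simp only [if_true]
      have := mul_le_mul_of_nonneg_right (exp_excess_le hv hf hs) (hp b)
      linarith
    · simp [hb]
  refine (Finset.sum_le_sum fun b _ => h1 b).trans ?_
  rw [← Finset.mul_sum, Finset.sum_add_distrib, Finset.sum_ite_eq' Finset.univ act]
  simp only [Finset.mem_univ, if_true]
  gcongr

open Classical in
/-- Whether `act` is plausible in round `t` on the context `y`, given the data `h`. -/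
noncomputable def activeInd {X : Type*} {K : ℕ} (G : Set (X → ℝ)) (T : ℕ) (C : ℝ)
    (h : ℕ → Round X K) (t : ℕ) (act : Fin K) (y : X) : ℝ :=
  if act ∈ activeSet G T C (obs h) t y then 1 else 0

section

variable {X : Type*} {K : ℕ} {G : Set (X → ℝ)} {T : ℕ} {C : ℝ}

lemma activeInd_mem_Icc (h : ℕ → Round X K) (t : ℕ) (act : Fin K) (y : X) :
    activeInd G T C h t act y ∈ Set.Icc (0 : ℝ) 1 := by
  unfold activeInd
  split_ifs <;> simp

lemma activeInd_div_le_playProb (h : ℕ → Round X K) (t : ℕ) (act : Fin K) (y : X) :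
    activeInd G T C h t act y / K ≤ playProb G T C h t y act := by
  unfold activeInd
  split_ifs with hm
  · rw [one_div]
    exact inv_le_playProb hm
  · rw [zero_div]
    exact playProb_nonneg _ _ _ _

variable [MeasurableSpace X]

lemma measurable_activeInd (hel : MeasurableElimination K G) (hC : 0 < C) {t : ℕ} (htT : t ≤ T)
    (act : Fin K) :
    Measurable fun q : (ℕ → Round X K) × X => activeInd G T C q.1 t act q.2 :=
  Measurable.ite (measurableSet_mem_activeSet hel hC htT act) measurable_const measurable_const

lemma measurable_activeInd_right (hel : MeasurableElimination K G) (hC : 0 < C) {t : ℕ}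
    (htT : t ≤ T) (act : Fin K) (h : ℕ → Round X K) :
    Measurable (activeInd G T C h t act) := by
  have h1 : Measurable fun y : X => (h, y) := measurable_prodMk_left
  have h2 := (measurable_activeInd hel hC htT act).comp h1
  exact h2

lemma measurable_playProb_right (hel : MeasurableElimination K G) (hC : 0 < C) {t : ℕ}
    (htT : t ≤ T) (h : ℕ → Round X K) (b : Fin K) :
    Measurable fun y => playProb G T C h t y b := by
  have h1 : Measurable fun y : X => (h, y) := measurable_prodMk_left
  have h2 := (measurable_playProb hel hC htT b).comp h1
  exact h2

lemma measurable_excess {fstar : X → Fin K → ℝ} (act : Fin K)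
    (hfm : Measurable fun y => fstar y act) (hel : MeasurableElimination K G) (hC : 0 < C) {t : ℕ}
    (htT : t ≤ T) {v : X → ℝ} (hv : Measurable v) (b : Fin K) :
    Measurable fun q : (ℕ → Round X K) × (X × (Fin K → ℝ)) =>
      excess (activeInd G T C q.1 t act q.2.1) (fstar q.2.1 act) (v q.2.1) (q.2.2 act) b act := by
  have hmap : Measurable fun q : (ℕ → Round X K) × (X × (Fin K → ℝ)) => (q.1, q.2.1) :=
    measurable_fst.prodMk measurable_snd.fst
  have hw : Measurable fun q : (ℕ → Round X K) × (X × (Fin K → ℝ)) =>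
      activeInd G T C q.1 t act q.2.1 := by
    have := (measurable_activeInd hel hC htT act).comp hmap
    exact this
  have hf : Measurable fun q : (ℕ → Round X K) × (X × (Fin K → ℝ)) => fstar q.2.1 act :=
    hfm.comp measurable_snd.fst
  have hv' : Measurable fun q : (ℕ → Round X K) × (X × (Fin K → ℝ)) => v q.2.1 :=
    hv.comp measurable_snd.fst
  have hs : Measurable fun q : (ℕ → Round X K) × (X × (Fin K → ℝ)) => q.2.2 act :=
    (measurable_pi_apply act).comp measurable_snd.snd
  unfold excess
  refine ((hw.mul ((hv'.sub hf).pow_const _)).div_const _).sub (Measurable.const_mul ?_ _)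
  by_cases hb : b = act
  · simp only [hb, if_true]
    exact ((hv'.sub hs).pow_const _).sub ((hf.sub hs).pow_const _)
  · simp only [hb, if_false]
    exact measurable_const

/-- After averaging over the reward the bracket of `sum_exp_excess_le` is `1 - p (v - f)² / 10`, as
`1/4 - 3/20 = 1/10`, and is at most the exponential of its deviation from one. This compensates the
factor `exp (w (v - f)² / (10 K))` because `w / K ≤ p`. The prediction `v` is a constant: in the
application it is one coordinate of a cover vector, not a function of the context. -/
lemma isStepWeight_excess {D : Measure (X × (Fin K → ℝ))} [IsProbabilityMeasure D]
    {fstar : X → Fin K → ℝ} (hD : BoundedRewards D) (hbase : IsBaseClass G)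
    (hreal : Realizes D G fstar) (hel : MeasurableElimination K G) (hC : 0 < C) {t : ℕ}
    (htT : t ≤ T) {v : ℝ} (hv : v ∈ Set.Icc (0 : ℝ) 1) (act : Fin K) :
    IsStepWeight D G T C t fun h z b => ENNReal.ofReal (Real.exp
      (excess (activeInd G T C h t act z.1) (fstar z.1 act) v (z.2 act) b act)) := by
  classical
  have hK : (1 : ℝ) ≤ K := by exact_mod_cast act.pos
  have hfm : Measurable fun y => fstar y act := (hbase _ (hreal.1 act)).1
  have hf01 : ∀ y, fstar y act ∈ Set.Icc (0 : ℝ) 1 := (hbase _ (hreal.1 act)).2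
  have hd1 : ∀ y, (v - fstar y act) ^ 2 ≤ 1 := by
    intro y
    rw [sq_le_one_iff_abs_le_one, abs_le]
    constructor <;> linarith [hv.1, hv.2, (hf01 y).1, (hf01 y).2]
  refine ⟨fun b => (measurable_excess act hfm hel hC htT measurable_const b).exp.ennreal_ofReal,
    fun h B hB => ?_⟩
  · set w : X → ℝ := fun y => activeInd G T C h t act y
    set p : X → Fin K → ℝ := fun y b => playProb G T C h t y b
    set E : X → ℝ := fun y => Real.exp (w y * (v - fstar y act) ^ 2 / (10 * K))
    have hw : Measurable w := measurable_activeInd_right hel hC htT act h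
    have hp : ∀ b, Measurable fun y => p y b := fun b =>
      measurable_playProb_right hel hC htT h b
    have hEm : Measurable E :=
      (((hw.mul ((measurable_const.sub hfm).pow_const _)).div_const _)).exp
    have hE0 : ∀ y, 0 < E y := fun y => Real.exp_pos _
    have hE3 : ∀ y, E y ≤ 3 := by
      intro y
      have h1 : w y * (v - fstar y act) ^ 2 / (10 * K) ≤ 1 := by
        rw [div_le_one (by positivity)]
        have := mul_le_one₀ (activeInd_mem_Icc (G := G) (T := T) (C := C) h t act y).2
          (sq_nonneg _) (hd1 y)
        linarith
      exact (Real.exp_le_exp.2 h1).trans (by linarith [Real.exp_one_lt_d9])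
    have hp0 : ∀ y b, 0 ≤ p y b := fun y b => playProb_nonneg _ _ _ _
    have hp1 : ∀ y b, p y b ≤ 1 := fun y b => playProb_le_one _ _ _ _
    let u : X → ℝ := fun y => E y * (1 + p y act *
      (-(1 / 4) * (v ^ 2 - fstar y act ^ 2) + 3 / 20 * (v - fstar y act) ^ 2))
    let c : X → Fin K → ℝ := fun y b =>
      if b = act then E y * p y act * (1 / 2 * (v - fstar y act)) else 0
    have hsum : ∀ y (s : Fin K → ℝ), u y + ∑ b, c y b * s b = E y * (1 + p y act *
        (-(1 / 4) * ((v - s act) ^ 2 - (fstar y act - s act) ^ 2)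
          + 3 / 20 * (v - fstar y act) ^ 2)) := by
      intro y s
      simp only [c, u, ite_mul, zero_mul, Finset.sum_ite_eq', Finset.mem_univ, if_true]
      ring
    have hum : Measurable u := by
      refine hEm.mul (measurable_const.add ((hp act).mul (Measurable.add ?_ ?_)))
      · exact (measurable_const.sub (hfm.pow_const _)).const_mul _
      · exact ((measurable_const.sub hfm).pow_const _).const_mul _
    have hcm : ∀ b, Measurable fun y => c y b := by
      intro b
      by_cases hb : b = act
      · simp only [c, hb, if_true]
        exact (hEm.mul (hp act)).mul ((measurable_const.sub hfm).const_mul _)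
      · simp only [c, hb, if_false]
        exact measurable_const
    have huM : ∀ y, |u y| ≤ 6 := by
      intro y
      have h2 : |(-(1 / 4) * (v ^ 2 - fstar y act ^ 2) + 3 / 20 * (v - fstar y act) ^ 2)| ≤ 1 := by
        have := hd1 y
        have h3 := hf01 y
        have e1 : v ^ 2 ≤ 1 := pow_le_one₀ hv.1 hv.2
        have e2 : fstar y act ^ 2 ≤ 1 := pow_le_one₀ h3.1 h3.2
        rw [abs_le]
        constructor <;> nlinarith [sq_nonneg v, sq_nonneg (fstar y act),
          sq_nonneg (v - fstar y act)]
      simp only [u]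
      rw [abs_mul, abs_of_pos (hE0 y)]
      have h4 : |1 + p y act *
          (-(1 / 4) * (v ^ 2 - fstar y act ^ 2) + 3 / 20 * (v - fstar y act) ^ 2)| ≤ 2 := by
        refine (abs_add_le _ _).trans ?_
        rw [abs_one, abs_mul, abs_of_nonneg (hp0 y act)]
        have := mul_le_one₀ (hp1 y act) (abs_nonneg _) h2
        linarith
      calc E y * _ ≤ 3 * 2 := mul_le_mul (hE3 y) h4 (abs_nonneg _) (by norm_num)
        _ = 6 := by norm_num
    have hcM : ∀ y b, |c y b| ≤ 6 := by
      intro y b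
      simp only [c]
      split_ifs
      · have h3 := hf01 y
        have h4 : |1 / 2 * (v - fstar y act)| ≤ 1 := by
          rw [abs_le]; constructor <;> linarith [hv.1, hv.2, h3.1, h3.2]
        rw [abs_mul, abs_mul, abs_of_pos (hE0 y), abs_of_nonneg (hp0 y act)]
        have h5 : E y * p y act ≤ 3 * 1 :=
          mul_le_mul (hE3 y) (hp1 y act) (hp0 y act) (by norm_num)
        have := mul_le_mul h5 h4 (abs_nonneg _) (by norm_num)
        linarith
      · simp
    have hnn : ∀ y, ∀ s : Fin K → ℝ, (∀ b, s b ∈ Set.Icc (0 : ℝ) 1) →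
        0 ≤ u y + ∑ b, c y b * s b := by
      intro y s hs
      rw [hsum]
      refine (Finset.sum_nonneg fun b _ => ?_).trans (sum_exp_excess_le (w := w y) (hp0 y)
        (sum_playProb_le_one h t y) hv (hf01 y) (hs act) act)
      exact mul_nonneg (Real.exp_pos _).le (hp0 y b)
    have hle1 : ∀ y, u y + ∑ b, c y b * fstar y b ≤ 1 := by
      intro y
      rw [hsum]
      have h1 : w y * (v - fstar y act) ^ 2 / (10 * K) ≤ p y act * (v - fstar y act) ^ 2 / 10 := by
        have := mul_le_mul_of_nonneg_right
          (activeInd_div_le_playProb (G := G) (T := T) (C := C) h t act y)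
          (sq_nonneg (v - fstar y act))
        calc w y * (v - fstar y act) ^ 2 / (10 * K)
            = w y / K * (v - fstar y act) ^ 2 / 10 := by field_simp
          _ ≤ _ := by gcongr
      have h2 : 1 + p y act * (-(1 / 4) * ((v - fstar y act) ^ 2
          - (fstar y act - fstar y act) ^ 2) + 3 / 20 * (v - fstar y act) ^ 2)
          ≤ Real.exp (-(p y act * (v - fstar y act) ^ 2 / 10)) := by
        have := Real.add_one_le_exp (-(p y act * (v - fstar y act) ^ 2 / 10))
        refine le_trans (le_of_eq ?_) this
        ring
      calc E y * _ ≤ E y * Real.exp (-(p y act * (v - fstar y act) ^ 2 / 10)) :=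
            mul_le_mul_of_nonneg_left h2 (hE0 y).le
        _ = Real.exp (w y * (v - fstar y act) ^ 2 / (10 * K)
            + -(p y act * (v - fstar y act) ^ 2 / 10)) := (Real.exp_add _ _).symm
        _ ≤ 1 := Real.exp_le_one_iff.2 (by linarith)
    calc _ ≤ ∫⁻ z, B z.1 * ENNReal.ofReal (u z.1 + ∑ b, c z.1 b * z.2 b) ∂D := by
          refine lintegral_mono_ae ?_
          filter_upwards [hD] with z hz
          simp only [mul_assoc]
          rw [← Finset.mul_sum]
          gcongr
          simp only [← ENNReal.ofReal_mul (Real.exp_pos _).le]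
          rw [← ENNReal.ofReal_sum_of_nonneg
            fun b _ => mul_nonneg (Real.exp_pos _).le (hp0 z.1 b), hsum]
          exact ENNReal.ofReal_le_ofReal (sum_exp_excess_le (hp0 z.1)
            (sum_playProb_le_one h t z.1) hv (hf01 z.1) (hz act) act)
      _ = ∫⁻ z, B z.1 * ENNReal.ofReal (u z.1 + ∑ b, c z.1 b * fstar z.1 b) ∂D :=
          lintegral_affine_reward hD hreal hum hcm huM hcM hnn hB
      _ ≤ ∫⁻ z, B z.1 ∂D := lintegral_mono fun z =>
          mul_le_of_le_one_right' (ENNReal.ofReal_le_one.2 (hle1 z.1))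
      _ = ∫⁻ y, B y ∂D.fst := by rw [Measure.fst, lintegral_map hB measurable_fst]

end

end RegCB

namespace RegCB

/-! ### Mean gaps with parameters -/

section MeanGap

variable {X : Type*} [MeasurableSpace X] {T : ℕ} {μ : Measure X}

lemma meanGap_congr {I : Finset (Fin T)} {h : (X → ℝ) → X → ℝ} {G₀ : Set (X → ℝ)}
    {xs ys : Fin T → X} (heq : ∀ i ∈ I, xs i = ys i) :
    meanGap μ I h G₀ xs = meanGap μ I h G₀ ys := by
  unfold meanGap
  refine iSup_congr fun g => iSup_congr fun _ => ?_
  rw [Finset.sum_congr rfl fun i hi => by rw [heq i hi]]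

lemma measurable_meanGap_uncurry {H : Type*} [MeasurableSpace H] [SFinite μ] (I : Finset (Fin T))
    {G₀ : Set (X → ℝ)} (hc : G₀.Countable) (hm : ∀ g ∈ G₀, Measurable g) {q : H → X → ℝ}
    {φ : X → ℝ} (hq : Measurable fun p : H × X => q p.1 p.2) (hφ : Measurable φ) :
    Measurable fun p : H × (Fin T → X) =>
      meanGap μ I (fun g y => q p.1 y * (g y - φ y) ^ 2) G₀ p.2 := by
  refine Measurable.biSup _ hc fun g hg => ?_
  refine ((Measurable.const_mul ?_ _).exp).ennreal_ofReal
  have h0 : Measurable fun p : H × X => q p.1 p.2 * (g p.2 - φ p.2) ^ 2 :=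
    hq.mul ((((hm g hg).comp measurable_snd).sub (hφ.comp measurable_snd)).pow_const _)
  have h1 : Measurable fun h : H => ∫ y, q h y * (g y - φ y) ^ 2 ∂μ :=
    h0.stronglyMeasurable.integral_prod_right'.measurable
  refine ((h1.comp measurable_fst).const_mul _).sub
    ((Finset.measurable_sum _ fun i _ => ?_).const_mul _)
  have h2 : Measurable fun p : H × (Fin T → X) => (p.1, p.2 i) :=
    measurable_fst.prodMk ((measurable_pi_apply i).comp measurable_snd)
  exact h0.comp h2

/-- The exponent is continuous along pointwise approximations by dominated convergence. Since `c` is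
strictly below it at `g`, some member of the countable subclass exceeds `c` too. -/
lemma ofReal_exp_le_meanGap [IsProbabilityMeasure μ] (I : Finset (Fin T)) {G G₀ : Set (X → ℝ)}
    (hG : IsBaseClass G) (hsub : G₀ ⊆ G)
    (hdense : ∀ g ∈ G, ∃ u : ℕ → X → ℝ, (∀ n, u n ∈ G₀) ∧
      ∀ x, Tendsto (fun n => u n x) atTop (𝓝 (g x)))
    {q φ : X → ℝ} (hqm : Measurable q) (hφm : Measurable φ)
    (hq : ∀ x, q x ∈ Set.Icc (0 : ℝ) 1) (hφ : ∀ x, φ x ∈ Set.Icc (0 : ℝ) 1) {g : X → ℝ}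
    (hg : g ∈ G) {xs : Fin T → X} {c : ℝ}
    (hlt : c < 1 / 8 * ((I.card : ℝ) * ∫ y, q y * (g y - φ y) ^ 2 ∂μ
      - 3 * ∑ i ∈ I, q (xs i) * (g (xs i) - φ (xs i)) ^ 2)) :
    ENNReal.ofReal (Real.exp c) ≤ meanGap μ I (fun g y => q y * (g y - φ y) ^ 2) G₀ xs := by
  let hh : (X → ℝ) → X → ℝ := fun g y => q y * (g y - φ y) ^ 2
  have hhm : ∀ g ∈ G, Measurable (hh g) := fun g hg =>
    hqm.mul (((hG g hg).1.sub hφm).pow_const _)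
  have hh1 : ∀ g ∈ G, ∀ y, ‖hh g y‖ ≤ 1 := by
    intro g hg y
    have h1 := hq y
    have h2 := (hG g hg).2 y
    have h3 := hφ y
    have h4 : (g y - φ y) ^ 2 ≤ 1 := by
      rw [sq_le_one_iff_abs_le_one, abs_le]
      constructor <;> linarith [h2.1, h2.2, h3.1, h3.2]
    rw [Real.norm_eq_abs, abs_of_nonneg (mul_nonneg h1.1 (sq_nonneg _))]
    exact mul_le_one₀ h1.2 (sq_nonneg _) h4
  obtain ⟨u, hu, hlim⟩ := hdense g hg
  let E : (X → ℝ) → ℝ := fun g => 1 / 8 * ((I.card : ℝ) * ∫ y, hh g y ∂μ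
    - 3 * ∑ i ∈ I, hh g (xs i))
  have hptw : ∀ y, Tendsto (fun n => hh (u n) y) atTop (𝓝 (hh g y)) := fun y =>
    (((hlim y).sub_const _).pow 2).const_mul _
  have hE : Tendsto (fun n => E (u n)) atTop (𝓝 (E g)) := by
    refine Tendsto.const_mul _ (Tendsto.sub (Tendsto.const_mul _ ?_) (Tendsto.const_mul _ ?_))
    · exact tendsto_integral_of_dominated_convergence (fun _ => 1)
        (fun n => (hhm _ (hsub (hu n))).aestronglyMeasurable) (integrable_const _)
        (fun n => Eventually.of_forall fun y => hh1 _ (hsub (hu n)) y)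
        (Eventually.of_forall hptw)
    · exact tendsto_finsetSum _ fun i _ => hptw _
  obtain ⟨n, hn⟩ := (hE.eventually (lt_mem_nhds (show c < E g from hlt))).exists
  calc ENNReal.ofReal (Real.exp c) ≤ ENNReal.ofReal (Real.exp (E (u n))) :=
        ENNReal.ofReal_le_ofReal (Real.exp_le_exp.2 hn.le)
    _ ≤ _ := le_iSup₂_of_le (u n) (hu n) le_rfl

end MeanGap

/-! ### Uniform concentration over the class along a run -/

section Concentration

variable {X Ω : Type*} {K : ℕ} {z₀ : Round X K} {x : ℕ → Ω → X} {r : ℕ → Ω → Fin K → ℝ}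
  {a : ℕ → Ω → Fin K} {G : Set (X → ℝ)} {T : ℕ} {C : ℝ}

lemma mixContexts_zero_past (ω : Ω) (y : Fin T → X) :
    mixContexts 0 T (past z₀ x r a (T + 1) ω) y = fun i : Fin T => x (i.val + 1) ω := by
  funext i
  have h1 : 0 ≤ i.val ∧ i.val < T := ⟨Nat.zero_le _, i.isLt⟩
  have h2 : i.val + 1 ∈ Finset.Ico 1 (T + 1) := by simp
  rw [mixContexts, if_pos h1, past_apply_of_mem h2]

variable [MeasurableSpace X] [MeasurableSpace Ω] {D : Measure (X × (Fin K → ℝ))} {P : Measure Ω}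

lemma IsRun.ae_bounded (hrun : IsRun D G T C P x r a) (hD : BoundedRewards D) :
    ∀ᵐ ω ∂P, ∀ t ∈ Finset.Icc 1 T, ∀ b, r t ω b ∈ Set.Icc (0 : ℝ) 1 := by
  rw [Finset.eventually_all]
  intro t ht
  have h1 : ∀ᵐ z ∂(P.map fun ω => (x t ω, r t ω)), ∀ b, z.2 b ∈ Set.Icc (0 : ℝ) 1 := by
    rw [hrun.law t ht]; exact hD
  exact ae_of_ae_map (hrun.measurable_pair t).aemeasurable h1

variable [IsProbabilityMeasure D] [IsProbabilityMeasure P]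

/-- With high probability, all excess sums over a set of rounds are small. -/
lemma IsRun.excess_concentration (hrun : IsRun D G T C P x r a) (hT : 0 < T)
    {fstar : X → Fin K → ℝ} (hD : BoundedRewards D) (hbase : IsBaseClass G)
    (hreal : Realizes D G fstar) (hsep : PointwiseSeparable G) (hel : MeasurableElimination K G)
    (hC : 0 < C) {I : Finset ℕ} (hI : I ⊆ Finset.Icc 1 T) (act : Fin K) {ε N η : ℝ} (hε : 0 < ε)
    (hN : 0 < N) (hη : 0 < η)
    (hcov : ∫⁻ xs, coverNum G ε xs ∂Measure.pi (fun _ : Fin T => D.fst) ≤ ENNReal.ofReal N) :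
    P {ω | ∃ g ∈ G, 7 / 5 * ε * T + Real.log (N / η) < ∑ t ∈ I,
        excess (activeInd G T C (past z₀ x r a t ω) t act (x t ω)) (fstar (x t ω) act)
          (g (x t ω)) (r t ω act) (a t ω) act} ≤ ENNReal.ofReal η := by
  classical
  obtain ⟨B, hBm, hBex, hBcov, hBsum⟩ := exists_cover_partition hT hbase hsep hε
  have hfm : Measurable fun y => fstar y act := (hbase _ (hreal.1 act)).1
  have hf01 : ∀ y, fstar y act ∈ Set.Icc (0 : ℝ) 1 := (hbase _ (hreal.1 act)).2
  -- A cover vector read as one constant prediction per round. Clipping makes it admissible for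
  -- every rational vector and changes nothing for the vectors of a cover.
  let vv : (Fin T → ℚ) → ℕ → ℝ := fun v t =>
    if h : t - 1 < T then max 0 (min 1 (v ⟨t - 1, h⟩ : ℝ)) else 0
  have hvv : ∀ v t, vv v t ∈ Set.Icc (0 : ℝ) 1 := by
    intro v t
    simp only [vv]
    split_ifs <;> simp
  let η' : (Fin T → ℚ) → ℕ → (ℕ → Round X K) → X × (Fin K → ℝ) → Fin K → ℝ≥0∞ :=
    fun v t h z b => if t ∈ I then ENNReal.ofReal (Real.exp
      (excess (activeInd G T C h t act z.1) (fstar z.1 act) (vv v t) (z.2 act) b act)) else 1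
  have hη' : ∀ v t, IsStepWeight D G T C t (η' v t) := by
    intro v t
    by_cases ht : t ∈ I
    · simp only [η', ht, if_true]
      exact isStepWeight_excess hD hbase hreal hel hC (Finset.mem_Icc.1 (hI ht)).2 (hvv v t) act
    · simp only [η', ht, if_false]
      exact isStepWeight_one t
  let S : Ω → (Fin T → ℚ) → ℝ := fun ω v => ∑ t ∈ I,
    excess (activeInd G T C (past z₀ x r a t ω) t act (x t ω)) (fstar (x t ω) act)
      (vv v t) (r t ω act) (a t ω) act
  let xv : Ω → Fin T → X := fun ω i => x (i.val + 1) ω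
  have hxv : Measurable xv := measurable_pi_lambda _ fun i => hrun.measurable_context _
  have hW : ∀ ω v, weightProd z₀ (η' v) 0 T (past z₀ x r a (T + 1) ω)
      = ENNReal.ofReal (Real.exp (S ω v)) := by
    intro ω v
    have h1 : ∀ s ∈ Finset.Ico 0 T, η' v (s + 1) (truncate z₀ (s + 1) (past z₀ x r a (T + 1) ω))
        ((past z₀ x r a (T + 1) ω (s + 1)).1, (past z₀ x r a (T + 1) ω (s + 1)).2.2)
        (past z₀ x r a (T + 1) ω (s + 1)).2.1
        = if s + 1 ∈ I then ENNReal.ofReal (Real.exp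
          (excess (activeInd G T C (past z₀ x r a (s + 1) ω) (s + 1) act (x (s + 1) ω))
            (fstar (x (s + 1) ω) act) (vv v (s + 1)) (r (s + 1) ω act) (a (s + 1) ω) act))
          else 1 := by
      intro s hs
      have hs' := Finset.mem_Ico.1 hs
      rw [truncate_past (by omega), past_apply_of_mem (by simp; omega)]
    rw [weightProd, Finset.prod_congr rfl h1]
    rw [Finset.prod_Ico_add' (fun t => if t ∈ I then ENNReal.ofReal (Real.exp
          (excess (activeInd G T C (past z₀ x r a t ω) t act (x t ω))
            (fstar (x t ω) act) (vv v t) (r t ω act) (a t ω) act)) else 1) 0 T 1]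
    rw [Finset.prod_ite_mem, Finset.inter_eq_right.2]
    · rw [← ENNReal.ofReal_prod_of_nonneg fun _ _ => (Real.exp_pos _).le, ← Real.exp_sum]
    · intro t ht
      have := Finset.mem_Icc.1 (hI ht)
      simp; omega
  have hWm : ∀ v, Measurable fun ω => ENNReal.ofReal (Real.exp (S ω v)) := by
    intro v
    simp only [← hW]
    exact (measurable_weightProd (fun t => (hη' v t).1) 0 T).comp (hrun.measurable_past _)
  -- The indicator of `B V` involves all contexts of the run. The telescope drops the weights and
  -- leaves the probability of `B V` under an independent sample.
  have hbound : ∀ V v, ∫⁻ ω, (B V).indicator 1 (xv ω) * ENNReal.ofReal (Real.exp (S ω v)) ∂P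
      ≤ Measure.pi (fun _ => D.fst) (B V) := by
    intro V v
    have hF : Measurable fun q : (ℕ → Round X K) × (Fin T → X) =>
        (B V).indicator (1 : (Fin T → X) → ℝ≥0∞) q.2 :=
      (measurable_one.indicator (hBm V)).comp measurable_snd
    have := hrun.lintegral_telescope (z₀ := z₀) hel hC (hη' v) hF (Nat.zero_le T) le_rfl
    simp only [mixContexts_zero_past, hW] at this
    simpa [lintegral_indicator_one (hBm V)] using this
  have hterm : ∀ V v, Measurable fun ω =>
      (B V).indicator (1 : (Fin T → X) → ℝ≥0∞) (xv ω) * ENNReal.ofReal (Real.exp (S ω v)) :=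
    fun V v => ((measurable_one.indicator (hBm V)).comp hxv).mul (hWm v)
  -- Summing over the pieces and over the cover attached to each yields the expected cover size,
  -- hence at most the expected covering number.
  let Φ : Ω → ℝ≥0∞ := fun ω => ∑' V, ∑ v ∈ V,
    (B V).indicator (1 : (Fin T → X) → ℝ≥0∞) (xv ω) * ENNReal.ofReal (Real.exp (S ω v))
  have hΦm : Measurable Φ := Measurable.tsum fun V => Finset.measurable_sum _ fun v _ => hterm V v
  have hΦ : ∫⁻ ω, Φ ω ∂P ≤ ENNReal.ofReal N := by
    calc ∫⁻ ω, Φ ω ∂P = ∑' V, ∑ v ∈ V, ∫⁻ ω,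
          (B V).indicator 1 (xv ω) * ENNReal.ofReal (Real.exp (S ω v)) ∂P := by
          simp only [Φ]
          rw [lintegral_tsum fun V =>
            (Finset.measurable_sum _ fun v _ => hterm V v).aemeasurable]
          exact tsum_congr fun V => lintegral_finsetSum _ fun v _ => hterm V v
      _ ≤ ∑' V, (V.card : ℝ≥0∞) * Measure.pi (fun _ => D.fst) (B V) := by
          refine ENNReal.tsum_le_tsum fun V => ?_
          refine (Finset.sum_le_sum fun v _ => hbound V v).trans ?_
          simp
      _ = ∫⁻ xs, ∑' V, (B V).indicator (fun _ => (V.card : ℝ≥0∞)) xs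
            ∂Measure.pi (fun _ => D.fst) := by
          rw [lintegral_tsum fun V => (measurable_const.indicator (hBm V)).aemeasurable]
          refine tsum_congr fun V => ?_
          rw [lintegral_indicator_const (hBm V)]
      _ ≤ ∫⁻ xs, coverNum G ε xs ∂Measure.pi (fun _ => D.fst) := lintegral_mono hBsum
      _ ≤ _ := hcov
  refine le_trans ?_ (measure_gt_div_le hΦm.aemeasurable hN hη hΦ)
  refine measure_mono_ae ?_
  filter_upwards [hrun.ae_bounded hD] with ω hω
  rintro ⟨g, hg, hlt⟩
  obtain ⟨V, hV⟩ := hBex (xv ω)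
  obtain ⟨v, hv, hle⟩ := (hBcov V hV).2 g hg
  have hv01 := (hBcov V hV).1 v hv
  -- The error is the Lipschitz constant `7/10` times the total deviation `2 ε T` of the rational
  -- cover.
  have hS : ∑ t ∈ I, excess (activeInd G T C (past z₀ x r a t ω) t act (x t ω))
      (fstar (x t ω) act) (g (x t ω)) (r t ω act) (a t ω) act
      ≤ S ω v + 7 / 5 * ε * T := by
    have h1 : ∀ t ∈ I, excess (activeInd G T C (past z₀ x r a t ω) t act (x t ω))
        (fstar (x t ω) act) (g (x t ω)) (r t ω act) (a t ω) act
        ≤ excess (activeInd G T C (past z₀ x r a t ω) t act (x t ω))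
        (fstar (x t ω) act) (vv v t) (r t ω act) (a t ω) act
          + 7 / 10 * |g (x t ω) - vv v t| := fun t ht =>
      abs_excess_sub_le act.pos (activeInd_mem_Icc _ _ _ _) (hf01 _) ((hbase g hg).2 _)
        (hvv v t) (hω t (hI ht) act) _ _
    have h2 : ∑ t ∈ I, |g (x t ω) - vv v t| ≤ 2 * ε * T := by
      refine le_trans ?_ hle
      calc ∑ t ∈ I, |g (x t ω) - vv v t| ≤ ∑ t ∈ Finset.Ico (0 + 1) (T + 1),
            |g (x t ω) - vv v t| := by
            refine Finset.sum_le_sum_of_subset_of_nonneg (fun t ht => ?_)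
              fun _ _ _ => abs_nonneg _
            have := Finset.mem_Icc.1 (hI ht)
            simp; omega
        _ = ∑ s ∈ Finset.range T, |g (x (s + 1) ω) - vv v (s + 1)| := by
            rw [← Finset.sum_Ico_add' (fun t => |g (x t ω) - vv v t|) 0 T 1,
              Finset.range_eq_Ico]
        _ = ∑ i : Fin T, |g (x (i.val + 1) ω) - vv v (i.val + 1)| :=
            (Fin.sum_univ_eq_sum_range (fun s => |g (x (s + 1) ω) - vv v (s + 1)|) T).symm
        _ = _ := by
            refine Finset.sum_congr rfl fun i _ => ?_
            have : vv v (i.val + 1) = v i := by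
              simp only [vv, Nat.add_sub_cancel, i.isLt, dif_pos]
              rw [min_eq_right (hv01 i).2, max_eq_right (hv01 i).1]
            rw [this]
    calc _ ≤ _ := Finset.sum_le_sum h1
      _ = S ω v + 7 / 10 * ∑ t ∈ I, |g (x t ω) - vv v t| := by
        rw [Finset.sum_add_distrib, Finset.mul_sum]
      _ ≤ _ := by linarith
  have hlog : N / η ≤ Real.exp (S ω v) := by
    rw [← Real.exp_log (div_pos hN hη)]
    exact Real.exp_le_exp.2 (by linarith)
  calc ENNReal.ofReal (N / η) ≤ ENNReal.ofReal (Real.exp (S ω v)) :=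
        ENNReal.ofReal_le_ofReal hlog
    _ = (B V).indicator (1 : (Fin T → X) → ℝ≥0∞) (xv ω) * ENNReal.ofReal (Real.exp (S ω v)) := by
        rw [Set.indicator_of_mem hV, Pi.one_apply, one_mul]
    _ ≤ ∑ v ∈ V, (B V).indicator (1 : (Fin T → X) → ℝ≥0∞) (xv ω) *
          ENNReal.ofReal (Real.exp (S ω v)) :=
        Finset.single_le_sum (f := fun v => (B V).indicator (1 : (Fin T → X) → ℝ≥0∞) (xv ω) *
          ENNReal.ofReal (Real.exp (S ω v))) (fun _ _ => zero_le) hv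
    _ ≤ Φ ω := ENNReal.le_tsum V

/-- With high probability, the mean squared distances to `fstar` over a block of rounds, on the
contexts where `act` is plausible, are bounded by the empirical ones. -/
lemma IsRun.mean_concentration (hrun : IsRun D G T C P x r a) (hT : 0 < T)
    {fstar : X → Fin K → ℝ} (hbase : IsBaseClass G)
    (hreal : Realizes D G fstar) (hsep : PointwiseSeparable G) (hel : MeasurableElimination K G)
    (hC : 0 < C) {k₀ k : ℕ} (hk0 : k₀ < k) (hkT : k ≤ T) (act : Fin K) {ε N η : ℝ} (hε : 0 < ε)
    (hN : 0 < N) (hη : 0 < η)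
    (hcov : ∫⁻ xs, coverNum G ε xs ∂Measure.pi (fun _ : Fin T => D.fst) ≤ ENNReal.ofReal N) :
    P {ω | ∃ g ∈ G, 3 * ε * T + Real.log (N ^ 2 / η) < 1 / 8 * (((k - k₀ : ℕ) : ℝ) *
        ∫ y, activeInd G T C (past z₀ x r a (k₀ + 1) ω) (k₀ + 1) act y * (g y - fstar y act) ^ 2
          ∂D.fst - 3 * ∑ s ∈ Finset.Ico k₀ k,
        activeInd G T C (past z₀ x r a (k₀ + 1) ω) (k₀ + 1) act (x (s + 1) ω) *
          (g (x (s + 1) ω) - fstar (x (s + 1) ω) act) ^ 2)} ≤ ENNReal.ofReal η := by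
  classical
  obtain ⟨G₀, hsub, hcount, hdense⟩ := id hsep
  have hfm : Measurable fun y => fstar y act := (hbase _ (hreal.1 act)).1
  have hf01 : ∀ y, fstar y act ∈ Set.Icc (0 : ℝ) 1 := (hbase _ (hreal.1 act)).2
  have htT : k₀ + 1 ≤ T := by omega
  let I : Finset (Fin T) := Finset.univ.filter fun i => k₀ ≤ i.val ∧ i.val < k
  have hmap : I.map Fin.valEmbedding = Finset.Ico k₀ k := by
    ext s
    simp only [I, Finset.mem_map, Finset.mem_filter, Finset.mem_univ, true_and,
      Fin.valEmbedding_apply, Finset.mem_Ico]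
    constructor
    · rintro ⟨i, hi, rfl⟩; exact hi
    · intro hs; exact ⟨⟨s, by omega⟩, hs, rfl⟩
  have hcard : I.card = k - k₀ := by rw [← Finset.card_map, hmap, Nat.card_Ico]
  have hsumI : ∀ φ : ℕ → ℝ, ∑ i ∈ I, φ i.val = ∑ s ∈ Finset.Ico k₀ k, φ s := by
    intro φ
    rw [← hmap, Finset.sum_map]
    rfl
  obtain ⟨q, hq⟩ : ∃ q : (ℕ → Round X K) → X → ℝ,
      q = fun h y => activeInd G T C h (k₀ + 1) act y := ⟨_, rfl⟩
  have hqm : Measurable fun p : (ℕ → Round X K) × X => q p.1 p.2 := by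
    rw [hq]; exact measurable_activeInd hel hC htT act
  have hqm2 : ∀ h, Measurable (q h) := by
    rw [hq]; exact measurable_activeInd_right hel hC htT act
  have hq01 : ∀ h y, q h y ∈ Set.Icc (0 : ℝ) 1 := by
    rw [hq]; exact fun h y => activeInd_mem_Icc h _ act y
  have hq' : ∀ h y, activeInd G T C h (k₀ + 1) act y = q h y := by
    rw [hq]; exact fun _ _ => rfl
  simp only [hq']
  clear hq hq'
  let F : (ℕ → Round X K) × (Fin T → X) → ℝ≥0∞ := fun p =>
    meanGap D.fst I (fun g y => q p.1 y * (g y - fstar y act) ^ 2) G₀ p.2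
  have hF : Measurable F := measurable_meanGap_uncurry I hcount
    (fun g hg => (hbase g (hsub hg)).1) hqm hfm
  -- With trivial weights the telescope treats the contexts of the block as an independent sample,
  -- given the data before the block; these data determine the weight `q`.
  have hmain := hrun.lintegral_telescope (z₀ := z₀) hel hC (η := fun _ _ _ _ => 1)
    (fun t => isStepWeight_one t) hF hk0.le hkT
  let xv : Ω → Fin T → X := fun ω i => x (i.val + 1) ω
  let M : Ω → ℝ≥0∞ := fun ω => F (past z₀ x r a (k₀ + 1) ω, xv ω)
  have hMm : Measurable M := hF.comp ((hrun.measurable_past (k₀ + 1)).prodMk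
    (measurable_pi_lambda _ fun i => hrun.measurable_context (i.val + 1)))
  have hmix : ∀ ω y, F (past z₀ x r a (k₀ + 1) ω,
      mixContexts k₀ k (past z₀ x r a (k + 1) ω) y) = M ω := by
    intro ω y
    refine meanGap_congr fun i hi => ?_
    have hi' := (Finset.mem_filter.1 hi).2
    have h2 : i.val + 1 ∈ Finset.Ico 1 (k + 1) := by simp; omega
    simp only [mixContexts, if_pos hi', past_apply_of_mem h2, xv]
  have hN2 : (∫⁻ xs, coverNum G ε xs ∂Measure.pi (fun _ : Fin T => D.fst)) ^ 2
      ≤ ENNReal.ofReal (N ^ 2) := by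
    rw [ENNReal.ofReal_pow hN.le]
    gcongr
  have hint : ∫⁻ ω, M ω ∂P ≤ ENNReal.ofReal (Real.exp (3 * ε * T) * N ^ 2) := by
    simp only [hmix, weightProd, Finset.prod_const_one, mul_one] at hmain
    simp only [lintegral_const, measure_univ, mul_one] at hmain
    refine hmain.trans ?_
    calc _ ≤ ∫⁻ _ω, ENNReal.ofReal (Real.exp (3 * ε * T) * N ^ 2) ∂P := by
          refine lintegral_mono fun ω => ?_
          rw [ENNReal.ofReal_mul (Real.exp_pos _).le]
          exact (lintegral_meanGap_le hT D.fst I hbase hsep hsub hcount (hqm2 _) hfm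
            (hq01 _) hf01 hε).trans (by gcongr)
      _ = _ := by simp
  refine le_trans ?_ (measure_gt_div_le hMm.aemeasurable (by positivity) hη hint)
  refine measure_mono ?_
  rintro ω ⟨g, hg, hlt⟩
  have h1 : (0 : ℝ) < N ^ 2 / η := by positivity
  have hexp : Real.exp (3 * ε * T) * N ^ 2 / η
      = Real.exp (3 * ε * T + Real.log (N ^ 2 / η)) := by
    rw [Real.exp_add, Real.exp_log h1, mul_div_assoc]
  change ENNReal.ofReal (Real.exp (3 * ε * T) * N ^ 2 / η) ≤ M ω
  rw [hexp]
  refine ofReal_exp_le_meanGap I hbase hsub hdense (hqm2 _) hfm (hq01 _) hf01 hg ?_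
  rw [hcard, hsumI fun s => q (past z₀ x r a (k₀ + 1) ω) (x (s + 1) ω) *
    (g (x (s + 1) ω) - fstar (x (s + 1) ω) act) ^ 2]
  exact hlt

end Concentration

end RegCB

namespace RegCB

/-! ### The good event -/

/-- The excess square loss of `g` over `f` in one round, for the action `act`. -/
noncomputable def lossDiff {X : Type*} {K : ℕ} (z : X × Fin K × ℝ) (act : Fin K) (f g : X → ℝ) :
    ℝ :=
  if z.2.1 = act then (g z.1 - z.2.2) ^ 2 - (f z.1 - z.2.2) ^ 2 else 0

lemma two_mul_epochStart_pred {m : ℕ} (hm : 2 ≤ m) : epochStart m = 2 * epochStart (m - 1) := by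
  unfold epochStart
  rw [← pow_succ']
  congr 1
  omega

lemma one_le_epochStart (m : ℕ) : 1 ≤ epochStart m := Nat.one_le_two_pow

lemma epochOf_eq {m t : ℕ} (hm : 1 ≤ m) (h1 : epochStart m ≤ t) (h2 : t < 2 * epochStart m) :
    epochOf t = m := by
  unfold epochOf epochStart at *
  rw [(Nat.log_eq_iff (m := m - 1) (Or.inr ⟨by norm_num, by
    have := Nat.one_le_two_pow (n := m - 1); omega⟩)).2 ⟨h1, by rw [pow_succ]; omega⟩]
  omega

lemma epochStart_mono {m m' : ℕ} (h : m ≤ m') : epochStart m ≤ epochStart m' :=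
  Nat.pow_le_pow_right (by norm_num) (by omega)

lemma epochStart_le_of_le_epochOf {m T : ℕ} (hT : 1 ≤ T) (h : m ≤ epochOf T) :
    epochStart m ≤ T :=
  (epochStart_mono h).trans (epochStart_epochOf_le hT)

/-- `ε` and `N` witness that the confidence radius `C` dominates the deviations. -/
structure Adequate {X : Type*} [MeasurableSpace X] {K : ℕ} (D : Measure (X × (Fin K → ℝ)))
    (G : Set (X → ℝ)) (T : ℕ) (δ C ε N : ℝ) : Prop where
  scale_pos : 0 < ε
  one_le : 1 ≤ N
  lintegral_le : ∫⁻ xs, coverNum G ε xs ∂Measure.pi (fun _ : Fin T => D.fst) ≤ ENNReal.ofReal N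
  radius_le : 6 * ε * T + 4 * Real.log (N / (δ / (8 * epochOf T * K))) ≤ C / 2

section GoodEvent

variable {X Ω : Type*} {K : ℕ} {z₀ : Round X K} {x : ℕ → Ω → X} {r : ℕ → Ω → Fin K → ℝ}
  {a : ℕ → Ω → Fin K} {G : Set (X → ℝ)} {T : ℕ} {C : ℝ}

lemma activeInd_congr {h h' : ℕ → Round X K} {t t' : ℕ} (het : epochOf t = epochOf t')
    (heq : ∀ s ∈ Finset.Ico 1 (epochStart (epochOf t)), h s = h' s) (act : Fin K) (y : X) :
    activeInd G T C h t act y = activeInd G T C h' t' act y := by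
  unfold activeInd
  rw [activeSet_congr (d := obs h) (d' := obs h') (fun s hs => by simp [obs, heq s hs]),
    activeSet_eq_of_epochOf_eq het]

/-- Plausible sets are frozen during an epoch, being determined by the rounds before its start. -/
lemma activeInd_past_eq {m t : ℕ} (hm : 1 ≤ m) (h1 : epochStart m ≤ t)
    (h2 : t < 2 * epochStart m) (ω : Ω) (act : Fin K) (y : X) :
    activeInd G T C (past z₀ x r a t ω) t act y
      = activeInd G T C (past z₀ x r a (epochStart m) ω) (epochStart m) act y := by
  have e1 : epochOf t = m := epochOf_eq hm h1 h2
  have e2 : epochOf (epochStart m) = m :=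
    epochOf_eq hm le_rfl (by have := one_le_epochStart m; omega)
  refine activeInd_congr (e1.trans e2.symm) (fun s hs => ?_) act y
  rw [e1] at hs
  exact (past_eq_past hs h1 ω).symm

lemma sum_excess_eq (I : Finset ℕ) (w : ℕ → ℝ) (fstar : X → Fin K → ℝ) (g : X → ℝ) (act : Fin K)
    (ω : Ω) :
    ∑ t ∈ I, excess (w t) (fstar (x t ω) act) (g (x t ω)) (r t ω act) (a t ω) act
      = 1 / (10 * K) * ∑ t ∈ I, w t * (g (x t ω) - fstar (x t ω) act) ^ 2
        - 1 / 4 * ∑ t ∈ I, lossDiff (x t ω, a t ω, r t ω (a t ω)) act (fun y => fstar y act) g := by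
  rw [Finset.mul_sum, Finset.mul_sum, ← Finset.sum_sub_distrib]
  refine Finset.sum_congr rfl fun t _ => ?_
  unfold excess lossDiff
  congr 1
  · ring
  · by_cases h : a t ω = act
    · subst h; simp
    · simp [h]

variable [MeasurableSpace X]

/-- On this event the version spaces behave as they should: excess losses are not too negative,
and weighted mean squared distances to `fstar` are controlled by excess losses. -/
structure GoodEvent (z₀ : Round X K) (x : ℕ → Ω → X) (r : ℕ → Ω → Fin K → ℝ)
    (a : ℕ → Ω → Fin K) (D : Measure (X × (Fin K → ℝ))) (G : Set (X → ℝ)) (T : ℕ) (C : ℝ)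
    (fstar : X → Fin K → ℝ) (ω : Ω) : Prop where
  neg_sum_le : ∀ m ∈ Finset.Icc 2 (epochOf T), ∀ act, ∀ g ∈ G,
    -∑ s ∈ Finset.Ico 1 (epochStart m), lossDiff (x s ω, a s ω, r s ω (a s ω)) act
      (fun y => fstar y act) g ≤ C / 2
  sum_sq_le : ∀ m ∈ Finset.Icc 2 (epochOf T), ∀ act, ∀ g ∈ G,
    4 / (10 * K) * ∑ s ∈ Finset.Ico (epochStart (m - 1)) (epochStart m),
      activeInd G T C (past z₀ x r a (epochStart (m - 1)) ω) (epochStart (m - 1)) act (x s ω) *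
        (g (x s ω) - fstar (x s ω) act) ^ 2
      ≤ ∑ s ∈ Finset.Ico (epochStart (m - 1)) (epochStart m),
        lossDiff (x s ω, a s ω, r s ω (a s ω)) act (fun y => fstar y act) g + C / 2
  mean_sq_le : ∀ m ∈ Finset.Icc 2 (epochOf T), ∀ act, ∀ g ∈ G,
    epochStart (m - 1) * ∫ y, activeInd G T C (past z₀ x r a (epochStart (m - 1)) ω)
        (epochStart (m - 1)) act y * (g y - fstar y act) ^ 2 ∂D.fst
      ≤ 3 * ∑ s ∈ Finset.Ico (epochStart (m - 1)) (epochStart m),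
        activeInd G T C (past z₀ x r a (epochStart (m - 1)) ω) (epochStart (m - 1)) act (x s ω) *
          (g (x s ω) - fstar (x s ω) act) ^ 2 + 2 * C

variable [MeasurableSpace Ω] {D : Measure (X × (Fin K → ℝ))} {P : Measure Ω}
  [IsProbabilityMeasure D] [IsProbabilityMeasure P]

/-- Union bound over the epochs, the actions and three deviations, each of probability at most `δ /
(8 M K)`, for a total of at most `3δ/8`. The other half of `δ` is kept for the realized regret. -/
lemma IsRun.measure_not_goodEvent_le (hrun : IsRun D G T C P x r a) (hT : 2 ≤ T)
    {fstar : X → Fin K → ℝ} (hD : BoundedRewards D) (hbase : IsBaseClass G)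
    (hreal : Realizes D G fstar) (hsep : PointwiseSeparable G) (hel : MeasurableElimination K G)
    (hC : 0 < C) (hK : 1 ≤ K) {δ ε N : ℝ} (hδ : 0 < δ) (hδ1 : δ < 1)
    (had : Adequate D G T δ C ε N) :
    P {ω | ¬ GoodEvent z₀ x r a D G T C fstar ω} ≤ ENNReal.ofReal (δ / 2) := by
  classical
  obtain ⟨hε, hN1, hcov, hrad⟩ := had
  have hN : 0 < N := by linarith
  have hM1 : 1 ≤ epochOf T := by simp [epochOf]
  have hMR : (1 : ℝ) ≤ epochOf T := by exact_mod_cast hM1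
  have hKR : (1 : ℝ) ≤ K := by exact_mod_cast hK
  have hTR : (2 : ℝ) ≤ T := by exact_mod_cast hT
  set η : ℝ := δ / (8 * epochOf T * K) with hηdef
  have hη : 0 < η := by positivity
  have hη1 : η ≤ 1 := by
    rw [hηdef, div_le_one (by positivity)]
    nlinarith
  have hL : 0 ≤ Real.log (N / η) := Real.log_nonneg (by
    rw [le_div_iff₀ hη]; linarith)
  let A1 : ℕ → Fin K → Set Ω := fun m act =>
    {ω | ∃ g ∈ G, 7 / 5 * ε * T + Real.log (N / η) < ∑ t ∈ Finset.Ico 1 (epochStart m),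
        excess (activeInd G T C (past z₀ x r a t ω) t act (x t ω)) (fstar (x t ω) act)
          (g (x t ω)) (r t ω act) (a t ω) act}
  let A2 : ℕ → Fin K → Set Ω := fun m act =>
    {ω | ∃ g ∈ G, 7 / 5 * ε * T + Real.log (N / η)
        < ∑ t ∈ Finset.Ico (epochStart (m - 1)) (epochStart m),
        excess (activeInd G T C (past z₀ x r a t ω) t act (x t ω)) (fstar (x t ω) act)
          (g (x t ω)) (r t ω act) (a t ω) act}
  let A3 : ℕ → Fin K → Set Ω := fun m act =>
    {ω | ∃ g ∈ G, 3 * ε * T + Real.log (N ^ 2 / η) < 1 / 8 * ((epochStart (m - 1) : ℝ) *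
        ∫ y, activeInd G T C (past z₀ x r a (epochStart (m - 1)) ω) (epochStart (m - 1)) act y *
          (g y - fstar y act) ^ 2 ∂D.fst
          - 3 * ∑ s ∈ Finset.Ico (epochStart (m - 1)) (epochStart m),
        activeInd G T C (past z₀ x r a (epochStart (m - 1)) ω) (epochStart (m - 1)) act (x s ω) *
          (g (x s ω) - fstar (x s ω) act) ^ 2)}
  have hIle : ∀ m ∈ Finset.Icc 2 (epochOf T), epochStart m ≤ T := fun m hm =>
    epochStart_le_of_le_epochOf (by omega) (Finset.mem_Icc.1 hm).2
  have hA1 : ∀ m ∈ Finset.Icc 2 (epochOf T), ∀ act, P (A1 m act) ≤ ENNReal.ofReal η := by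
    intro m hm act
    refine hrun.excess_concentration (by omega) hD hbase hreal hsep hel hC ?_ act hε hN hη hcov
    intro t ht
    have := Finset.mem_Ico.1 ht
    have := hIle m hm
    rw [Finset.mem_Icc]; omega
  have hA2 : ∀ m ∈ Finset.Icc 2 (epochOf T), ∀ act, P (A2 m act) ≤ ENNReal.ofReal η := by
    intro m hm act
    refine hrun.excess_concentration (by omega) hD hbase hreal hsep hel hC ?_ act hε hN hη hcov
    intro t ht
    have := Finset.mem_Ico.1 ht
    have := hIle m hm
    have := one_le_epochStart (m - 1)
    rw [Finset.mem_Icc]; omega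
  have hA3 : ∀ m ∈ Finset.Icc 2 (epochOf T), ∀ act, P (A3 m act) ≤ ENNReal.ofReal η := by
    intro m hm act
    have h1 := one_le_epochStart (m - 1)
    have h2 := two_mul_epochStart_pred (Finset.mem_Icc.1 hm).1
    have h3 := hIle m hm
    -- Blocks of coordinates start at `0`, epochs at round `1`, so both ends of the block are
    -- shifted by one.
    have e1 : epochStart (m - 1) - 1 + 1 = epochStart (m - 1) := by omega
    have e2 : epochStart m - 1 + 1 = epochStart m := by omega
    have e3 : epochStart m - 1 - (epochStart (m - 1) - 1) = epochStart (m - 1) := by omega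
    have := hrun.mean_concentration (z₀ := z₀) (by omega) hbase hreal hsep hel hC
      (k₀ := epochStart (m - 1) - 1) (k := epochStart m - 1) (by omega) (by omega) act hε hN hη hcov
    rw [e1, e3] at this
    refine le_trans (le_of_eq ?_) this
    congr 1
    ext ω
    simp only [A3, Set.mem_ofPred_eq]
    have e4 : ∀ φ : ℕ → ℝ, ∑ s ∈ Finset.Ico (epochStart (m - 1) - 1) (epochStart m - 1), φ (s + 1)
        = ∑ s ∈ Finset.Ico (epochStart (m - 1)) (epochStart m), φ s := by
      intro φ
      rw [Finset.sum_Ico_add', e1, e2]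
    refine exists_congr fun g => and_congr_right fun hg => ?_
    rw [e4 fun s =>
      activeInd G T C (past z₀ x r a (epochStart (m - 1)) ω) (epochStart (m - 1)) act (x s ω) *
          (g (x s ω) - fstar (x s ω) act) ^ 2]
  have hsub : {ω | ¬ GoodEvent z₀ x r a D G T C fstar ω}
      ⊆ ⋃ m ∈ Finset.Icc 2 (epochOf T), ⋃ act ∈ (Finset.univ : Finset (Fin K)),
        (A1 m act ∪ A2 m act ∪ A3 m act) := by
    intro ω hω
    by_contra hcon
    simp only [Set.mem_iUnion, Set.mem_union, not_exists, not_or] at hcon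
    refine hω ⟨fun m hm act g hg => ?_, fun m hm act g hg => ?_, fun m hm act g hg => ?_⟩
    · have h1 := (hcon m hm act (Finset.mem_univ _)).1.1
      simp only [A1, Set.mem_ofPred_eq, not_exists, not_and, not_lt] at h1
      have h2 := h1 g hg
      rw [sum_excess_eq (w := fun t => activeInd G T C (past z₀ x r a t ω) t act (x t ω))] at h2
      have h3 : 0 ≤ 1 / (10 * (K : ℝ)) * ∑ t ∈ Finset.Ico 1 (epochStart m),
          activeInd G T C (past z₀ x r a t ω) t act (x t ω) *
            (g (x t ω) - fstar (x t ω) act) ^ 2 :=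
        mul_nonneg (by positivity) (Finset.sum_nonneg fun t _ =>
          mul_nonneg (activeInd_mem_Icc _ _ _ _).1 (sq_nonneg _))
      have h4 : 0 ≤ ε * T := by positivity
      linarith
    · have h1 := (hcon m hm act (Finset.mem_univ _)).1.2
      simp only [A2, Set.mem_ofPred_eq, not_exists, not_and, not_lt] at h1
      have h2 := h1 g hg
      rw [sum_excess_eq (w := fun t => activeInd G T C (past z₀ x r a t ω) t act (x t ω))] at h2
      have h3 : ∀ t ∈ Finset.Ico (epochStart (m - 1)) (epochStart m),
          activeInd G T C (past z₀ x r a t ω) t act (x t ω) *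
            (g (x t ω) - fstar (x t ω) act) ^ 2
          = activeInd G T C (past z₀ x r a (epochStart (m - 1)) ω) (epochStart (m - 1)) act
            (x t ω) * (g (x t ω) - fstar (x t ω) act) ^ 2 := by
        intro t ht
        have hm2 := (Finset.mem_Icc.1 hm).1
        have ht' := Finset.mem_Ico.1 ht
        rw [activeInd_past_eq (m := m - 1) (by omega) ht'.1
          (by rw [← two_mul_epochStart_pred hm2]; exact ht'.2)]
      rw [Finset.sum_congr rfl h3] at h2
      have h4 : 0 ≤ ε * T := by positivity
      have h5 : ∀ s : ℝ, 4 / (10 * (K : ℝ)) * s = 4 * (1 / (10 * (K : ℝ)) * s) := by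
        intro s; ring
      rw [h5]
      linarith
    · have h1 := (hcon m hm act (Finset.mem_univ _)).2
      simp only [A3, Set.mem_ofPred_eq, not_exists, not_and, not_lt] at h1
      have h2 := h1 g hg
      -- The square from the two samples only doubles the logarithm, because `η ≤ 1`; then `8 (3 ε T
      -- + 2 L) = 4 (6 ε T + 4 L) ≤ 2 C` with `L = log (N / η)`.
      have h3 : Real.log (N ^ 2 / η) ≤ 2 * Real.log (N / η) := by
        rw [← Real.log_rpow (div_pos hN hη)]
        refine Real.log_le_log (by positivity) ?_
        rw [Real.rpow_two, div_pow]
        refine div_le_div_of_nonneg_left (by positivity) (by positivity) ?_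
        nlinarith
      linarith
  calc P {ω | ¬ GoodEvent z₀ x r a D G T C fstar ω}
      ≤ P (⋃ m ∈ Finset.Icc 2 (epochOf T), ⋃ act ∈ (Finset.univ : Finset (Fin K)),
        (A1 m act ∪ A2 m act ∪ A3 m act)) := measure_mono hsub
    _ ≤ ∑ m ∈ Finset.Icc 2 (epochOf T), P (⋃ act ∈ (Finset.univ : Finset (Fin K)),
        (A1 m act ∪ A2 m act ∪ A3 m act)) := measure_biUnion_finset_le _ _
    _ ≤ ∑ m ∈ Finset.Icc 2 (epochOf T), ∑ _act : Fin K, ENNReal.ofReal (3 * η) := by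
        refine Finset.sum_le_sum fun m hm => (measure_biUnion_finset_le _ _).trans ?_
        refine Finset.sum_le_sum fun act _ => ?_
        calc P (A1 m act ∪ A2 m act ∪ A3 m act)
            ≤ P (A1 m act) + P (A2 m act) + P (A3 m act) :=
              (measure_union_le _ _).trans (add_le_add (measure_union_le _ _) le_rfl)
          _ ≤ ENNReal.ofReal η + ENNReal.ofReal η + ENNReal.ofReal η :=
              add_le_add (add_le_add (hA1 m hm act) (hA2 m hm act)) (hA3 m hm act)
          _ = ENNReal.ofReal (3 * η) := by
              rw [← ENNReal.ofReal_add hη.le hη.le, ← ENNReal.ofReal_add (by positivity) hη.le]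
              congr 1; ring
    _ ≤ ENNReal.ofReal (δ / 2) := by
        rw [Finset.sum_const, Finset.sum_const, Nat.card_Icc, Finset.card_univ, Fintype.card_fin,
          smul_smul, nsmul_eq_mul, ← ENNReal.ofReal_natCast,
          ← ENNReal.ofReal_mul (Nat.cast_nonneg _)]
        refine ENNReal.ofReal_le_ofReal ?_
        have h1 : (((epochOf T + 1 - 2) * K : ℕ) : ℝ) ≤ epochOf T * K := by
          exact_mod_cast Nat.mul_le_mul_right K (by omega)
        calc _ ≤ (epochOf T * K : ℝ) * (3 * η) :=
              mul_le_mul_of_nonneg_right h1 (by positivity)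
          _ = 3 / 8 * δ := by rw [hηdef]; field_simp
          _ ≤ δ / 2 := by linarith

end GoodEvent

end RegCB

namespace RegCB

/-! ### Version spaces on the good event -/

section Deterministic

variable {X Ω : Type*} {K : ℕ} {G : Set (X → ℝ)} {T : ℕ} {C : ℝ}

lemma empLoss_sub_empLoss (d : ℕ → X × Fin K × ℝ) (m : ℕ) (act : Fin K) (f g : X → ℝ) :
    empLoss d m act g - empLoss d m act f
      = 1 / ((epochStart m : ℝ) - 1) *
        ∑ s ∈ Finset.Ico 1 (epochStart m), lossDiff (d s) act f g := by
  unfold empLoss lossDiff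
  rw [← mul_sub, ← Finset.sum_sub_distrib]
  congr 1
  refine Finset.sum_congr rfl fun s _ => ?_
  split_ifs <;> simp

lemma bddBelow_empLoss (d : ℕ → X × Fin K × ℝ) {m : ℕ} (act : Fin K) :
    BddBelow (empLoss d m act '' G) := by
  refine ⟨0, ?_⟩
  rintro _ ⟨g, -, rfl⟩
  unfold empLoss
  have h1 : (1 : ℝ) ≤ epochStart m := by exact_mod_cast one_le_epochStart m
  refine mul_nonneg (div_nonneg zero_le_one (by linarith)) (Finset.sum_nonneg fun s _ => ?_)
  split_ifs
  · exact sq_nonneg _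
  · exact le_rfl

/-- The version space compares with the minimal loss, the analysis with `f`. As no member of the
class beats `f` by more than `C/2` in total, giving up `C/2` of the tolerance bridges the two. -/
lemma mem_versionSpace_of_sum_le {d : ℕ → X × Fin K × ℝ} {m : ℕ} (hm : 2 ≤ m) {act : Fin K}
    {f g : X → ℝ} (hg : g ∈ G)
    (hmin : ∀ g' ∈ G, -∑ s ∈ Finset.Ico 1 (epochStart m), lossDiff (d s) act f g' ≤ C / 2)
    (hle : ∑ s ∈ Finset.Ico 1 (epochStart m), lossDiff (d s) act f g
      ≤ ((epochOf T : ℝ) - m + 1) * C - C / 2) :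
    g ∈ versionSpace G d m (tolerance T C m) act := by
  refine ⟨hg, Or.inr ?_⟩
  have h2 : (0 : ℝ) < (epochStart m : ℝ) - 1 := by
    have : (1 : ℝ) < epochStart m := by exact_mod_cast one_lt_epochStart hm
    linarith
  have hinf : empLoss d m act f - (C / 2) / ((epochStart m : ℝ) - 1)
      ≤ sInf (empLoss d m act '' G) := by
    refine le_csInf ⟨_, g, hg, rfl⟩ ?_
    rintro _ ⟨g', hg', rfl⟩
    have h3 := empLoss_sub_empLoss d m act f g'
    have h4 : -(C / 2) / ((epochStart m : ℝ) - 1) ≤ empLoss d m act g' - empLoss d m act f := by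
      rw [h3, one_div, inv_mul_eq_div]
      exact div_le_div_of_nonneg_right (by linarith [hmin g' hg']) h2.le
    rw [neg_div] at h4
    linarith
  have h5 : empLoss d m act g - empLoss d m act f
      ≤ (((epochOf T : ℝ) - m + 1) * C - C / 2) / ((epochStart m : ℝ) - 1) := by
    rw [empLoss_sub_empLoss, one_div, inv_mul_eq_div]
    exact div_le_div_of_nonneg_right hle h2.le
  rw [sub_div] at h5
  unfold tolerance
  linarith

lemma sum_le_of_mem_versionSpace {d : ℕ → X × Fin K × ℝ} {m : ℕ} (hm : 2 ≤ m) {act : Fin K}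
    {f g : X → ℝ} (hf : f ∈ G) (hg : g ∈ versionSpace G d m (tolerance T C m) act) :
    ∑ s ∈ Finset.Ico 1 (epochStart m), lossDiff (d s) act f g
      ≤ ((epochOf T : ℝ) - m + 1) * C := by
  have h2 : (0 : ℝ) < (epochStart m : ℝ) - 1 := by
    have : (1 : ℝ) < epochStart m := by exact_mod_cast one_lt_epochStart hm
    linarith
  have h1 := hg.2.resolve_left (by omega)
  have h3 : sInf (empLoss d m act '' G) ≤ empLoss d m act f :=
    csInf_le (bddBelow_empLoss d act) ⟨f, hf, rfl⟩
  have h4 : empLoss d m act g - empLoss d m act f ≤ tolerance T C m := by linarith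
  rw [empLoss_sub_empLoss, tolerance, one_div, inv_mul_eq_div, div_le_div_iff_of_pos_right h2] at h4
  exact h4

variable {z₀ : Round X K} {x : ℕ → Ω → X} {r : ℕ → Ω → Fin K → ℝ} {a : ℕ → Ω → Fin K}

/-- The version spaces of a run. -/
def runVersionSpace (z₀ : Round X K) (x : ℕ → Ω → X) (r : ℕ → Ω → Fin K → ℝ) (a : ℕ → Ω → Fin K)
    (G : Set (X → ℝ)) (T : ℕ) (C : ℝ) (ω : Ω) (m : ℕ) : Fin K → Set (X → ℝ) :=
  versionSpace G (obs (past z₀ x r a (T + 1) ω)) m (tolerance T C m)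

lemma runVersionSpace_subset (ω : Ω) (m : ℕ) (c : Fin K) :
    runVersionSpace z₀ x r a G T C ω m c ⊆ G := fun _ hg => hg.1

lemma sum_lossDiff_obs {n n' : ℕ} (hn' : n' ≤ T + 1) (hn : 1 ≤ n) (ω : Ω) (act : Fin K)
    (f g : X → ℝ) :
    ∑ s ∈ Finset.Ico n n', lossDiff (obs (past z₀ x r a (T + 1) ω) s) act f g
      = ∑ s ∈ Finset.Ico n n', lossDiff (x s ω, a s ω, r s ω (a s ω)) act f g := by
  refine Finset.sum_congr rfl fun s hs => ?_
  have hs' := Finset.mem_Ico.1 hs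
  have : s ∈ Finset.Ico 1 (T + 1) := by rw [Finset.mem_Ico]; omega
  simp only [obs, past_apply_of_mem this]

lemma activeSet_past_eq {t : ℕ} (ht : t ∈ Finset.Icc 1 T) (ω : Ω) (y : X) :
    activeSet G T C (obs (past z₀ x r a t ω)) t y
      = {b | ∀ a', low (productClass (runVersionSpace z₀ x r a G T C ω (epochOf t))) y a'
          ≤ high (productClass (runVersionSpace z₀ x r a G T C ω (epochOf t))) y b} := by
  have ht' := Finset.mem_Icc.1 ht
  rw [activeSet_congr (d' := obs (past z₀ x r a (T + 1) ω))]
  · rfl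
  · intro s hs
    have h1 := epochStart_epochOf_le ht'.1
    have h2 : s ∈ Finset.Ico 1 t := by
      have := Finset.mem_Ico.1 hs
      rw [Finset.mem_Ico]; omega
    simp only [obs, past_eq_past h2 (show t ≤ T + 1 by omega)]

variable [MeasurableSpace X] {D : Measure (X × (Fin K → ℝ))} {fstar : X → Fin K → ℝ}

/-- On the good event, a member of a version space belongs to the previous one, and its mean
squared distance to `fstar` on the plausible contexts of the previous epoch is small. -/
lemma GoodEvent.mean_sq_le_of_mem {ω : Ω} (hω : GoodEvent z₀ x r a D G T C fstar ω) (hT : 1 ≤ T)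
    (hC : 0 < C) (hK : 1 ≤ K) (hf : fstar ∈ productClass fun _ => G) {m : ℕ}
    (hm : m ∈ Finset.Icc 2 (epochOf T)) {act : Fin K} {g : X → ℝ}
    (hg : g ∈ runVersionSpace z₀ x r a G T C ω m act) :
    g ∈ runVersionSpace z₀ x r a G T C ω (m - 1) act ∧
      ∫ y, activeInd G T C (past z₀ x r a (epochStart (m - 1)) ω)
        (epochStart (m - 1)) act y * (g y - fstar y act) ^ 2 ∂D.fst
        ≤ 17 * K * epochOf T * C / epochStart (m - 1) := by
  have hm' := Finset.mem_Icc.1 hm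
  have hgG : g ∈ G := hg.1
  have hKR : (1 : ℝ) ≤ K := by exact_mod_cast hK
  have hmR : (2 : ℝ) ≤ m := by exact_mod_cast hm'.1
  have hmM : (m : ℝ) ≤ epochOf T := by exact_mod_cast hm'.2
  have hτT : epochStart m ≤ T := epochStart_le_of_le_epochOf hT hm'.2
  have h2τ := two_mul_epochStart_pred hm'.1
  have h1τ := one_le_epochStart (m - 1)
  set ℓ : ℕ → ℝ := fun s => lossDiff (x s ω, a s ω, r s ω (a s ω)) act (fun y => fstar y act) g
  have hsplit : ∑ s ∈ Finset.Ico 1 (epochStart (m - 1)), ℓ s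
      + ∑ s ∈ Finset.Ico (epochStart (m - 1)) (epochStart m), ℓ s
      = ∑ s ∈ Finset.Ico 1 (epochStart m), ℓ s :=
    Finset.sum_Ico_consecutive _ h1τ (by omega)
  have hup : ∑ s ∈ Finset.Ico 1 (epochStart m), ℓ s ≤ ((epochOf T : ℝ) - m + 1) * C := by
    have := sum_le_of_mem_versionSpace hm'.1 (hf act) hg
    rwa [sum_lossDiff_obs (by omega) le_rfl] at this
  have hsq := hω.sum_sq_le m hm act g hgG
  have hmean := hω.mean_sq_le m hm act g hgG
  set W : ℝ := ∑ s ∈ Finset.Ico (epochStart (m - 1)) (epochStart m),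
      activeInd G T C (past z₀ x r a (epochStart (m - 1)) ω) (epochStart (m - 1)) act (x s ω) *
        (g (x s ω) - fstar (x s ω) act) ^ 2
  have hW : 0 ≤ W := Finset.sum_nonneg fun s _ =>
    mul_nonneg (activeInd_mem_Icc _ _ _ _).1 (sq_nonneg _)
  have hep : 0 ≤ ∑ s ∈ Finset.Ico (epochStart (m - 1)) (epochStart m), ℓ s + C / 2 :=
    le_trans (by positivity) hsq
  -- For `m = 2` no rounds precede epoch `1` and the sum is empty; the good event speaks only of
  -- epochs from `2` on.
  have hlow : -∑ s ∈ Finset.Ico 1 (epochStart (m - 1)), ℓ s ≤ C / 2 := by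
    rcases hm'.1.eq_or_lt with h | h
    · subst h
      simp [epochStart]
      positivity
    · exact hω.neg_sum_le (m - 1) (Finset.mem_Icc.2 ⟨by omega, by omega⟩) act g hgG
  constructor
  · rcases hm'.1.eq_or_lt with h | h
    · subst h
      exact ⟨hgG, Or.inl rfl⟩
    · have hmem : m - 1 ∈ Finset.Icc 2 (epochOf T) := Finset.mem_Icc.2 ⟨by omega, by omega⟩
      refine mem_versionSpace_of_sum_le (f := fun y => fstar y act) (by omega) hgG
        (fun g' hg' => ?_) ?_
      · rw [sum_lossDiff_obs (by omega) le_rfl]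
        exact hω.neg_sum_le (m - 1) hmem act g' hg'
      · rw [sum_lossDiff_obs (by omega) le_rfl]
        have hcast : ((m - 1 : ℕ) : ℝ) = (m : ℝ) - 1 := by
          rw [Nat.cast_sub (by omega)]; simp
        rw [hcast]
        -- Epoch `m - 1` contributes at least `-C/2`, so the earlier rounds total at most `(M - m +
        -- 1) C + C/2`, which equals the budget `(M - (m - 1) + 1) C - C/2` of the previous version
        -- space.
        have : ∑ s ∈ Finset.Ico 1 (epochStart (m - 1)), ℓ s
          ≤ ((epochOf T : ℝ) - (m - 1) + 1) * C - C / 2 := by linarith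
        exact this
  · have h1 : 4 / (10 * (K : ℝ)) * W ≤ 2 * epochOf T * C := by
      have : ((epochOf T : ℝ) - m + 1) * C ≤ (epochOf T - 1) * C :=
        mul_le_mul_of_nonneg_right (by linarith) hC.le
      have h3 : 0 < (epochOf T : ℝ) * C := mul_pos (by linarith) hC
      linarith
    have h2 : W ≤ 5 * K * epochOf T * C := by
      have h3 : W = (10 * K / 4) * (4 / (10 * (K : ℝ)) * W) := by field_simp
      rw [h3]
      calc _ ≤ (10 * K / 4) * (2 * epochOf T * C) :=
            mul_le_mul_of_nonneg_left h1 (by positivity)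
        _ = _ := by ring
    have hτ : (0 : ℝ) < epochStart (m - 1) := by exact_mod_cast h1τ
    rw [le_div_iff₀ hτ, mul_comm]
    -- Three times the bound on `W` plus the deviation `2 C` gives the constant `15 + 2 = 17`.
    have h4 : C ≤ K * epochOf T * C := by
      have : (1 : ℝ) ≤ K * epochOf T := by nlinarith
      nlinarith
    linarith

lemma GoodEvent.fstar_mem {ω : Ω} (hω : GoodEvent z₀ x r a D G T C fstar ω) (hT : 1 ≤ T)
    (hC : 0 < C) (hf : fstar ∈ productClass fun _ => G) {m : ℕ} (hm1 : 1 ≤ m)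
    (hm : m ≤ epochOf T) : fstar ∈ productClass (runVersionSpace z₀ x r a G T C ω m) := by
  intro act
  rcases hm1.eq_or_lt with h | h
  · subst h
    exact ⟨hf act, Or.inl rfl⟩
  · have hmem : m ∈ Finset.Icc 2 (epochOf T) := Finset.mem_Icc.2 ⟨h, hm⟩
    have hτT : epochStart m ≤ T := epochStart_le_of_le_epochOf hT hm
    refine mem_versionSpace_of_sum_le (f := fun y => fstar y act) h (hf act)
      (fun g' hg' => ?_) ?_
    · rw [sum_lossDiff_obs (by omega) le_rfl]
      exact hω.neg_sum_le m hmem act g' hg'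
    · have h0 : ∀ s, lossDiff (obs (past z₀ x r a (T + 1) ω) s) act (fun y => fstar y act)
          (fun y => fstar y act) = 0 := by
        intro s; unfold lossDiff; split_ifs <;> simp
      rw [Finset.sum_eq_zero fun s _ => h0 s]
      have hmM : (m : ℝ) ≤ epochOf T := by exact_mod_cast hm
      nlinarith

end Deterministic

end RegCB

namespace RegCB

/-! ### Policy regret of the version spaces -/

section PolicyRegret

variable {X : Type*} {K : ℕ} {G : Set (X → ℝ)}

lemma forall_low_le_high_of_argmax {S : Fin K → Set (X → ℝ)}
    (h01 : ∀ c, ∀ g ∈ S c, ∀ x, g x ∈ Set.Icc (0 : ℝ) 1) {y : X} {b : Fin K}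
    {f : X → Fin K → ℝ} (hf : f ∈ productClass S) (hb : b ∈ argmaxSet f y) (a' : Fin K) :
    low (productClass S) y a' ≤ high (productClass S) y b :=
  (csInf_le (bddBelow_image_productClass h01 y a') ⟨f, hf, rfl⟩).trans
    ((hb a').trans (le_csSup (bddAbove_image_productClass h01 y b) ⟨f, hf, rfl⟩))

/-- Since `f` prefers `b` to `π`, the gap is at most `(fs π - f π) + (f b - fs b)`. Errors at only
two actions matter, so weights are allowed that equal one there and are arbitrary nonnegative
elsewhere. -/
lemma sq_gap_le {f fs : Fin K → ℝ} {π b : Fin K} (hb : ∀ c, f c ≤ f b)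
    (hπ : ∀ c, fs c ≤ fs π) {w : Fin K → ℝ} (hw : ∀ c, 0 ≤ w c) (hwπ : w π = 1) (hwb : w b = 1) :
    (fs π - fs b) ^ 2 ≤ 2 * ∑ c, w c * (f c - fs c) ^ 2 := by
  classical
  have hnn : ∀ c, 0 ≤ w c * (f c - fs c) ^ 2 := fun c => mul_nonneg (hw c) (sq_nonneg _)
  by_cases h : π = b
  · subst h
    simpa using Finset.sum_nonneg fun c _ => hnn c
  · have h1 : ∑ c ∈ {π, b}, w c * (f c - fs c) ^ 2 ≤ ∑ c, w c * (f c - fs c) ^ 2 :=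
      Finset.sum_le_sum_of_subset_of_nonneg (Finset.subset_univ _) fun c _ _ => hnn c
    rw [Finset.sum_pair h, hwπ, hwb] at h1
    have h2 := hb π
    have h3 := hπ b
    nlinarith [sq_nonneg ((f π - fs π) + (f b - fs b)),
      mul_nonneg (sub_nonneg.2 h3) (sub_nonneg.2 h2)]

variable [MeasurableSpace X] {D : Measure (X × (Fin K → ℝ))}
  {fstar : X → Fin K → ℝ} {pol : (X → Fin K → ℝ) → X → Fin K}

lemma measurable_apply_policy {f : X → Fin K → ℝ} (hf : ∀ b, Measurable fun y => f y b)
    {π : X → Fin K} (hπ : Measurable π) : Measurable fun y => f y (π y) := by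
  have h1 : Measurable fun p : X × Fin K => f p.1 p.2 :=
    measurable_from_prod_countable_left fun b => hf b
  exact h1.comp (measurable_id.prodMk hπ)

lemma Realizes.measurable (hreal : Realizes D G fstar) (hbase : IsBaseClass G) (b : Fin K) :
    Measurable fun y => fstar y b := (hbase _ (hreal.1 b)).1

lemma Realizes.mem_Icc (hreal : Realizes D G fstar) (hbase : IsBaseClass G) (y : X) (b : Fin K) :
    fstar y b ∈ Set.Icc (0 : ℝ) 1 := (hbase _ (hreal.1 b)).2 y

/-- The loss in mean reward when playing greedily for `f` instead of `fstar`. -/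
def policyGap (fstar : X → Fin K → ℝ) (pol : (X → Fin K → ℝ) → X → Fin K) (f : X → Fin K → ℝ)
    (y : X) : ℝ := fstar y (pol fstar y) - fstar y (pol f y)

lemma measurable_policyGap (hbase : IsBaseClass G) (hreal : Realizes D G fstar)
    (hpol : IsGreedyRule G pol) {f : X → Fin K → ℝ} (hf : f ∈ productClass fun _ => G) :
    Measurable (policyGap fstar pol f) :=
  (measurable_apply_policy (hreal.measurable hbase) (hpol _ hreal.1).1).sub
    (measurable_apply_policy (hreal.measurable hbase) (hpol _ hf).1)

lemma policyGap_mem_Icc (hbase : IsBaseClass G) (hreal : Realizes D G fstar)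
    (hpol : IsGreedyRule G pol) (f : X → Fin K → ℝ) (y : X) :
    policyGap fstar pol f y ∈ Set.Icc (0 : ℝ) 1 := by
  have h1 := (hpol _ hreal.1).2 y (pol f y)
  have h2 := hreal.mem_Icc hbase y (pol fstar y)
  have h3 := hreal.mem_Icc hbase y (pol f y)
  unfold policyGap
  constructor <;> linarith [h2.1, h2.2, h3.1, h3.2]

variable [IsProbabilityMeasure D]

lemma mem_regretBall_iff (hD : BoundedRewards D) (hbase : IsBaseClass G)
    (hreal : Realizes D G fstar) (hpol : IsGreedyRule G pol) {f : X → Fin K → ℝ}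
    (hf : f ∈ productClass fun _ => G) {ε : ℝ} :
    f ∈ regretBall D G fstar pol ε ↔ ∫ y, policyGap fstar pol f y ∂D.fst ≤ ε := by
  have hbd : ∀ g ∈ productClass (fun _ : Fin K => G),
      Integrable (fun z : X × (Fin K → ℝ) => fstar z.1 (pol g z.1)) D := fun g hg =>
    Integrable.of_bound ((measurable_apply_policy (hreal.measurable hbase)
      (hpol g hg).1).comp measurable_fst).aestronglyMeasurable 1 (Eventually.of_forall fun z => by
        have := hreal.mem_Icc hbase z.1 (pol g z.1)
        rw [Real.norm_eq_abs, abs_of_nonneg this.1]; exact this.2)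
  have h1 : ∫ y, policyGap fstar pol f y ∂D.fst
      = ∫ z, fstar z.1 (pol fstar z.1) ∂D - ∫ z, fstar z.1 (pol f z.1) ∂D := by
    rw [← integral_sub (hbd _ hreal.1) (hbd _ hf), Measure.fst, integral_map
      measurable_fst.aemeasurable (measurable_policyGap hbase hreal hpol hf).aestronglyMeasurable]
    rfl
  rw [h1, ← integral_reward_policy hD hreal (hpol _ hf).1,
    ← integral_reward_policy hD hreal (hpol _ hreal.1).1]
  constructor
  · rintro ⟨-, h⟩
    linarith
  · intro h
    exact ⟨hf, by linarith⟩

lemma productClass_subset_regretBall (hD : BoundedRewards D) (hbase : IsBaseClass G)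
    (hreal : Realizes D G fstar) (hpol : IsGreedyRule G pol) {ε : ℝ} (hε : 1 ≤ ε) :
    productClass (fun _ => G) ⊆ regretBall D G fstar pol ε := by
  intro f hf
  rw [mem_regretBall_iff hD hbase hreal hpol hf]
  refine le_trans ?_ hε
  calc ∫ y, policyGap fstar pol f y ∂D.fst ≤ ∫ _y, (1 : ℝ) ∂D.fst := by
        refine integral_mono_of_nonneg
          (Eventually.of_forall fun y => (policyGap_mem_Icc hbase hreal hpol f y).1)
          (integrable_const _)
          (Eventually.of_forall fun y => (policyGap_mem_Icc hbase hreal hpol f y).2)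
    _ = 1 := by simp

variable {Ω : Type*} {T : ℕ} {C : ℝ} {z₀ : Round X K} {x : ℕ → Ω → X} {r : ℕ → Ω → Fin K → ℝ}
  {a : ℕ → Ω → Fin K}

/-- On the good event, the members of the version space of epoch `m` have small mean squared
policy gaps. -/
lemma GoodEvent.integral_policyGap_sq_le {ω : Ω} (hω : GoodEvent z₀ x r a D G T C fstar ω)
    (hT : 1 ≤ T) (hC : 0 < C) (hK : 1 ≤ K) (hbase : IsBaseClass G) (hreal : Realizes D G fstar)
    (hel : MeasurableElimination K G) (hpol : IsGreedyRule G pol) {m : ℕ}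
    (hm : m ∈ Finset.Icc 2 (epochOf T)) {f : X → Fin K → ℝ}
    (hf : f ∈ productClass (runVersionSpace z₀ x r a G T C ω m)) :
    ∫ y, policyGap fstar pol f y ^ 2 ∂D.fst
      ≤ 34 * K ^ 2 * epochOf T * C / epochStart (m - 1) := by
  have hm' := Finset.mem_Icc.1 hm
  set w : Fin K → X → ℝ := fun c y => activeInd G T C
    (past z₀ x r a (epochStart (m - 1)) ω) (epochStart (m - 1)) c y with hw
  have hfG : f ∈ productClass fun _ => G := fun c => runVersionSpace_subset ω m c (hf c)
  have hτT : epochStart (m - 1) ≤ T :=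
    epochStart_le_of_le_epochOf hT (by omega)
  have hτ1 := one_le_epochStart (m - 1)
  have hep : epochOf (epochStart (m - 1)) = m - 1 := epochOf_eq (by omega) le_rfl (by omega)
  have hVS01 : ∀ c, ∀ g ∈ runVersionSpace z₀ x r a G T C ω (m - 1) c, ∀ x,
      g x ∈ Set.Icc (0 : ℝ) 1 := fun c g hg => (hbase g hg.1).2
  -- Greedy actions of survivors of epoch `m - 1` are plausible throughout that epoch, so the
  -- weights do not suppress them.
  have hone : ∀ g ∈ productClass (runVersionSpace z₀ x r a G T C ω (m - 1)), ∀ y b,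
      b ∈ argmaxSet g y → w b y = 1 := by
    intro g hg y b hb
    refine if_pos ?_
    rw [activeSet_past_eq (Finset.mem_Icc.2 ⟨hτ1, hτT⟩), hep]
    exact forall_low_le_high_of_argmax hVS01 hg hb
  -- Nestedness enters here: `f` survived the previous epoch as well, so its greedy action and that
  -- of `fstar` both carry weight one.
  have hf' : f ∈ productClass (runVersionSpace z₀ x r a G T C ω (m - 1)) := fun c =>
    (hω.mean_sq_le_of_mem hT hC hK hreal.1 hm (hf c)).1
  have hfs' : fstar ∈ productClass (runVersionSpace z₀ x r a G T C ω (m - 1)) :=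
    hω.fstar_mem hT hC hreal.1 (by omega) (by omega)
  have hw0 : ∀ c y, 0 ≤ w c y := fun c y => (activeInd_mem_Icc _ _ _ _).1
  have hpt : ∀ y, policyGap fstar pol f y ^ 2 ≤ 2 * ∑ c, w c y * (f y c - fstar y c) ^ 2 :=
    fun y => sq_gap_le ((hpol _ hfG).2 y) ((hpol _ hreal.1).2 y) (fun c => hw0 c y)
      (hone _ hfs' y _ ((hpol _ hreal.1).2 y)) (hone _ hf' y _ ((hpol _ hfG).2 y))
  have hwm : ∀ c, Measurable (w c) := fun c => measurable_activeInd_right hel hC hτT c _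
  have hint : ∀ c, Integrable (fun y => w c y * (f y c - fstar y c) ^ 2) D.fst := by
    intro c
    refine Integrable.of_bound ((hwm c).mul (((hbase _ (hfG c)).1.sub
      (hreal.measurable hbase c)).pow_const _)).aestronglyMeasurable 1
      (Eventually.of_forall fun y => ?_)
    have h1 := activeInd_mem_Icc (G := G) (T := T) (C := C)
      (past z₀ x r a (epochStart (m - 1)) ω) (epochStart (m - 1)) c y
    have h2 := (hbase _ (hfG c)).2 y
    have h3 := hreal.mem_Icc hbase y c
    have h4 : (f y c - fstar y c) ^ 2 ≤ 1 := by
      rw [sq_le_one_iff_abs_le_one, abs_le]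
      constructor <;> linarith [h2.1, h2.2, h3.1, h3.2]
    rw [Real.norm_eq_abs, abs_of_nonneg (mul_nonneg h1.1 (sq_nonneg _))]
    exact mul_le_one₀ h1.2 (sq_nonneg _) h4
  calc ∫ y, policyGap fstar pol f y ^ 2 ∂D.fst
      ≤ ∫ y, 2 * ∑ c, w c y * (f y c - fstar y c) ^ 2 ∂D.fst :=
        integral_mono_of_nonneg (Eventually.of_forall fun y => sq_nonneg _)
          ((integrable_finsetSum _ fun c _ => hint c).const_mul _) (Eventually.of_forall hpt)
    _ = 2 * ∑ c, ∫ y, w c y * (f y c - fstar y c) ^ 2 ∂D.fst := by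
        rw [integral_const_mul, integral_finsetSum _ fun c _ => hint c]
    _ ≤ 2 * ∑ _c : Fin K, 17 * K * epochOf T * C / epochStart (m - 1) := by
        gcongr with c
        exact (hω.mean_sq_le_of_mem hT hC hK hreal.1 hm (hf c)).2
    _ = _ := by
        rw [Finset.sum_const, Finset.card_univ, Fintype.card_fin, nsmul_eq_mul]
        ring

lemma sq_integral_le_integral_sq {μ : Measure X} [IsProbabilityMeasure μ] {φ : X → ℝ}
    (hφ : Integrable φ μ) (hφ2 : Integrable (fun y => φ y ^ 2) μ) :
    (∫ y, φ y ∂μ) ^ 2 ≤ ∫ y, φ y ^ 2 ∂μ := by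
  set c := ∫ y, φ y ∂μ
  have h : ∫ y, (2 * c * φ y - c ^ 2) ∂μ ≤ ∫ y, φ y ^ 2 ∂μ :=
    integral_mono ((hφ.const_mul _).sub (integrable_const _)) hφ2 fun y => by
      have := sq_nonneg (φ y - c)
      simp only
      nlinarith
  rw [integral_sub (hφ.const_mul _) (integrable_const _), integral_const_mul] at h
  simp only [integral_const, probReal_univ, smul_eq_mul, one_mul] at h
  have : ∫ y, φ y ∂μ = c := rfl
  rw [this] at h
  nlinarith

lemma integrable_policyGap (hbase : IsBaseClass G) (hreal : Realizes D G fstar)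
    (hpol : IsGreedyRule G pol) {f : X → Fin K → ℝ} (hf : f ∈ productClass fun _ => G) :
    Integrable (policyGap fstar pol f) D.fst :=
  Integrable.of_bound (measurable_policyGap hbase hreal hpol hf).aestronglyMeasurable 1
    (Eventually.of_forall fun y => by
      have := policyGap_mem_Icc hbase hreal hpol f y
      rw [Real.norm_eq_abs, abs_of_nonneg this.1]; exact this.2)

lemma integrable_policyGap_sq (hbase : IsBaseClass G) (hreal : Realizes D G fstar)
    (hpol : IsGreedyRule G pol) {f : X → Fin K → ℝ} (hf : f ∈ productClass fun _ => G) :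
    Integrable (fun y => policyGap fstar pol f y ^ 2) D.fst :=
  Integrable.of_bound ((measurable_policyGap hbase hreal hpol hf).pow_const _).aestronglyMeasurable
    1 (Eventually.of_forall fun y => by
      have := policyGap_mem_Icc hbase hreal hpol f y
      rw [Real.norm_eq_abs, abs_of_nonneg (sq_nonneg _)]; exact pow_le_one₀ this.1 this.2)

/-- The policy regret is the mean of the gap, and by Jensen its square is at most the mean squared
gap. -/
lemma GoodEvent.subset_regretBall {ω : Ω} (hω : GoodEvent z₀ x r a D G T C fstar ω)
    (hT : 1 ≤ T) (hC : 0 < C) (hK : 1 ≤ K) (hD : BoundedRewards D) (hbase : IsBaseClass G)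
    (hreal : Realizes D G fstar)
    (hel : MeasurableElimination K G) (hpol : IsGreedyRule G pol) {m : ℕ}
    (hm : m ∈ Finset.Icc 2 (epochOf T)) {ε : ℝ} (hε : 0 ≤ ε)
    (hle : 34 * K ^ 2 * epochOf T * C / epochStart (m - 1) ≤ ε ^ 2) :
    productClass (runVersionSpace z₀ x r a G T C ω m) ⊆ regretBall D G fstar pol ε := by
  intro f hf
  have hfG : f ∈ productClass fun _ => G := fun c => runVersionSpace_subset ω m c (hf c)
  rw [mem_regretBall_iff hD hbase hreal hpol hfG]
  have h1 := hω.integral_policyGap_sq_le hT hC hK hbase hreal hel hpol hm hf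
  have h2 := sq_integral_le_integral_sq (integrable_policyGap hbase hreal hpol hfG)
    (integrable_policyGap_sq hbase hreal hpol hfG)
  exact abs_le_of_sq_le_sq' (h2.trans (h1.trans hle)) hε |>.2

/-- Under the margin condition the gap is either zero or at least `γ`, so `γ` times the gap is at
most its square: the radius becomes linear, not a square root, in the squared error. -/
lemma GoodEvent.subset_regretBall_of_massart {ω : Ω}
    (hω : GoodEvent z₀ x r a D G T C fstar ω)
    (hT : 1 ≤ T) (hC : 0 < C) (hK : 1 ≤ K) (hD : BoundedRewards D) (hbase : IsBaseClass G)
    (hreal : Realizes D G fstar)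
    (hel : MeasurableElimination K G) (hpol : IsGreedyRule G pol) {m : ℕ}
    (hm : m ∈ Finset.Icc 2 (epochOf T)) {γ ε : ℝ} (hγ : 0 < γ)
    (hmas : Massart D fstar (pol fstar) γ)
    (hle : 34 * K ^ 2 * epochOf T * C / epochStart (m - 1) ≤ ε * γ) :
    productClass (runVersionSpace z₀ x r a G T C ω m) ⊆ regretBall D G fstar pol ε := by
  intro f hf
  have hfG : f ∈ productClass fun _ => G := fun c => runVersionSpace_subset ω m c (hf c)
  rw [mem_regretBall_iff hD hbase hreal hpol hfG]
  have h1 := hω.integral_policyGap_sq_le hT hC hK hbase hreal hel hpol hm hf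
  have h2 : ∫ y, γ * policyGap fstar pol f y ∂D.fst ≤ ∫ y, policyGap fstar pol f y ^ 2 ∂D.fst := by
    refine integral_mono_ae ((integrable_policyGap hbase hreal hpol hfG).const_mul _)
      (integrable_policyGap_sq hbase hreal hpol hfG) ?_
    filter_upwards [hmas] with y hy
    by_cases h : pol f y = pol fstar y
    · simp [policyGap, h]
    · have h3 := hy _ h
      have h4 : γ ≤ policyGap fstar pol f y := by unfold policyGap; linarith
      nlinarith
  rw [integral_const_mul] at h2
  nlinarith

end PolicyRegret

end RegCB

namespace RegCB

/-! ### Mean regret of a round -/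

/-- The mean regret on the context `y` in round `t`, given the data `h`. -/
noncomputable def contextRegret {X : Type*} {K : ℕ} (G : Set (X → ℝ)) (T : ℕ) (C : ℝ)
    (fstar : X → Fin K → ℝ) (π : X → Fin K) (h : ℕ → Round X K) (t : ℕ) (y : X) : ℝ :=
  ∑ b, playProb G T C h t y b * (fstar y (π y) - fstar y b)

/-- The mean regret in round `t`, given the data `h`. -/
noncomputable def meanRegret {X : Type*} [MeasurableSpace X] {K : ℕ}
    (D : Measure (X × (Fin K → ℝ))) (G : Set (X → ℝ)) (T : ℕ) (C : ℝ)
    (fstar : X → Fin K → ℝ) (π : X → Fin K) (h : ℕ → Round X K) (t : ℕ) : ℝ≥0∞ :=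
  ∫⁻ y, ENNReal.ofReal (contextRegret G T C fstar π h t y) ∂D.fst

section MeanRegret

variable {X : Type*} {K : ℕ} {G : Set (X → ℝ)} {T : ℕ} {C : ℝ} {fstar : X → Fin K → ℝ}
  {π : X → Fin K} {h : ℕ → Round X K} {t : ℕ} {y : X}

lemma contextRegret_nonneg (hπ : π y ∈ argmaxSet fstar y) :
    0 ≤ contextRegret G T C fstar π h t y :=
  Finset.sum_nonneg fun b _ => mul_nonneg (playProb_nonneg _ _ _ _) (sub_nonneg.2 (hπ b))

lemma contextRegret_le {s : ℝ} (hs : 0 ≤ s)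
    (hgap : ∀ b ∈ activeSet G T C (obs h) t y, fstar y (π y) - fstar y b ≤ s) :
    contextRegret G T C fstar π h t y ≤ s := by
  calc contextRegret G T C fstar π h t y ≤ ∑ b, playProb G T C h t y b * s := by
        refine Finset.sum_le_sum fun b _ => ?_
        by_cases hb : b ∈ activeSet G T C (obs h) t y
        · exact mul_le_mul_of_nonneg_left (hgap b hb) (playProb_nonneg _ _ _ _)
        · rw [playProb_of_notMem hb, zero_mul, zero_mul]
    _ = (∑ b, playProb G T C h t y b) * s := by rw [Finset.sum_mul]
    _ ≤ s := mul_le_of_le_one_left hs (sum_playProb_le_one _ _ _)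

lemma sub_le_width {F : Set (X → Fin K → ℝ)}
    (h01 : ∀ f ∈ F, ∀ x b, f x b ∈ Set.Icc (0 : ℝ) 1) {f f' : X → Fin K → ℝ} (hf : f ∈ F)
    (hf' : f' ∈ F) (y : X) (b : Fin K) : f y b - f' y b ≤ width F y b := by
  have h1 : f y b ≤ high F y b := le_csSup
    ⟨1, by rintro _ ⟨k, hk, rfl⟩; exact (h01 k hk y b).2⟩ ⟨f, hf, rfl⟩
  have h2 : low F y b ≤ f' y b := csInf_le
    ⟨0, by rintro _ ⟨k, hk, rfl⟩; exact (h01 k hk y b).1⟩ ⟨f', hf', rfl⟩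
  unfold width
  linarith

/-- The contexts on which the class `F` disagrees and is wider than `s` at a disagreement action. -/
def wideRegion (F : Set (X → Fin K → ℝ)) (s : ℝ) : Set X :=
  {x | x ∈ disagreementRegion F ∧ ∃ a ∈ disagreementSet F x, s < width F x a}

/-- If the argmax sets agree nothing is lost. Otherwise `y` is a disagreement point, and off the
wide region both actions have width at most `s`; since `f` prefers `b`, passing from `fstar` to `f`
and back costs `s` at each of them. -/
lemma gap_le_of_notMem_wideRegion {F : Set (X → Fin K → ℝ)}
    (h01 : ∀ f ∈ F, ∀ x b, f x b ∈ Set.Icc (0 : ℝ) 1) (hfs : fstar ∈ F)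
    (hπ : π y ∈ argmaxSet fstar y) {s : ℝ} (hs : 0 ≤ s) (hy : y ∉ wideRegion F s)
    {f : X → Fin K → ℝ} (hf : f ∈ F) {b : Fin K} (hb : b ∈ argmaxSet f y) :
    fstar y (π y) - fstar y b ≤ 2 * s := by
  by_cases heq : argmaxSet f y = argmaxSet fstar y
  · have : fstar y (π y) ≤ fstar y b := by
      rw [heq] at hb; exact hb _
    linarith
  · have hw : ∀ a ∈ disagreementSet F y, width F y a ≤ s := by
      intro a ha
      by_contra hlt
      exact hy ⟨⟨f, hf, fstar, hfs, heq⟩, a, ha, not_le.1 hlt⟩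
    have hπ' : π y ∈ disagreementSet F y := Set.mem_biUnion hfs hπ
    have hb' : b ∈ disagreementSet F y := Set.mem_biUnion hf hb
    have h1 := (sub_le_width h01 hfs hf y (π y)).trans (hw _ hπ')
    have h2 := (sub_le_width h01 hf hfs y b).trans (hw _ hb')
    have h3 := hb (π y)
    linarith

variable [MeasurableSpace X] {D : Measure (X × (Fin K → ℝ))}
  {pol : (X → Fin K → ℝ) → X → Fin K}

lemma measure_wideRegion_le (hθ : disagreementCoeff D G fstar pol ≠ ⊤) {ε s : ℝ} (hε : 0 < ε)
    (hs : 0 < s) :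
    D.fst (wideRegion (regretBall D G fstar pol ε) s)
      ≤ ENNReal.ofReal ((disagreementCoeff D G fstar pol).toReal * ε / s) := by
  have h1 : ENNReal.ofReal (s / ε) * D.fst (wideRegion (regretBall D G fstar pol ε) s)
      ≤ disagreementCoeff D G fstar pol := by
    unfold disagreementCoeff
    exact le_iSup₂_of_le s hs (le_iSup₂_of_le ε hε le_rfl)
  have h2 : ENNReal.ofReal (ε / s) * ENNReal.ofReal (s / ε) = 1 := by
    rw [← ENNReal.ofReal_mul (by positivity)]
    have : ε / s * (s / ε) = 1 := by field_simp
    rw [this, ENNReal.ofReal_one]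
  calc _ = ENNReal.ofReal (ε / s) *
        (ENNReal.ofReal (s / ε) * D.fst (wideRegion (regretBall D G fstar pol ε) s)) := by
        rw [← mul_assoc, h2, one_mul]
    _ ≤ ENNReal.ofReal (ε / s) * disagreementCoeff D G fstar pol := by gcongr
    _ = _ := by
        rw [mul_div_assoc, mul_comm, ENNReal.ofReal_mul ENNReal.toReal_nonneg,
          ENNReal.ofReal_toReal hθ]

lemma fstar_mem_regretBall (hreal : Realizes D G fstar) {ε : ℝ} (hε : 0 ≤ ε) :
    fstar ∈ regretBall D G fstar pol ε :=
  ⟨hreal.1, by simpa using hε⟩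

lemma regretBall_mem_Icc (hbase : IsBaseClass G) {ε : ℝ} :
    ∀ f ∈ regretBall D G fstar pol ε, ∀ x b, f x b ∈ Set.Icc (0 : ℝ) 1 :=
  fun _ hf x b => (hbase _ (hf.1 b)).2 x

lemma contextRegret_le_one (hbase : IsBaseClass G) (hreal : Realizes D G fstar) :
    contextRegret G T C fstar π h t y ≤ 1 :=
  contextRegret_le zero_le_one fun b _ => by
    linarith [(hreal.mem_Icc hbase y (π y)).2, (hreal.mem_Icc hbase y b).1]

lemma measurable_contextRegret (hbase : IsBaseClass G) (hreal : Realizes D G fstar)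
    (hel : MeasurableElimination K G) (hC : 0 < C) (htT : t ≤ T) (hπ : Measurable π) :
    Measurable fun q : (ℕ → Round X K) × X => contextRegret G T C fstar π q.1 t q.2 := by
  refine Finset.measurable_sum _ fun b _ => (measurable_playProb hel hC htT b).mul ?_
  exact ((measurable_apply_policy (hreal.measurable hbase) hπ).sub
    (hreal.measurable hbase b)).comp measurable_snd

/-- With threshold `γ / 4`, a plausible action off the wide region loses at most `γ / 2 < γ`, so it
is the optimal one. Regret arises only on the wide region, where it is at most one. -/
lemma meanRegret_le_of_massart (hbase : IsBaseClass G) (hreal : Realizes D G fstar)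
    (hpol : IsGreedyRule G pol) (hθ : disagreementCoeff D G fstar pol ≠ ⊤) {γ ε : ℝ} (hε : 0 < ε)
    (hγ : 0 < γ) (hmas : Massart D fstar (pol fstar) γ)
    (hplaus : ∀ y, ∀ b ∈ activeSet G T C (obs h) t y,
      ∃ f ∈ regretBall D G fstar pol ε, b ∈ argmaxSet f y) :
    meanRegret D G T C fstar (pol fstar) h t
      ≤ ENNReal.ofReal (4 * (disagreementCoeff D G fstar pol).toReal * ε / γ) := by
  set S := wideRegion (regretBall D G fstar pol ε) (γ / 4)
  calc meanRegret D G T C fstar (pol fstar) h t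
      ≤ ∫⁻ y, S.indicator (fun _ => 1) y ∂D.fst := by
        refine lintegral_mono_ae ?_
        filter_upwards [hmas] with y hm
        by_cases hy : y ∈ S
        · rw [Set.indicator_of_mem hy]
          exact ENNReal.ofReal_le_one.2 (contextRegret_le_one hbase hreal)
        · rw [Set.indicator_of_notMem hy, nonpos_iff_eq_zero, ENNReal.ofReal_eq_zero]
          refine contextRegret_le le_rfl fun b hb => ?_
          obtain ⟨f, hf, hbf⟩ := hplaus y b hb
          have h1 := gap_le_of_notMem_wideRegion (regretBall_mem_Icc hbase)
            (fstar_mem_regretBall hreal hε.le) ((hpol _ hreal.1).2 y) (by positivity) hy hf hbf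
          by_cases hbπ : b = pol fstar y
          · simp [hbπ]
          · have := hm b hbπ
            linarith
    _ ≤ D.fst S := by simpa using lintegral_indicator_const_le (μ := D.fst) S 1
    _ ≤ ENNReal.ofReal ((disagreementCoeff D G fstar pol).toReal * ε / (γ / 4)) :=
        measure_wideRegion_le hθ hε (by positivity)
    _ = _ := by congr 1; field_simp

variable [IsProbabilityMeasure D]

lemma meanRegret_le_one (hbase : IsBaseClass G) (hreal : Realizes D G fstar) :
    meanRegret D G T C fstar π h t ≤ 1 := by
  calc meanRegret D G T C fstar π h t ≤ ∫⁻ _y, 1 ∂D.fst := lintegral_mono fun y =>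
        ENNReal.ofReal_le_one.2 (contextRegret_le_one hbase hreal)
    _ = 1 := by simp

lemma measurable_meanRegret (hbase : IsBaseClass G) (hreal : Realizes D G fstar)
    (hel : MeasurableElimination K G) (hC : 0 < C) (htT : t ≤ T) (hπ : Measurable π) :
    Measurable fun h => meanRegret D G T C fstar π h t :=
  (measurable_contextRegret hbase hreal hel hC htT hπ).ennreal_ofReal.lintegral_prod_right'

lemma meanRegret_le (hbase : IsBaseClass G) (hreal : Realizes D G fstar)
    (hpol : IsGreedyRule G pol) (hθ : disagreementCoeff D G fstar pol ≠ ⊤) {ε s : ℝ} (hε : 0 < ε)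
    (hs : 0 < s)
    (hplaus : ∀ y, ∀ b ∈ activeSet G T C (obs h) t y,
      ∃ f ∈ regretBall D G fstar pol ε, b ∈ argmaxSet f y) :
    meanRegret D G T C fstar (pol fstar) h t
      ≤ ENNReal.ofReal (2 * s + (disagreementCoeff D G fstar pol).toReal * ε / s) := by
  set S := wideRegion (regretBall D G fstar pol ε) s
  calc meanRegret D G T C fstar (pol fstar) h t
      ≤ ∫⁻ y, (S.indicator (fun _ => 1) y + ENNReal.ofReal (2 * s)) ∂D.fst := by
        refine lintegral_mono fun y => ?_
        by_cases hy : y ∈ S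
        · rw [Set.indicator_of_mem hy]
          exact le_add_right (ENNReal.ofReal_le_one.2 (contextRegret_le_one hbase hreal))
        · refine le_add_left (ENNReal.ofReal_le_ofReal (contextRegret_le (by positivity) ?_))
          intro b hb
          obtain ⟨f, hf, hbf⟩ := hplaus y b hb
          exact gap_le_of_notMem_wideRegion (regretBall_mem_Icc hbase)
            (fstar_mem_regretBall hreal hε.le) ((hpol _ hreal.1).2 y) hs.le hy hf hbf
    _ = ∫⁻ y, S.indicator (fun _ => 1) y ∂D.fst + ENNReal.ofReal (2 * s) := by
        rw [lintegral_add_right _ measurable_const]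
        simp
    _ ≤ D.fst S + ENNReal.ofReal (2 * s) := by
        gcongr
        simpa using lintegral_indicator_const_le (μ := D.fst) S 1
    _ ≤ ENNReal.ofReal ((disagreementCoeff D G fstar pol).toReal * ε / s)
          + ENNReal.ofReal (2 * s) := by
        gcongr
        exact measure_wideRegion_le hθ hε hs
    _ = _ := by
        rw [add_comm, ENNReal.ofReal_add (by positivity) (by positivity)]

/-- The threshold `√(θ ε)` balances the narrow contexts against the wide ones; for `θ = 0` it
degenerates and the threshold is sent to zero instead. -/
lemma meanRegret_le_sqrt (hbase : IsBaseClass G) (hreal : Realizes D G fstar)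
    (hpol : IsGreedyRule G pol) (hθ : disagreementCoeff D G fstar pol ≠ ⊤) {ε : ℝ} (hε : 0 < ε)
    (hplaus : ∀ y, ∀ b ∈ activeSet G T C (obs h) t y,
      ∃ f ∈ regretBall D G fstar pol ε, b ∈ argmaxSet f y) :
    meanRegret D G T C fstar (pol fstar) h t
      ≤ ENNReal.ofReal (3 * √((disagreementCoeff D G fstar pol).toReal * ε)) := by
  have hmain := fun s (hs : 0 < s) => meanRegret_le hbase hreal hpol hθ hε hs hplaus
  set θ := (disagreementCoeff D G fstar pol).toReal
  have hθ0 : 0 ≤ θ := ENNReal.toReal_nonneg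
  rcases hθ0.eq_or_lt with h0 | h0
  · rw [← h0]
    simp only [zero_mul, Real.sqrt_zero, mul_zero, ENNReal.ofReal_zero, nonpos_iff_eq_zero]
    refine le_antisymm (ENNReal.le_of_forall_pos_le_add fun s hs _ => ?_) zero_le
    have := hmain (s / 2) (by positivity)
    rw [← h0] at this
    simpa [mul_div_cancel₀] using this
  · have h1 : 0 < θ * ε := mul_pos h0 hε
    have h2 := hmain (√(θ * ε)) (Real.sqrt_pos.2 h1)
    rw [Real.div_sqrt] at h2
    convert h2 using 2
    ring

variable {Ω : Type*} {z₀ : Round X K} {x : ℕ → Ω → X} {r : ℕ → Ω → Fin K → ℝ}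
  {a : ℕ → Ω → Fin K}

/-- Attainment of the extrema is used here: it makes every plausible action greedy for a member of
the current version space. The padding `z₀` has rewards in the unit interval because attainment is
assumed only for such data. -/
lemma exists_argmax_of_mem_activeSet (hbase : IsBaseClass G) (hext : ExtremaAttained K G)
    (hC : 0 < C) (ht : t ∈ Finset.Icc 1 T) (hz₀ : ∀ b, z₀.2.2 b ∈ Set.Icc (0 : ℝ) 1) {ω : Ω}
    (hr : ∀ s ∈ Finset.Icc 1 T, ∀ b, r s ω b ∈ Set.Icc (0 : ℝ) 1) {y : X} {b : Fin K}
    (hb : b ∈ activeSet G T C (obs (past z₀ x r a t ω)) t y) :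
    ∃ f ∈ productClass (runVersionSpace z₀ x r a G T C ω (epochOf t)), b ∈ argmaxSet f y := by
  rw [activeSet_past_eq ht] at hb
  have hcase := epoch_cases hC (Finset.mem_Icc.1 ht).2
  refine (forall_low_le_high_iff_exists_argmax (fun c g hg => (hbase g hg.1).2)
    (fun c => hext _ (fun s => ?_) _ _ hcase.1 hcase.2 c y) b).1 hb
  by_cases hs : s ∈ Finset.Ico 1 (T + 1)
  · have hs' : s ∈ Finset.Icc 1 T := by
      rw [Finset.mem_Ico] at hs; rw [Finset.mem_Icc]; omega
    simp only [obs, past_apply_of_mem hs]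
    exact hr s hs' _
  · simp only [obs, past_apply_of_notMem hs]
    exact hz₀ _

end MeanRegret

end RegCB

namespace RegCB

/-! ### Concentration of the regret -/

section Regret

variable {X Ω : Type*} {K : ℕ} {G : Set (X → ℝ)} {T : ℕ} {C : ℝ} {fstar : X → Fin K → ℝ}
  {π : X → Fin K} {z₀ : Round X K} {x : ℕ → Ω → X} {r : ℕ → Ω → Fin K → ℝ} {a : ℕ → Ω → Fin K}
  [MeasurableSpace X] [MeasurableSpace Ω] {D : Measure (X × (Fin K → ℝ))} {P : Measure Ω}

lemma measurable_apply_policy_reward (hπ : Measurable π) :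
    Measurable fun z : X × (Fin K → ℝ) => z.2 (π z.1) := by
  have h1 : Measurable fun z : X × (Fin K → ℝ) => (π z.1, z.2) :=
    (hπ.comp measurable_fst).prodMk measurable_snd
  exact measurable_eval_action.comp h1

lemma IsRun.measurable_reward_policy (hrun : IsRun D G T C P x r a) (hπ : Measurable π) (t : ℕ) :
    Measurable fun ω => r t ω (π (x t ω)) :=
  measurable_eval_action.comp
    ((hπ.comp (hrun.measurable_context t)).prodMk (hrun.measurable_reward t))

lemma IsRun.measurable_reward_action (hrun : IsRun D G T C P x r a) (t : ℕ) :
    Measurable fun ω => r t ω (a t ω) :=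
  measurable_eval_action.comp ((hrun.measurable_action t).prodMk (hrun.measurable_reward t))

lemma IsRun.ae_abs_regret_le (hrun : IsRun D G T C P x r a) (hD : BoundedRewards D) :
    ∀ᵐ ω ∂P, |regret T π x r a ω| ≤ T := by
  filter_upwards [hrun.ae_bounded hD] with ω hω
  rw [regret, ← Finset.sum_sub_distrib]
  refine (Finset.abs_sum_le_sum_abs _ _).trans ?_
  calc ∑ t ∈ Finset.Icc 1 T, |r t ω (π (x t ω)) - r t ω (a t ω)|
      ≤ ∑ _t ∈ Finset.Icc 1 T, (1 : ℝ) := by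
        refine Finset.sum_le_sum fun t ht => ?_
        have h1 := hω t ht (π (x t ω))
        have h2 := hω t ht (a t ω)
        rw [abs_le]
        constructor <;> linarith [h1.1, h1.2, h2.1, h2.2]
    _ = T := by simp

lemma IsRun.measurable_regret (hrun : IsRun D G T C P x r a) (hπ : Measurable π) :
    Measurable (regret T π x r a) :=
  (Finset.measurable_sum _ fun t _ => hrun.measurable_reward_policy hπ t).sub
    (Finset.measurable_sum _ fun t _ => hrun.measurable_reward_action t)

lemma IsRun.integrable_regret [IsProbabilityMeasure P]
    (hrun : IsRun D G T C P x r a) (hD : BoundedRewards D) (hπ : Measurable π) :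
    Integrable (regret T π x r a) P :=
  Integrable.of_bound (hrun.measurable_regret hπ).aestronglyMeasurable T
    (hrun.ae_abs_regret_le hD)

variable [IsProbabilityMeasure D]

/-- The reward gap is affine in the rewards, so its mean is computed with `fstar`; `κ ≥ 1` keeps the
integrand nonnegative. It is used with `κ = 1 + l²` for exponential moments and with `κ = l = 1` for
the expectation. -/
lemma lintegral_sum_affine_gap_le (hD : BoundedRewards D) (hbase : IsBaseClass G)
    (hreal : Realizes D G fstar) (hel : MeasurableElimination K G) (hC : 0 < C) {t : ℕ}
    (htT : t ≤ T) (hπ : Measurable π) (hgr : ∀ y, π y ∈ argmaxSet fstar y) {κ l : ℝ}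
    (hl0 : 0 ≤ l) (hl1 : l ≤ 1) (hκ : 1 ≤ κ) (h : ℕ → Round X K) :
    ∫⁻ z, ∑ b, ENNReal.ofReal (κ + l * (z.2 (π z.1) - z.2 b)) *
        ENNReal.ofReal (playProb G T C h t z.1 b) ∂D
      ≤ ENNReal.ofReal κ + ENNReal.ofReal l * meanRegret D G T C fstar π h t := by
  classical
  set p : X → Fin K → ℝ := fun y b => playProb G T C h t y b
  have hp : ∀ b, Measurable fun y => p y b := fun b => measurable_playProb_right hel hC htT h b
  have hp0 : ∀ y b, 0 ≤ p y b := fun y b => playProb_nonneg _ _ _ _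
  have hp1 : ∀ y b, p y b ≤ 1 := fun y b => playProb_le_one _ _ _ _
  have hs1 : ∀ y, ∑ b, p y b ≤ 1 := fun y => sum_playProb_le_one _ _ _
  have hs0 : ∀ y, 0 ≤ ∑ b, p y b := fun y => Finset.sum_nonneg fun b _ => hp0 y b
  let u : X → ℝ := fun y => κ * ∑ b, p y b
  let c : X → Fin K → ℝ := fun y b => l * ((if π y = b then ∑ b, p y b else 0) - p y b)
  have hsm : Measurable fun y => ∑ b, p y b := Finset.measurable_sum _ fun b _ => hp b
  have hsum : ∀ y (s : Fin K → ℝ), u y + ∑ b, c y b * s b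
      = ∑ b, (κ + l * (s (π y) - s b)) * p y b := by
    intro y s
    have e1 : ∑ b, c y b * s b = l * ((∑ b, p y b) * s (π y)) - l * ∑ b, p y b * s b := by
      simp only [c, mul_assoc, sub_mul, ite_mul, zero_mul, ← Finset.mul_sum,
        Finset.sum_sub_distrib, Finset.sum_ite_eq, Finset.mem_univ, if_true, mul_sub]
    rw [e1]
    simp only [u, Finset.mul_sum, Finset.sum_mul, ← Finset.sum_sub_distrib,
      ← Finset.sum_add_distrib]
    exact Finset.sum_congr rfl fun b _ => by ring
  have hpos : ∀ y (s : Fin K → ℝ), (∀ b, s b ∈ Set.Icc (0 : ℝ) 1) → ∀ b,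
      0 ≤ κ + l * (s (π y) - s b) := by
    intro y s hs b
    have h1 := hs (π y)
    have h2 := hs b
    nlinarith [h1.1, h2.2, mul_nonneg hl0 (sub_nonneg.2 h2.2), mul_nonneg hl0 h1.1]
  have hnn : ∀ y, ∀ s : Fin K → ℝ, (∀ b, s b ∈ Set.Icc (0 : ℝ) 1) →
      0 ≤ u y + ∑ b, c y b * s b := by
    intro y s hs
    rw [hsum]
    exact Finset.sum_nonneg fun b _ => mul_nonneg (hpos y s hs b) (hp0 y b)
  have hum : Measurable u := hsm.const_mul _
  have hcm : ∀ b, Measurable fun y => c y b := fun b =>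
    ((Measurable.ite (hπ (measurableSet_singleton b)) hsm measurable_const).sub (hp b)).const_mul _
  have huM : ∀ y, |u y| ≤ κ := fun y => by
    rw [abs_of_nonneg (mul_nonneg (by linarith) (hs0 y))]
    exact mul_le_of_le_one_right (by linarith) (hs1 y)
  have hcM : ∀ y b, |c y b| ≤ κ := by
    intro y b
    have h1 : |(if π y = b then ∑ b, p y b else 0) - p y b| ≤ 1 := by
      have := hp0 y b
      have := hp1 y b
      have := hs0 y
      have := hs1 y
      rw [abs_le]
      split_ifs <;> constructor <;> linarith
    simp only [c]
    rw [abs_mul, abs_of_nonneg hl0]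
    exact (mul_le_one₀ hl1 (abs_nonneg _) h1).trans hκ
  calc _ = ∫⁻ z, 1 * ENNReal.ofReal (u z.1 + ∑ b, c z.1 b * z.2 b) ∂D := by
        refine lintegral_congr_ae ?_
        filter_upwards [hD] with z hz
        rw [one_mul, hsum, ENNReal.ofReal_sum_of_nonneg fun b _ =>
          mul_nonneg (hpos _ _ hz b) (hp0 _ b)]
        exact Finset.sum_congr rfl fun b _ => (ENNReal.ofReal_mul (hpos _ _ hz b)).symm
    _ = ∫⁻ z, 1 * ENNReal.ofReal (u z.1 + ∑ b, c z.1 b * fstar z.1 b) ∂D :=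
        lintegral_affine_reward hD hreal hum hcm huM hcM hnn (B := fun _ => 1) measurable_const
    _ = ∫⁻ y, ENNReal.ofReal (u y + ∑ b, c y b * fstar y b) ∂D.fst := by
        simp only [one_mul]
        rw [Measure.fst, lintegral_map _ measurable_fst]
        exact (hum.add (Finset.measurable_sum _ fun b _ =>
          (hcm b).mul (hreal.measurable hbase b))).ennreal_ofReal
    _ ≤ ∫⁻ y, (ENNReal.ofReal κ + ENNReal.ofReal l *
          ENNReal.ofReal (contextRegret G T C fstar π h t y)) ∂D.fst := by
        refine lintegral_mono fun y => ?_
        have hcr : 0 ≤ contextRegret G T C fstar π h t y := contextRegret_nonneg (hgr y)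
        rw [← ENNReal.ofReal_mul hl0, ← ENNReal.ofReal_add (by linarith) (mul_nonneg hl0 hcr)]
        refine ENNReal.ofReal_le_ofReal ?_
        rw [hsum]
        calc _ = κ * ∑ b, p y b + l * contextRegret G T C fstar π h t y := by
              simp only [contextRegret, Finset.mul_sum, ← Finset.sum_add_distrib]
              exact Finset.sum_congr rfl fun b _ => by simp only [p]; ring
          _ ≤ _ := by
              gcongr
              exact mul_le_of_le_one_right (by linarith) (hs1 y)
    _ = _ := by
        have hm : Measurable fun y => contextRegret G T C fstar π h t y := by
          have h1 : Measurable fun y : X => (h, y) := measurable_prodMk_left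
          have h2 := (measurable_contextRegret hbase hreal hel hC htT hπ).comp h1
          exact h2
        rw [lintegral_add_left measurable_const, lintegral_const_mul _ hm.ennreal_ofReal]
        simp [meanRegret]

variable [IsProbabilityMeasure P]

/-- An ordinary supermartingale: nothing depends on future contexts here, so a mean bound given the
past alone is enough, without conditioning on the context. -/
lemma IsRun.lintegral_weightProd_le_one (hrun : IsRun D G T C P x r a)
    (hel : MeasurableElimination K G) (hC : 0 < C)
    {η : ℕ → (ℕ → Round X K) → X × (Fin K → ℝ) → Fin K → ℝ≥0∞}
    (hηm : ∀ t b, Measurable fun q : (ℕ → Round X K) × (X × (Fin K → ℝ)) => η t q.1 q.2 b)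
    (hη : ∀ t ∈ Finset.Icc 1 T, ∀ h,
      ∫⁻ z, ∑ b, η t h z b * ENNReal.ofReal (playProb G T C h t z.1 b) ∂D ≤ 1)
    {k : ℕ} (hk : k ≤ T) :
    ∫⁻ ω, weightProd z₀ η 0 k (past z₀ x r a (k + 1) ω) ∂P ≤ 1 := by
  induction k with
  | zero => simp [weightProd]
  | succ k ih =>
    have ht : k + 1 ∈ Finset.Icc 1 T := Finset.mem_Icc.2 ⟨by omega, hk⟩
    have hsplit : ∀ ω, weightProd z₀ η 0 (k + 1) (past z₀ x r a (k + 1 + 1) ω)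
        = weightProd z₀ η 0 k (past z₀ x r a (k + 1) ω) *
          η (k + 1) (past z₀ x r a (k + 1) ω) (x (k + 1) ω, r (k + 1) ω) (a (k + 1) ω) := by
      intro ω
      unfold weightProd
      rw [Finset.prod_Ico_succ_top (Nat.zero_le k), truncate_past (by omega),
        past_apply_of_mem (by simp)]
      congr 1
      refine Finset.prod_congr rfl fun s hs => ?_
      have hs' := Finset.mem_Ico.1 hs
      rw [truncate_past (by omega), truncate_past (by omega), past_apply_of_mem (by simp; omega),
        past_apply_of_mem (by simp; omega)]
    have hmW := measurable_weightProd (z₀ := z₀) hηm 0 k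
    simp only [hsplit]
    have := hrun.lintegral_round (z₀ := z₀) hel hC ht
      (B := fun h z b => weightProd z₀ η 0 k h * η (k + 1) h z b)
      fun b => (hmW.comp measurable_fst).mul (hηm (k + 1) b)
    rw [this]
    calc _ ≤ ∫⁻ ω, weightProd z₀ η 0 k (past z₀ x r a (k + 1) ω) * 1 ∂P := by
          refine lintegral_mono fun ω => ?_
          simp only [mul_assoc, ← Finset.mul_sum]
          rw [lintegral_const_mul]
          · gcongr
            exact hη (k + 1) ht _
          · refine Finset.measurable_sum _ fun b _ => Measurable.mul ?_ ?_
            · have h1 := (hηm (k + 1) b).comp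
                (measurable_prodMk_left (x := past z₀ x r a (k + 1) ω))
              exact h1
            · exact ((measurable_playProb_right hel hC hk _ b).comp measurable_fst).ennreal_ofReal
      _ ≤ 1 := by simpa using ih (by omega)

/-- The weight is the exponential of `l` times (realized minus mean regret), less `l²`. As gaps are
at most one, its mean is at most `exp (-(l ρ + l²)) (1 + l ρ + l²) ≤ 1`; Markov's inequality and
division by `l` finish. -/
lemma IsRun.regret_concentration (hrun : IsRun D G T C P x r a) (hD : BoundedRewards D)
    (hbase : IsBaseClass G) (hreal : Realizes D G fstar) (hel : MeasurableElimination K G)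
    (hC : 0 < C) (hπ : Measurable π) (hgr : ∀ y, π y ∈ argmaxSet fstar y) {l η : ℝ}
    (hl0 : 0 < l) (hl1 : l ≤ 1) (hη : 0 < η) :
    P {ω | ∑ t ∈ Finset.Icc 1 T, (meanRegret D G T C fstar π (past z₀ x r a t ω) t).toReal
        + l * T + Real.log (1 / η) / l < regret T π x r a ω} ≤ ENNReal.ofReal η := by
  classical
  set ρ : ℕ → (ℕ → Round X K) → ℝ := fun t h => (meanRegret D G T C fstar π h t).toReal
  let w : ℕ → (ℕ → Round X K) → X × (Fin K → ℝ) → Fin K → ℝ≥0∞ := fun t h z b =>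
    if t ≤ T then ENNReal.ofReal (Real.exp (l * (z.2 (π z.1) - z.2 b) - l * ρ t h - l ^ 2)) else 1
  have hwm : ∀ t b, Measurable fun q : (ℕ → Round X K) × (X × (Fin K → ℝ)) => w t q.1 q.2 b := by
    intro t b
    by_cases ht : t ≤ T
    · simp only [w, ht, if_true]
      have h1 : Measurable fun q : (ℕ → Round X K) × (X × (Fin K → ℝ)) => q.2.2 (π q.2.1) := by
        exact (measurable_apply_policy_reward hπ).comp measurable_snd
      have h2 : Measurable fun q : (ℕ → Round X K) × (X × (Fin K → ℝ)) => q.2.2 b :=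
        (measurable_pi_apply b).comp measurable_snd.snd
      have h3 : Measurable fun q : (ℕ → Round X K) × (X × (Fin K → ℝ)) => ρ t q.1 :=
        ((measurable_meanRegret hbase hreal hel hC ht hπ).ennreal_toReal).comp measurable_fst
      exact ((((h1.sub h2).const_mul l).sub (h3.const_mul l)).sub_const _).exp.ennreal_ofReal
    · simp only [w, ht, if_false]
      exact measurable_const
  have hw : ∀ t ∈ Finset.Icc 1 T, ∀ h,
      ∫⁻ z, ∑ b, w t h z b * ENNReal.ofReal (playProb G T C h t z.1 b) ∂D ≤ 1 := by
    intro t ht h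
    have htT := (Finset.mem_Icc.1 ht).2
    have hρ : ENNReal.ofReal (ρ t h) = meanRegret D G T C fstar π h t :=
      ENNReal.ofReal_toReal (ne_top_of_le_ne_top ENNReal.one_ne_top
        (meanRegret_le_one hbase hreal))
    have hρ0 : 0 ≤ ρ t h := ENNReal.toReal_nonneg
    calc _ ≤ ∫⁻ z, ENNReal.ofReal (Real.exp (-(l * ρ t h + l ^ 2))) *
          ∑ b, ENNReal.ofReal (1 + l ^ 2 + l * (z.2 (π z.1) - z.2 b)) *
            ENNReal.ofReal (playProb G T C h t z.1 b) ∂D := by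
          refine lintegral_mono_ae ?_
          filter_upwards [hD] with z hz
          rw [Finset.mul_sum]
          refine Finset.sum_le_sum fun b _ => ?_
          rw [← mul_assoc, ← ENNReal.ofReal_mul (Real.exp_pos _).le]
          refine mul_le_mul_left (α := ℝ≥0∞) ?_ _
          simp only [w, htT, if_true]
          refine ENNReal.ofReal_le_ofReal ?_
          have h1 : |z.2 (π z.1) - z.2 b| ≤ 1 := by
            rw [abs_le]
            constructor <;> linarith [(hz (π z.1)).1, (hz (π z.1)).2, (hz b).1, (hz b).2]
          have h2 : |l * (z.2 (π z.1) - z.2 b)| ≤ 1 := by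
            rw [abs_mul, abs_of_pos hl0]
            exact mul_le_one₀ hl1 (abs_nonneg _) h1
          have h3 := exp_le_one_add_add_sq h2
          have h4 : (l * (z.2 (π z.1) - z.2 b)) ^ 2 ≤ l ^ 2 := by
            rw [mul_pow]
            exact mul_le_of_le_one_right (sq_nonneg _) ((sq_le_one_iff_abs_le_one _).2 h1)
          calc Real.exp (l * (z.2 (π z.1) - z.2 b) - l * ρ t h - l ^ 2)
              = Real.exp (-(l * ρ t h + l ^ 2)) * Real.exp (l * (z.2 (π z.1) - z.2 b)) := by
                rw [← Real.exp_add]; congr 1; ring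
            _ ≤ _ := by
                gcongr
                linarith
      _ ≤ ENNReal.ofReal (Real.exp (-(l * ρ t h + l ^ 2))) *
          (ENNReal.ofReal (1 + l ^ 2) + ENNReal.ofReal l * meanRegret D G T C fstar π h t) := by
          rw [lintegral_const_mul' _ _ ENNReal.ofReal_ne_top]
          gcongr
          exact lintegral_sum_affine_gap_le hD hbase hreal hel hC htT hπ hgr hl0.le hl1
            (by nlinarith) h
      _ = ENNReal.ofReal (Real.exp (-(l * ρ t h + l ^ 2)) * (1 + l ^ 2 + l * ρ t h)) := by
          rw [← hρ, ← ENNReal.ofReal_mul hl0.le, ← ENNReal.ofReal_add (by positivity)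
            (by positivity), ENNReal.ofReal_mul (Real.exp_pos _).le]
      _ ≤ 1 := by
          refine ENNReal.ofReal_le_one.2 ?_
          rw [Real.exp_neg, inv_mul_le_one₀ (Real.exp_pos _)]
          linarith [Real.add_one_le_exp (l * ρ t h + l ^ 2)]
  have hprod : ∀ ω, weightProd z₀ w 0 T (past z₀ x r a (T + 1) ω)
      = ENNReal.ofReal (Real.exp (l * regret T π x r a ω
        - l * ∑ t ∈ Finset.Icc 1 T, ρ t (past z₀ x r a t ω) - l ^ 2 * T)) := by
    intro ω
    have h1 : ∀ s ∈ Finset.Ico 0 T, w (s + 1) (truncate z₀ (s + 1) (past z₀ x r a (T + 1) ω))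
        ((past z₀ x r a (T + 1) ω (s + 1)).1, (past z₀ x r a (T + 1) ω (s + 1)).2.2)
        (past z₀ x r a (T + 1) ω (s + 1)).2.1
        = ENNReal.ofReal (Real.exp (l * (r (s + 1) ω (π (x (s + 1) ω)) - r (s + 1) ω (a (s + 1) ω))
          - l * ρ (s + 1) (past z₀ x r a (s + 1) ω) - l ^ 2)) := by
      intro s hs
      have hs' := Finset.mem_Ico.1 hs
      rw [truncate_past (by omega), past_apply_of_mem (by simp; omega)]
      exact if_pos (by omega)
    rw [weightProd, Finset.prod_congr rfl h1,
      ← ENNReal.ofReal_prod_of_nonneg fun _ _ => (Real.exp_pos _).le, ← Real.exp_sum,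
      Finset.sum_Ico_add' (fun t => l * (r t ω (π (x t ω)) - r t ω (a t ω))
        - l * ρ t (past z₀ x r a t ω) - l ^ 2) 0 T 1]
    have h2 : Finset.Ico (0 + 1) (T + 1) = Finset.Icc 1 T := by ext; simp
    rw [h2]
    simp only [regret, Finset.sum_sub_distrib, ← Finset.mul_sum, Finset.sum_const, Nat.card_Icc,
      nsmul_eq_mul, Nat.add_sub_cancel]
    congr 3
    ring
  have hint := hrun.lintegral_weightProd_le_one (z₀ := z₀) hel hC hwm hw le_rfl
  have hmk := measure_gt_div_le (P := P) (N := 1)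
    ((measurable_weightProd (z₀ := z₀) hwm 0 T).comp (hrun.measurable_past (T + 1))).aemeasurable
    one_pos hη (by simpa using hint)
  refine (measure_mono fun ω hω => ?_).trans hmk
  simp only [Set.mem_ofPred_eq, Function.comp] at hω ⊢
  rw [hprod]
  refine ENNReal.ofReal_le_ofReal ?_
  rw [← Real.exp_log (show 0 < 1 / η by positivity)]
  refine Real.exp_le_exp.2 ?_
  have h1 := mul_le_mul_of_nonneg_left hω.le hl0.le
  have h2 : l * (Real.log (1 / η) / l) = Real.log (1 / η) := by field_simp
  rw [mul_add, h2] at h1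
  nlinarith

lemma IsRun.integral_regret_le (hrun : IsRun D G T C P x r a) (hD : BoundedRewards D)
    (hbase : IsBaseClass G) (hreal : Realizes D G fstar) (hel : MeasurableElimination K G)
    (hC : 0 < C) (hπ : Measurable π) (hgr : ∀ y, π y ∈ argmaxSet fstar y) {R : ℕ → ℝ}
    (hR0 : ∀ t, 0 ≤ R t)
    (hR : ∀ t ∈ Finset.Icc 1 T, ∫⁻ ω, meanRegret D G T C fstar π (past z₀ x r a t ω) t ∂P
      ≤ ENNReal.ofReal (R t)) :
    ∫ ω, regret T π x r a ω ∂P ≤ ∑ t ∈ Finset.Icc 1 T, R t := by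
  have hbd := hrun.ae_bounded hD
  have hm : ∀ t, Measurable fun ω => r t ω (π (x t ω)) - r t ω (a t ω) := fun t =>
    (hrun.measurable_reward_policy hπ t).sub (hrun.measurable_reward_action t)
  have habs : ∀ t ∈ Finset.Icc 1 T, ∀ᵐ ω ∂P, |r t ω (π (x t ω)) - r t ω (a t ω)| ≤ 1 := by
    intro t ht
    filter_upwards [hbd] with ω hω
    have h1 := hω t ht (π (x t ω))
    have h2 := hω t ht (a t ω)
    rw [abs_le]
    constructor <;> linarith [h1.1, h1.2, h2.1, h2.2]
  have hint : ∀ t ∈ Finset.Icc 1 T, Integrable (fun ω => r t ω (π (x t ω)) - r t ω (a t ω)) P :=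
    fun t ht => Integrable.of_bound (hm t).aestronglyMeasurable 1 (habs t ht)
  have hstep : ∀ t ∈ Finset.Icc 1 T, ∫ ω, (r t ω (π (x t ω)) - r t ω (a t ω)) ∂P ≤ R t := by
    intro t ht
    have htT := (Finset.mem_Icc.1 ht).2
    -- Adding one makes the gap nonnegative, so that the disintegration for lower integrals applies;
    -- the one is subtracted at the end.
    have h1 := hrun.lintegral_round (z₀ := z₀) hel hC ht
      (B := fun _ z b => ENNReal.ofReal (1 + 1 * (z.2 (π z.1) - z.2 b))) (fun b => by
        have h1 : Measurable fun q : (ℕ → Round X K) × (X × (Fin K → ℝ)) => q.2.2 (π q.2.1) := by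
          exact (measurable_apply_policy_reward hπ).comp measurable_snd
        have h2 : Measurable fun q : (ℕ → Round X K) × (X × (Fin K → ℝ)) => q.2.2 b :=
          (measurable_pi_apply b).comp measurable_snd.snd
        exact (((h1.sub h2).const_mul 1).const_add 1).ennreal_ofReal)
    have h2 : ∫⁻ ω, ENNReal.ofReal (1 + 1 * (r t ω (π (x t ω)) - r t ω (a t ω))) ∂P
        ≤ ENNReal.ofReal (1 + R t) := by
      calc _ = _ := h1
        _ ≤ ∫⁻ ω, (ENNReal.ofReal 1 + ENNReal.ofReal 1 *
              meanRegret D G T C fstar π (past z₀ x r a t ω) t) ∂P := lintegral_mono fun ω =>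
            lintegral_sum_affine_gap_le hD hbase hreal hel hC htT hπ hgr zero_le_one le_rfl
              le_rfl _
        _ ≤ _ := by
            rw [lintegral_add_left measurable_const, ENNReal.ofReal_add zero_le_one (hR0 t)]
            simp only [ENNReal.ofReal_one, one_mul, lintegral_const, measure_univ, mul_one]
            gcongr
            exact hR t ht
    have h3 : ∫ ω, (1 + 1 * (r t ω (π (x t ω)) - r t ω (a t ω))) ∂P ≤ 1 + R t := by
      rw [integral_eq_lintegral_of_nonneg_ae]
      · exact ENNReal.toReal_le_of_le_ofReal (by linarith [hR0 t]) h2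
      · filter_upwards [habs t ht] with ω hω
        have := (abs_le.1 hω).1
        simp only [Pi.zero_apply]
        linarith
      · exact (((hm t).const_mul 1).const_add 1).aestronglyMeasurable
    simp only [one_mul] at h3
    rw [integral_add (integrable_const _) (hint t ht)] at h3
    simp only [integral_const, probReal_univ, smul_eq_mul, mul_one] at h3
    linarith
  have h4 : ∫ ω, regret T π x r a ω ∂P
      = ∑ t ∈ Finset.Icc 1 T, ∫ ω, (r t ω (π (x t ω)) - r t ω (a t ω)) ∂P := by
    rw [← integral_finsetSum _ hint]
    simp only [regret, Finset.sum_sub_distrib]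
  rw [h4]
  exact Finset.sum_le_sum hstep

end Regret

end RegCB

namespace RegCB

/-! ### The confidence radius -/

section Radius

lemma epochOf_le_self {T : ℕ} (hT : 2 ≤ T) : epochOf T ≤ T :=
  Nat.log_lt_self 2 (by omega)

lemma half_le_log {T : ℕ} (hT : 2 ≤ T) : (1 / 2 : ℝ) ≤ Real.log T := by
  have h1 : Real.log 2 ≤ Real.log T :=
    Real.log_le_log two_pos (by exact_mod_cast hT)
  linarith [Real.log_two_gt_d9]

lemma epochOf_le_log {T : ℕ} (hT : 2 ≤ T) : (epochOf T : ℝ) ≤ 3 * Real.log T := by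
  have h1 : (Nat.log 2 T : ℝ) * Real.log 2 ≤ Real.log T := by
    rw [← Real.log_pow]
    refine Real.log_le_log (by positivity) ?_
    exact_mod_cast Nat.pow_log_le_self 2 (by omega)
  have h2 : Real.log 2 ≤ Real.log T :=
    Real.log_le_log two_pos (by exact_mod_cast hT)
  have h3 := Real.log_two_gt_d9
  have h4 : (epochOf T : ℝ) = Nat.log 2 T + 1 := by simp [epochOf]
  rw [h4]
  have h5 : (0 : ℝ) ≤ Nat.log 2 T := Nat.cast_nonneg _
  nlinarith

lemma one_le_log_of_three_le {A : ℝ} (hA : 3 ≤ A) : 1 ≤ Real.log A := by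
  rw [Real.le_log_iff_exp_le (by linarith)]
  linarith [Real.exp_one_lt_d9]

variable {X : Type*} [MeasurableSpace X] {K : ℕ} {D : Measure (X × (Fin K → ℝ))}
  {G : Set (X → ℝ)} {T : ℕ} {δ : ℝ}

lemma le_radiusFinite (hG : G.Finite) {C : ℝ}
    (hC : C = radius D G T δ ∨ (G.Finite ∧ C = radiusFinite K G T δ)) :
    C ≤ radiusFinite K G T δ := by
  rcases hC with rfl | ⟨-, rfl⟩
  · rw [radius, if_pos hG]
    exact min_le_left _ _
  · exact le_rfl

variable [IsProbabilityMeasure D]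

lemma lintegral_coverNum_eq (hbase : IsBaseClass G) {ε : ℝ} (hε : 0 < ε) :
    ∫⁻ xs, coverNum G ε xs ∂Measure.pi (fun _ : Fin T => D.fst)
      = ENNReal.ofReal (expCoverNum D G T ε) :=
  (ENNReal.ofReal_toReal (lintegral_coverNum_ne_top (fun g hg => (hbase g hg).2) hε _)).symm

lemma one_le_expCoverNum (hne : G.Nonempty) (hbase : IsBaseClass G) {ε : ℝ} (hε : 0 < ε) :
    1 ≤ expCoverNum D G T ε := by
  have h1 : (1 : ℝ≥0∞) ≤ ENNReal.ofReal (expCoverNum D G T ε) := by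
    rw [← lintegral_coverNum_eq hbase hε]
    calc (1 : ℝ≥0∞) = ∫⁻ _xs, 1 ∂Measure.pi (fun _ : Fin T => D.fst) := by simp
      _ ≤ _ := lintegral_mono fun xs => one_le_coverNum hne ε xs
  exact ENNReal.one_le_ofReal.1 h1

/-- What the analysis needs of the confidence radius. -/
structure GoodRadius (D : Measure (X × (Fin K → ℝ))) (G : Set (X → ℝ)) (T : ℕ) (δ C : ℝ) :
    Prop where
  adequate : ∃ ε N, Adequate D G T δ C ε N
  one_le : 1 ≤ C
  log_le : Real.log (2 / δ) ≤ C

lemma goodRadius_radiusFinite (hG : G.Finite) (hne : G.Nonempty) (hT : 2 ≤ T) (hK : 1 ≤ K)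
    (hδ : 0 < δ) (hδ1 : δ < 1) : GoodRadius D G T δ (radiusFinite K G T δ) := by
  have hTR : (2 : ℝ) ≤ T := by exact_mod_cast hT
  have hKR : (1 : ℝ) ≤ K := by exact_mod_cast hK
  have hNn : 1 ≤ G.ncard := (Set.ncard_pos hG).2 hne
  have hN : (1 : ℝ) ≤ G.ncard := by exact_mod_cast hNn
  set N : ℝ := (G.ncard : ℝ)
  have hNK : 1 ≤ N * K := one_le_mul_of_one_le_of_one_le hN hKR
  have hT2 : (4 : ℝ) ≤ (T : ℝ) ^ 2 := by nlinarith
  have hA : 2 / δ ≤ 2 * N * K * (T : ℝ) ^ 2 / δ := by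
    gcongr
    nlinarith
  have hA8 : 8 ≤ 2 * N * K * (T : ℝ) ^ 2 / δ := by
    rw [le_div_iff₀ hδ]
    nlinarith
  have hL1 := one_le_log_of_three_le (show (3 : ℝ) ≤ _ by linarith)
  have hM : (epochOf T : ℝ) ≤ T := by exact_mod_cast epochOf_le_self hT
  have hM1 : (1 : ℝ) ≤ epochOf T := by exact_mod_cast (by simp [epochOf] : 1 ≤ epochOf T)
  -- A finite class covers itself at every scale, so the scale can be so small that the
  -- discretization term `6 ε T` is only `3`.
  refine ⟨⟨1 / (2 * T), N, by positivity, hN, ?_, ?_⟩, ?_, ?_⟩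
  · calc _ ≤ ∫⁻ _xs, (G.ncard : ℝ≥0∞) ∂Measure.pi (fun _ : Fin T => D.fst) :=
          lintegral_mono fun xs => coverNum_le_ncard hG (by positivity) xs
      _ = _ := by simp [N]
  · have h1 : 4 * (N / (δ / (8 * epochOf T * K))) ≤ (2 * N * K * (T : ℝ) ^ 2 / δ) ^ 2 := by
      have e1 : 4 * (N / (δ / (8 * epochOf T * K))) = N * K / δ * (32 * epochOf T) := by
        field_simp; ring
      have e2 : (2 * N * K * (T : ℝ) ^ 2 / δ) ^ 2 = (N * K / δ) * ((N * K / δ) * (4 * T ^ 4)) := by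
        field_simp; ring
      rw [e1, e2]
      have h2 : 1 ≤ N * K / δ := by rw [le_div_iff₀ hδ]; linarith
      have h3 : 32 * (epochOf T : ℝ) ≤ 4 * (T : ℝ) ^ 4 := by
        have : (8 : ℝ) * T ≤ T ^ 4 := by
          have : (2 : ℝ) ^ 3 ≤ (T : ℝ) ^ 3 := by gcongr
          nlinarith
        linarith
      have h4 : 4 * (T : ℝ) ^ 4 ≤ (N * K / δ) * (4 * T ^ 4) :=
        le_mul_of_one_le_left (by positivity) h2
      exact mul_le_mul_of_nonneg_left (h3.trans h4) (by positivity)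
    have h2 := Real.log_le_log (by positivity) h1
    rw [Real.log_mul (by norm_num) (by positivity), Real.log_pow] at h2
    have h3 := one_le_log_of_three_le (show (3 : ℝ) ≤ 4 by norm_num)
    have h4 : 6 * (1 / (2 * (T : ℝ))) * T = 3 := by field_simp; norm_num
    rw [h4]
    unfold radiusFinite
    push_cast at h2
    linarith
  · unfold radiusFinite
    linarith
  · have h1 := Real.log_le_log (by positivity) hA
    unfold radiusFinite
    linarith

lemma goodRadius_radiusCover (hne : G.Nonempty) (hbase : IsBaseClass G) (hT : 2 ≤ T)
    (hK : 1 ≤ K) (hδ : 0 < δ) (hδ1 : δ < 1) : GoodRadius D G T δ (radiusCover D G T δ) := by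
  have hTR : (2 : ℝ) ≤ T := by exact_mod_cast hT
  have hKR : (1 : ℝ) ≤ K := by exact_mod_cast hK
  have hlog := half_le_log hT
  have hT2 : (4 : ℝ) ≤ (T : ℝ) ^ 2 := by nlinarith
  have hA : ∀ ε : ℝ, 0 < ε →
      8 / δ ≤ 8 * expCoverNum D G T ε * K * (T : ℝ) ^ 2 * Real.log T / δ := by
    intro ε hε
    have h1 : 1 ≤ expCoverNum D G T ε := one_le_expCoverNum hne hbase hε
    have h2 : 1 ≤ expCoverNum D G T ε * K := one_le_mul_of_one_le_of_one_le h1 hKR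
    have h3 : 1 ≤ (T : ℝ) ^ 2 * Real.log T := by nlinarith
    have h4 := one_le_mul_of_one_le_of_one_le h2 h3
    gcongr
    linarith
  have h8 : 8 ≤ 8 / δ := by rw [le_div_iff₀ hδ]; linarith
  have hterm : ∀ ε : Set.Ioi (0 : ℝ), 320 * Real.log (8 / δ) ≤ 100 * (ε : ℝ) * T +
      320 * Real.log (8 * expCoverNum D G T ε * K * (T : ℝ) ^ 2 * Real.log T / δ) := by
    intro ε
    have h1 := Real.log_le_log (by positivity) (hA ε ε.2)
    have h2 : 0 < (ε : ℝ) := ε.2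
    have h3 : 0 ≤ 100 * (ε : ℝ) * T := by positivity
    linarith
  have : Nonempty (Set.Ioi (0 : ℝ)) := ⟨⟨1, Set.mem_Ioi.2 one_pos⟩⟩
  have hC : 320 * Real.log (8 / δ) ≤ radiusCover D G T δ := le_ciInf hterm
  have h1 := one_le_log_of_three_le (show (3 : ℝ) ≤ 8 / δ by linarith)
  refine ⟨?_, by linarith, ?_⟩
  · obtain ⟨ε, hε⟩ := exists_lt_of_ciInf_lt
      (show radiusCover D G T δ < 2 * radiusCover D G T δ by linarith)
    have hε0 : 0 < (ε : ℝ) := ε.2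
    have hN : 1 ≤ expCoverNum D G T ε := one_le_expCoverNum hne hbase hε0
    refine ⟨ε, expCoverNum D G T ε, hε0, hN, (lintegral_coverNum_eq hbase hε0).le, ?_⟩
    have hM1 : (1 : ℝ) ≤ epochOf T := by exact_mod_cast (by simp [epochOf] : 1 ≤ epochOf T)
    have h2 : expCoverNum D G T ε / (δ / (8 * epochOf T * K))
        ≤ 8 * expCoverNum D G T ε * K * (T : ℝ) ^ 2 * Real.log T / δ := by
      have e1 : expCoverNum D G T ε / (δ / (8 * epochOf T * K))
          = 8 * expCoverNum D G T ε * K * epochOf T / δ := by field_simp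
      rw [e1, mul_assoc (8 * expCoverNum D G T ε * K)]
      have := epochOf_le_log hT
      gcongr
      nlinarith
    have h3 := Real.log_le_log (by positivity) h2
    have h4 := Real.log_le_log (by positivity) (hA ε hε0)
    have h5 : 0 ≤ (ε : ℝ) * T := by positivity
    linarith
  · have h2 : Real.log (2 / δ) ≤ Real.log (8 / δ) :=
      Real.log_le_log (by positivity) (by gcongr; norm_num)
    linarith

lemma goodRadius (hne : G.Nonempty) (hbase : IsBaseClass G) (hT : 2 ≤ T) (hK : 1 ≤ K)
    (hδ : 0 < δ) (hδ1 : δ < 1) {C : ℝ}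
    (hC : C = radius D G T δ ∨ (G.Finite ∧ C = radiusFinite K G T δ)) :
    GoodRadius D G T δ C := by
  rcases hC with rfl | ⟨hG, rfl⟩
  · unfold radius
    split_ifs with hG
    · rcases min_choice (radiusFinite K G T δ) (radiusCover D G T δ) with h | h <;> rw [h]
      · exact goodRadius_radiusFinite hG hne hT hK hδ hδ1
      · exact goodRadius_radiusCover hne hbase hT hK hδ hδ1
    · exact goodRadius_radiusCover hne hbase hT hK hδ hδ1
  · exact goodRadius_radiusFinite hG hne hT hK hδ hδ1

end Radius

end RegCB

namespace RegCB

/-! ### Regret bounds -/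

lemma lt_two_mul_epochStart_epochOf (t : ℕ) : t < 2 * epochStart (epochOf t) := by
  have := Nat.lt_pow_succ_log_self one_lt_two t
  simp only [epochStart, epochOf, Nat.add_sub_cancel]
  rw [pow_succ] at this
  omega

/-- Induction, after multiplying by `y^{1/4}` with `y = n + 1`: weighted AM-GM bounds `n^{3/4}
y^{1/4}` by `3n/4 + y/4`, and `2 (3n/4 + y/4) + 1 ≤ 2 y`. -/
lemma sum_rpow_neg_quarter_le (T : ℕ) :
    ∑ t ∈ Finset.Icc 1 T, (t : ℝ) ^ (-(1 / 4) : ℝ) ≤ 2 * (T : ℝ) ^ (3 / 4 : ℝ) := by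
  induction T with
  | zero => simp
  | succ n ih =>
    rw [Finset.sum_Icc_succ_top (by omega)]
    have hy : (0 : ℝ) < ((n + 1 : ℕ) : ℝ) := by positivity
    set y : ℝ := ((n + 1 : ℕ) : ℝ) with hydef
    have hn : (n : ℝ) = y - 1 := by rw [hydef]; push_cast; ring
    have hn0 : (0 : ℝ) ≤ n := Nat.cast_nonneg n
    have h1 := Real.geom_mean_le_arith_mean2_weighted (w₁ := 3 / 4) (w₂ := 1 / 4) (by norm_num)
      (by norm_num) hn0 hy.le (by norm_num)
    have h2 : y ^ (3 / 4 : ℝ) * y ^ (1 / 4 : ℝ) = y := by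
      rw [← Real.rpow_add hy]; norm_num
    have h3 : y ^ (-(1 / 4) : ℝ) * y ^ (1 / 4 : ℝ) = 1 := by
      rw [← Real.rpow_add hy]; norm_num
    have h4 : 0 < y ^ (1 / 4 : ℝ) := Real.rpow_pos_of_pos hy _
    refine le_of_mul_le_mul_right ?_ h4
    rw [add_mul, h3, mul_assoc, h2]
    have h5 := mul_le_mul_of_nonneg_right ih h4.le
    linarith

lemma sum_one_div_le {T : ℕ} (hT : 2 ≤ T) :
    ∑ t ∈ Finset.Icc 1 T, 1 / (t : ℝ) ≤ 3 * Real.log T := by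
  have h1 := harmonic_le_one_add_log T
  have h2 := half_le_log hT
  rw [harmonic_eq_sum_Icc] at h1
  push_cast at h1
  simp only [one_div]
  linarith

lemma exists_round {X Ω : Type*} {K : ℕ} [MeasurableSpace Ω] (a : ℕ → Ω → Fin K)
    (x : ℕ → Ω → X) (P : Measure Ω) [IsProbabilityMeasure P] :
    ∃ z₀ : Round X K, ∀ b, z₀.2.2 b ∈ Set.Icc (0 : ℝ) 1 := by
  obtain ⟨ω⟩ : Nonempty Ω := P.nonempty_of_neZero
  exact ⟨(x 0 ω, a 0 ω, fun _ => 0), fun _ => ⟨le_rfl, zero_le_one⟩⟩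

section Bounds

variable {X Ω : Type*} {K : ℕ} {G : Set (X → ℝ)} {T : ℕ} {C : ℝ} {fstar : X → Fin K → ℝ}
  {pol : (X → Fin K → ℝ) → X → Fin K} {z₀ : Round X K} {x : ℕ → Ω → X}
  {r : ℕ → Ω → Fin K → ℝ} {a : ℕ → Ω → Fin K}
  [MeasurableSpace X] {D : Measure (X × (Fin K → ℝ))}

/-- Epoch lengths double, so `t` is below four times the start of the previous epoch; with `M ≤ 3
log T` the constant is `34 · 3 · 4 = 408`. -/
lemma mean_sq_bound_le {t : ℕ} (hT : 2 ≤ T) (hC : 0 < C) (ht : t ∈ Finset.Icc 1 T)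
    (hm : 2 ≤ epochOf t) :
    34 * (K : ℝ) ^ 2 * epochOf T * C / epochStart (epochOf t - 1)
      ≤ 408 * K ^ 2 * Real.log T * C / t := by
  have ht' := Finset.mem_Icc.1 ht
  have h1 := lt_two_mul_epochStart_epochOf t
  rw [two_mul_epochStart_pred hm] at h1
  have hτ : (0 : ℝ) < epochStart (epochOf t - 1) := by exact_mod_cast one_le_epochStart _
  have htR : (0 : ℝ) < t := by exact_mod_cast ht'.1
  have h2 : (t : ℝ) ≤ 4 * epochStart (epochOf t - 1) := by
    have : t ≤ 4 * epochStart (epochOf t - 1) := by omega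
    exact_mod_cast this
  have hM := epochOf_le_log hT
  rw [div_le_div_iff₀ hτ htR]
  calc 34 * (K : ℝ) ^ 2 * epochOf T * C * t
      ≤ 34 * (K : ℝ) ^ 2 * (3 * Real.log T) * C * (4 * epochStart (epochOf t - 1)) := by
        have := half_le_log hT
        gcongr
    _ = _ := by ring

lemma GoodEvent.subset_regretBall_of_round [IsProbabilityMeasure D] {ω : Ω}
    (hω : GoodEvent z₀ x r a D G T C fstar ω)
    (hT : 2 ≤ T) (hC : 1 ≤ C) (hK : 1 ≤ K) (hD : BoundedRewards D) (hbase : IsBaseClass G)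
    (hreal : Realizes D G fstar) (hel : MeasurableElimination K G) (hpol : IsGreedyRule G pol)
    {t : ℕ} (ht : t ∈ Finset.Icc 1 T) :
    productClass (runVersionSpace z₀ x r a G T C ω (epochOf t))
      ⊆ regretBall D G fstar pol (29 * K * Real.log T * √(C / t)) := by
  have ht' := Finset.mem_Icc.1 ht
  have hlog := half_le_log hT
  have hKR : (1 : ℝ) ≤ K := by exact_mod_cast hK
  have htR : (1 : ℝ) ≤ t := by exact_mod_cast ht'.1
  -- The first epoch is round `1` alone; no data constrain its version space, but the claimed radius
  -- is at least one and that ball is the whole class.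
  rcases (epoch_cases (C := C) (by linarith) ht'.2).1.eq_or_lt with h | h
  · have ht1 : t = 1 := by
      have := lt_two_mul_epochStart_epochOf t
      rw [← h] at this
      simp [epochStart] at this
      omega
    refine Set.Subset.trans (b := productClass fun _ => G)
      (fun f hf c => runVersionSpace_subset ω _ c (hf c))
      (productClass_subset_regretBall hD hbase hreal hpol ?_)
    have h1 : 1 ≤ √(C / t) := by
      rw [Real.one_le_sqrt, ht1]
      simpa using hC
    have h2 : 1 ≤ 29 * (K : ℝ) * Real.log T := by nlinarith
    exact one_le_mul_of_one_le_of_one_le h2 h1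
  · refine hω.subset_regretBall (by omega) (by linarith) hK hD hbase hreal hel hpol
      (Finset.mem_Icc.2 ⟨h, epochOf_mono ht'.2⟩) (by positivity) ?_
    refine (mean_sq_bound_le hT (by linarith) ht h).trans ?_
    rw [mul_pow, Real.sq_sqrt (by positivity), ← mul_div_assoc]
    gcongr
    -- This uses `log T ≥ 1/2`; then `2 · 408 ≤ 29²` accounts for the constant in the radius.
    have : Real.log T ≤ 2 * Real.log T ^ 2 := by nlinarith
    calc 408 * (K : ℝ) ^ 2 * Real.log T ≤ 408 * (K : ℝ) ^ 2 * (2 * Real.log T ^ 2) := by gcongr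
      _ ≤ (29 * K * Real.log T) ^ 2 := by
        have : 0 ≤ (K : ℝ) ^ 2 * Real.log T ^ 2 := by positivity
        nlinarith

lemma GoodEvent.subset_regretBall_of_round_massart [IsProbabilityMeasure D] {ω : Ω}
    (hω : GoodEvent z₀ x r a D G T C fstar ω)
    (hT : 2 ≤ T) (hC : 1 ≤ C) (hK : 1 ≤ K) (hD : BoundedRewards D) (hbase : IsBaseClass G)
    (hreal : Realizes D G fstar) (hel : MeasurableElimination K G) (hpol : IsGreedyRule G pol)
    {γ : ℝ} (hγ : 0 < γ) (hγ1 : γ ≤ 1) (hmas : Massart D fstar (pol fstar) γ)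
    {t : ℕ} (ht : t ∈ Finset.Icc 1 T) :
    productClass (runVersionSpace z₀ x r a G T C ω (epochOf t))
      ⊆ regretBall D G fstar pol (408 * K ^ 2 * Real.log T * C / t / γ) := by
  have ht' := Finset.mem_Icc.1 ht
  have hlog := half_le_log hT
  have hKR : (1 : ℝ) ≤ K := by exact_mod_cast hK
  rcases (epoch_cases (C := C) (by linarith) ht'.2).1.eq_or_lt with h | h
  · have ht1 : t = 1 := by
      have := lt_two_mul_epochStart_epochOf t
      rw [← h] at this
      simp [epochStart] at this
      omega
    refine Set.Subset.trans (b := productClass fun _ => G)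
      (fun f hf c => runVersionSpace_subset ω _ c (hf c))
      (productClass_subset_regretBall hD hbase hreal hpol ?_)
    rw [ht1, Nat.cast_one, div_one, one_le_div hγ]
    have h2 : 1 ≤ 408 * (K : ℝ) ^ 2 * Real.log T := by nlinarith
    exact hγ1.trans (one_le_mul_of_one_le_of_one_le h2 hC)
  · refine hω.subset_regretBall_of_massart (by omega) (by linarith) hK hD hbase hreal hel hpol
      (Finset.mem_Icc.2 ⟨h, epochOf_mono ht'.2⟩) hγ hmas ?_
    rw [div_mul_cancel₀ _ hγ.ne']
    exact mean_sq_bound_le hT (by linarith) ht h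

variable [MeasurableSpace Ω] {P : Measure Ω} {δ : ℝ}

/-- The standing assumptions on the reward distribution, the class and the run. -/
structure Setup (D : Measure (X × (Fin K → ℝ))) (G : Set (X → ℝ)) (fstar : X → Fin K → ℝ)
    (pol : (X → Fin K → ℝ) → X → Fin K) (T : ℕ) (δ C : ℝ) (P : Measure Ω) (x : ℕ → Ω → X)
    (r : ℕ → Ω → Fin K → ℝ) (a : ℕ → Ω → Fin K) : Prop where
  two_le : 2 ≤ T
  delta_pos : 0 < δ
  delta_lt_one : δ < 1
  bounded : BoundedRewards D
  base : IsBaseClass G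
  separable : PointwiseSeparable G
  extrema : ExtremaAttained K G
  elimination : MeasurableElimination K G
  realizes : Realizes D G fstar
  greedy : IsGreedyRule G pol
  coeff_ne_top : disagreementCoeff D G fstar pol ≠ ⊤
  radius : GoodRadius D G T δ C
  run : IsRun D G T C P x r a
  one_le_card : 1 ≤ K

/-! ### Regret of a run, with high probability and in expectation -/

namespace Setup

lemma C_pos (S : Setup D G fstar pol T δ C P x r a) : 0 < C := by
  linarith [S.radius.one_le]

lemma le_measureReal_regret_le [IsProbabilityMeasure P]
    (S : Setup D G fstar pol T δ C P x r a) {B B' : ℝ}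
    (hB : B ≤ B')
    (h : P {ω | B < regret T (pol fstar) x r a ω} ≤ ENNReal.ofReal δ) :
    1 - δ ≤ P.real {ω | regret T (pol fstar) x r a ω ≤ B'} := by
  have hm : MeasurableSet {ω | regret T (pol fstar) x r a ω ≤ B} :=
    measurableSet_le (S.run.measurable_regret (S.greedy _ S.realizes.1).1) measurable_const
  have h1 : P.real {ω | regret T (pol fstar) x r a ω ≤ B}ᶜ ≤ δ := by
    refine ENNReal.toReal_le_of_le_ofReal S.delta_pos.le (le_trans (measure_mono fun ω hω => ?_) h)
    simpa using hω
  rw [probReal_compl_eq_one_sub hm] at h1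
  have h2 : P.real {ω | regret T (pol fstar) x r a ω ≤ B}
      ≤ P.real {ω | regret T (pol fstar) x r a ω ≤ B'} :=
    measureReal_mono fun ω hω => le_trans hω hB
  linarith

lemma meanRegret_toReal_le [IsProbabilityMeasure D]
    (S : Setup D G fstar pol T δ C P x r a) {z₀ : Round X K}
    (hz₀ : ∀ b, z₀.2.2 b ∈ Set.Icc (0 : ℝ) 1) {ω : Ω}
    (hω : GoodEvent z₀ x r a D G T C fstar ω)
    (hr : ∀ t ∈ Finset.Icc 1 T, ∀ b, r t ω b ∈ Set.Icc (0 : ℝ) 1) {t : ℕ}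
    (ht : t ∈ Finset.Icc 1 T) :
    (meanRegret D G T C fstar (pol fstar) (past z₀ x r a t ω) t).toReal
      ≤ 17 * (C ^ (1 / 4 : ℝ) *
        √((disagreementCoeff D G fstar pol).toReal * K * Real.log T)) *
          (t : ℝ) ^ (-(1 / 4) : ℝ) := by
  have hT := S.two_le
  have hC := S.radius.one_le
  have hlog := half_le_log hT
  have hKR : (1 : ℝ) ≤ K := by exact_mod_cast S.one_le_card
  have htR : (0 : ℝ) < t := by exact_mod_cast (Finset.mem_Icc.1 ht).1
  have hsub := hω.subset_regretBall_of_round hT hC S.one_le_card S.bounded S.base S.realizes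
    S.elimination S.greedy ht
  have hε : 0 < 29 * (K : ℝ) * Real.log T * √(C / t) := by
    have : 0 < √(C / t) := Real.sqrt_pos.2 (by positivity)
    positivity
  have h1 := meanRegret_le_sqrt S.base S.realizes S.greedy S.coeff_ne_top hε fun y b hb => by
    obtain ⟨f, hf, hbf⟩ := exists_argmax_of_mem_activeSet S.base S.extrema S.C_pos ht hz₀ hr hb
    exact ⟨f, hsub hf, hbf⟩
  set θ := (disagreementCoeff D G fstar pol).toReal
  have hθ : 0 ≤ θ := ENNReal.toReal_nonneg
  refine (ENNReal.toReal_le_of_le_ofReal (by positivity) h1).trans ?_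
  have e1 : θ * (29 * K * Real.log T * √(C / t)) = 29 * ((θ * K * Real.log T) * √(C / t)) := by
    ring
  have e2 : √(√(C / t)) = C ^ (1 / 4 : ℝ) * (t : ℝ) ^ (-(1 / 4) : ℝ) := by
    rw [Real.sqrt_eq_rpow, Real.sqrt_eq_rpow, ← Real.rpow_mul (by positivity),
      Real.div_rpow (by linarith) htR.le, Real.rpow_neg htR.le, div_eq_mul_inv]
    norm_num
  -- The constant `17` dominates `3 √29`, from the factor `3` of `meanRegret_le_sqrt` and the `29`
  -- in the radius.
  have e3 : √29 ≤ 17 / 3 := Real.sqrt_le_iff.2 ⟨by norm_num, by norm_num⟩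
  rw [e1, Real.sqrt_mul (by norm_num), Real.sqrt_mul (by positivity), e2]
  have h4 : 0 ≤ C ^ (1 / 4 : ℝ) := by positivity
  have h5 : 0 ≤ (t : ℝ) ^ (-(1 / 4) : ℝ) := by positivity
  calc 3 * (√29 * (√(θ * K * Real.log T) * (C ^ (1 / 4 : ℝ) * (t : ℝ) ^ (-(1 / 4) : ℝ))))
      ≤ 3 * (17 / 3 * (√(θ * K * Real.log T) * (C ^ (1 / 4 : ℝ) * (t : ℝ) ^ (-(1 / 4) : ℝ)))) := by
        gcongr
    _ = _ := by ring

variable [IsProbabilityMeasure D] [IsProbabilityMeasure P]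

lemma measure_not_good_le (S : Setup D G fstar pol T δ C P x r a) (z₀ : Round X K) :
    P {ω | ¬ (GoodEvent z₀ x r a D G T C fstar ω ∧
      ∀ t ∈ Finset.Icc 1 T, ∀ b, r t ω b ∈ Set.Icc (0 : ℝ) 1)} ≤ ENNReal.ofReal (δ / 2) := by
  obtain ⟨ε, N, had⟩ := S.radius.adequate
  have h1 := S.run.measure_not_goodEvent_le (z₀ := z₀) S.two_le S.bounded S.base S.realizes
    S.separable S.elimination S.C_pos S.one_le_card S.delta_pos S.delta_lt_one had
  refine le_trans (measure_mono_ae ?_) h1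
  filter_upwards [S.run.ae_bounded S.bounded] with ω hω hbad hgood
  exact hbad ⟨hgood, hω⟩

/-- With `Λ = log (2/δ)`, the choice `l = √(Λ/T)` makes both deviation terms equal to `√(T Λ)`. It
requires `Λ ≤ T`; otherwise `√(T Λ)` already exceeds the trivial bound `T`. -/
lemma measure_lt_regret_le (S : Setup D G fstar pol T δ C P x r a) :
    P {ω | 34 * ((T : ℝ) ^ (3 / 4 : ℝ) * C ^ (1 / 4 : ℝ) *
        √((disagreementCoeff D G fstar pol).toReal * K * Real.log T))
        + 2 * √(T * Real.log (2 / δ)) < regret T (pol fstar) x r a ω} ≤ ENNReal.ofReal δ := by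
  obtain ⟨z₀, hz₀⟩ := exists_round a x P
  have hTR : (2 : ℝ) ≤ T := by exact_mod_cast S.two_le
  have hC := S.radius.one_le
  have hδ := S.delta_pos
  set Q := (T : ℝ) ^ (3 / 4 : ℝ) * C ^ (1 / 4 : ℝ) *
        √((disagreementCoeff D G fstar pol).toReal * K * Real.log T)
  set Λ := Real.log (2 / δ)
  have hQ0 : 0 ≤ Q := by positivity
  have hΛ0 : 0 < Λ := Real.log_pos (by rw [lt_div_iff₀ hδ]; linarith [S.delta_lt_one])
  by_cases hΛ : Λ ≤ T
  · have hl : √(Λ / T) ≤ 1 := Real.sqrt_le_iff.2 ⟨zero_le_one, by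
      rw [one_pow, div_le_one (by linarith)]
      exact hΛ⟩
    have hl0 : 0 < √(Λ / T) := Real.sqrt_pos.2 (by positivity)
    have hpol := S.greedy _ S.realizes.1
    have hconc := S.run.regret_concentration (z₀ := z₀) S.bounded S.base S.realizes S.elimination
      S.C_pos hpol.1 hpol.2 hl0 hl (half_pos hδ)
    have e1 : √(Λ / T) * T = √(T * Λ) := by
      rw [Real.sqrt_div hΛ0.le, Real.sqrt_mul (by linarith), div_mul_eq_mul_div, mul_comm,
        mul_div_right_comm, Real.div_sqrt]
    have e2 : Λ / √(Λ / T) = √(T * Λ) := by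
      rw [Real.sqrt_div hΛ0.le, Real.sqrt_mul (by linarith), div_div_eq_mul_div,
        mul_div_right_comm, Real.div_sqrt, mul_comm]
    have e3 : Real.log (1 / (δ / 2)) = Λ := by
      rw [one_div_div]
    rw [e3, e1, e2] at hconc
    have hgood := S.measure_not_good_le z₀
    calc _ ≤ P ({ω | ¬ (GoodEvent z₀ x r a D G T C fstar ω ∧
            ∀ t ∈ Finset.Icc 1 T, ∀ b, r t ω b ∈ Set.Icc (0 : ℝ) 1)} ∪
          {ω | ∑ t ∈ Finset.Icc 1 T,
            (meanRegret D G T C fstar (pol fstar) (past z₀ x r a t ω) t).toReal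
            + √(T * Λ) + √(T * Λ) < regret T (pol fstar) x r a ω}) := by
          refine measure_mono fun ω hω => ?_
          by_contra hnot
          simp only [Set.mem_union, Set.mem_ofPred_eq, not_or, not_not, not_lt] at hnot hω
          obtain ⟨⟨hg, hr⟩, hle⟩ := hnot
          have h1 := Finset.sum_le_sum fun t ht => S.meanRegret_toReal_le hz₀ hg hr ht
          rw [← Finset.mul_sum] at h1
          have h2 := mul_le_mul_of_nonneg_left (sum_rpow_neg_quarter_le T)
            (show 0 ≤ 17 * (C ^ (1 / 4 : ℝ) *
              √((disagreementCoeff D G fstar pol).toReal * K * Real.log T)) by positivity)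
          have h3 : 17 * (C ^ (1 / 4 : ℝ) *
              √((disagreementCoeff D G fstar pol).toReal * K * Real.log T)) *
              (2 * (T : ℝ) ^ (3 / 4 : ℝ)) = 34 * Q := by simp only [Q]; ring
          linarith
      _ ≤ _ := measure_union_le _ _
      _ ≤ ENNReal.ofReal (δ / 2) + ENNReal.ofReal (δ / 2) := add_le_add hgood hconc
      _ = _ := by
          rw [← ENNReal.ofReal_add (by positivity) (by positivity), add_halves]
  · refine le_trans (le_of_eq ?_) zero_le
    rw [measure_eq_zero_iff_ae_notMem]
    filter_upwards [S.run.ae_abs_regret_le S.bounded (π := pol fstar)] with ω hω hlt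
    have h1 := (le_abs_self _).trans hω
    have h2 : (T : ℝ) ≤ √(T * Λ) := by
      refine Real.le_sqrt_of_sq_le ?_
      rw [sq]
      exact mul_le_mul_of_nonneg_left (not_le.1 hΛ).le (by linarith)
    change _ < _ at hlt
    linarith [Real.sqrt_nonneg (T * Λ)]

/-- The radius dominates `log (2/δ)`, so for `C ≤ T` the deviation `√(T C)` is at most `T^{3/4}
C^{1/4}` and joins the main term, `34 + 2 = 36`. For `C > T` the main term exceeds `T`. -/
lemma measure_lt_regret_le_of_one_le (S : Setup D G fstar pol T δ C P x r a)
    (hθ : 1 ≤ (disagreementCoeff D G fstar pol).toReal * K * Real.log T) :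
    P {ω | 36 * ((T : ℝ) ^ (3 / 4 : ℝ) * C ^ (1 / 4 : ℝ) *
        √((disagreementCoeff D G fstar pol).toReal * K * Real.log T))
        < regret T (pol fstar) x r a ω} ≤ ENNReal.ofReal δ := by
  have hTR : (0 : ℝ) < T := by exact_mod_cast (by linarith [S.two_le] : 0 < T)
  have hC := S.C_pos
  set q := √((disagreementCoeff D G fstar pol).toReal * K * Real.log T)
  have hq : 1 ≤ q := Real.one_le_sqrt.2 hθ
  have hTT : (T : ℝ) ^ (3 / 4 : ℝ) * (T : ℝ) ^ (1 / 4 : ℝ) = T := by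
    rw [← Real.rpow_add hTR]; norm_num
  by_cases hCT : C ≤ T
  · refine (measure_mono fun ω hω => ?_).trans S.measure_lt_regret_le
    simp only [Set.mem_ofPred_eq] at hω ⊢
    refine lt_of_le_of_lt ?_ hω
    have h1 : √(T * Real.log (2 / δ)) ≤ (T : ℝ) ^ (3 / 4 : ℝ) * C ^ (1 / 4 : ℝ) := by
      calc √(T * Real.log (2 / δ)) ≤ √(T * C) :=
            Real.sqrt_le_sqrt (mul_le_mul_of_nonneg_left S.radius.log_le hTR.le)
        _ = (T : ℝ) ^ (1 / 2 : ℝ) * (C ^ (1 / 4 : ℝ) * C ^ (1 / 4 : ℝ)) := by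
            rw [Real.sqrt_eq_rpow, Real.mul_rpow hTR.le hC.le, ← Real.rpow_add hC]
            norm_num
        _ ≤ (T : ℝ) ^ (1 / 2 : ℝ) * ((T : ℝ) ^ (1 / 4 : ℝ) * C ^ (1 / 4 : ℝ)) := by
            gcongr
        _ = _ := by
            rw [← mul_assoc, ← Real.rpow_add hTR]
            norm_num
    have h2 : (T : ℝ) ^ (3 / 4 : ℝ) * C ^ (1 / 4 : ℝ)
        ≤ (T : ℝ) ^ (3 / 4 : ℝ) * C ^ (1 / 4 : ℝ) * q :=
      le_mul_of_one_le_right (by positivity) hq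
    linarith
  · refine le_trans (le_of_eq ?_) zero_le
    rw [measure_eq_zero_iff_ae_notMem]
    filter_upwards [S.run.ae_abs_regret_le S.bounded (π := pol fstar)] with ω hω hlt
    have h1 := (le_abs_self _).trans hω
    have h2 : (T : ℝ) ≤ (T : ℝ) ^ (3 / 4 : ℝ) * C ^ (1 / 4 : ℝ) := by
      calc (T : ℝ) = (T : ℝ) ^ (3 / 4 : ℝ) * (T : ℝ) ^ (1 / 4 : ℝ) := hTT.symm
        _ ≤ _ := by
          have := (not_le.1 hCT).le
          gcongr
    have h3 : (T : ℝ) ^ (3 / 4 : ℝ) * C ^ (1 / 4 : ℝ)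
        ≤ (T : ℝ) ^ (3 / 4 : ℝ) * C ^ (1 / 4 : ℝ) * q :=
      le_mul_of_one_le_right (by positivity) hq
    change _ < _ at hlt
    linarith

/-- Off the good event the whole class is still a regret ball of radius one, which bounds the mean
regret by `4θ/γ`. Unlike the trivial bound one this is proportional to `θ`, so the final estimate
has no additive term. -/
lemma lintegral_meanRegret_le (S : Setup D G fstar pol T δ C P x r a) {z₀ : Round X K}
    (hz₀ : ∀ b, z₀.2.2 b ∈ Set.Icc (0 : ℝ) 1) {γ : ℝ} (hγ : 0 < γ) (hγ1 : γ ≤ 1)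
    (hmas : Massart D fstar (pol fstar) γ) {t : ℕ} (ht : t ∈ Finset.Icc 1 T) :
    ∫⁻ ω, meanRegret D G T C fstar (pol fstar) (past z₀ x r a t ω) t ∂P
      ≤ ENNReal.ofReal (1632 * ((disagreementCoeff D G fstar pol).toReal * K ^ 2 * C *
        Real.log T / γ ^ 2) * (1 / t)
        + 4 * (disagreementCoeff D G fstar pol).toReal / γ * δ) := by
  have hT := S.two_le
  have hC := S.radius.one_le
  have hlog := half_le_log hT
  have hδ := S.delta_pos
  have hKR : (1 : ℝ) ≤ K := by exact_mod_cast S.one_le_card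
  have htR : (0 : ℝ) < t := by exact_mod_cast (Finset.mem_Icc.1 ht).1
  set θ := (disagreementCoeff D G fstar pol).toReal with hθdef
  have hθ : 0 ≤ θ := ENNReal.toReal_nonneg
  set R : ℝ := 1632 * (θ * K ^ 2 * C * Real.log T / γ ^ 2) * (1 / t)
  set bad := {ω | ¬ (GoodEvent z₀ x r a D G T C fstar ω ∧
      ∀ t ∈ Finset.Icc 1 T, ∀ b, r t ω b ∈ Set.Icc (0 : ℝ) 1)}
  calc _ ≤ ∫⁻ ω, (ENNReal.ofReal R +
        bad.indicator (fun _ => ENNReal.ofReal (4 * θ / γ)) ω) ∂P := by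
        refine lintegral_mono_ae ?_
        filter_upwards [S.run.ae_bounded S.bounded] with ω hr
        by_cases hω : ω ∈ bad
        · rw [Set.indicator_of_mem hω]
          refine le_add_left ?_
          have := meanRegret_le_of_massart (h := past z₀ x r a t ω) (t := t) (T := T) (C := C)
            S.base S.realizes S.greedy S.coeff_ne_top one_pos hγ hmas fun y b hb => by
              obtain ⟨f, hf, hbf⟩ := exists_argmax_of_mem_activeSet S.base S.extrema S.C_pos ht
                hz₀ hr hb
              exact ⟨f, productClass_subset_regretBall S.bounded S.base S.realizes S.greedy le_rfl
                fun c => runVersionSpace_subset ω _ c (hf c), hbf⟩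
          simpa using this
        · rw [Set.indicator_of_notMem hω, add_zero]
          have hg : GoodEvent z₀ x r a D G T C fstar ω := (not_not.1 hω).1
          have hsub := hg.subset_regretBall_of_round_massart hT hC S.one_le_card S.bounded S.base
            S.realizes S.elimination S.greedy hγ hγ1 hmas ht
          have := meanRegret_le_of_massart (h := past z₀ x r a t ω) (t := t) (T := T) (C := C)
            S.base S.realizes S.greedy S.coeff_ne_top
            (show 0 < 408 * (K : ℝ) ^ 2 * Real.log T * C / t / γ by positivity) hγ hmas
            fun y b hb => by
              obtain ⟨f, hf, hbf⟩ := exists_argmax_of_mem_activeSet S.base S.extrema S.C_pos ht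
                hz₀ hr hb
              exact ⟨f, hsub hf, hbf⟩
          refine this.trans (ENNReal.ofReal_le_ofReal (le_of_eq ?_))
          simp only [R, ← hθdef]
          field_simp
          ring
    _ = ENNReal.ofReal R + ∫⁻ ω, bad.indicator (fun _ => ENNReal.ofReal (4 * θ / γ)) ω ∂P := by
        rw [lintegral_add_left measurable_const]
        simp
    _ ≤ ENNReal.ofReal R + ENNReal.ofReal (4 * θ / γ) * ENNReal.ofReal δ := by
        gcongr
        refine (lintegral_indicator_const_le _ _).trans ?_
        gcongr
        exact (S.measure_not_good_le z₀).trans (ENNReal.ofReal_le_ofReal (by linarith))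
    _ = _ := by
        rw [← ENNReal.ofReal_mul (by positivity), ENNReal.ofReal_add (by positivity)
          (by positivity)]

/-- A single action has no regret; with two or more, rewards in the unit interval force `γ ≤ 1`.
With `δ = 1/T` the bad event costs `4θ/γ` over all rounds, and the harmonic sum gives `3 · 1632 =
4896`; the total stays below `5000`. -/
lemma integral_regret_le (S : Setup D G fstar pol T δ C P x r a) {γ : ℝ} (hγ : 0 < γ)
    (hmas : Massart D fstar (pol fstar) γ) (hδT : δ = 1 / T) :
    ∫ ω, regret T (pol fstar) x r a ω ∂P
      ≤ 5000 * ((disagreementCoeff D G fstar pol).toReal * K ^ 2 * C * Real.log T ^ 2 / γ ^ 2) := by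
  have hT := S.two_le
  have hC := S.radius.one_le
  have hlog := half_le_log hT
  have hTR : (0 : ℝ) < T := by exact_mod_cast (by omega : 0 < T)
  have hKR : (1 : ℝ) ≤ K := by exact_mod_cast S.one_le_card
  have hθ : 0 ≤ (disagreementCoeff D G fstar pol).toReal := ENNReal.toReal_nonneg
  rcases S.one_le_card.eq_or_lt with hK | hK
  · subst hK
    have h0 : ∀ ω, regret T (pol fstar) x r a ω = 0 := by
      intro ω
      unfold regret
      rw [sub_eq_zero]
      exact Finset.sum_congr rfl fun t _ => congrArg _ (Subsingleton.elim _ _)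
    simp only [h0, integral_zero]
    positivity
  · have hγ1 : γ ≤ 1 := by
      obtain ⟨y, hy⟩ := hmas.exists
      obtain ⟨b, hb⟩ : ∃ b, b ≠ pol fstar y := by
        have : Nontrivial (Fin K) := Fin.nontrivial_iff_two_le.2 hK
        exact exists_ne _
      have h1 := hy b hb
      linarith [(S.realizes.mem_Icc S.base y b).1, (S.realizes.mem_Icc S.base y (pol fstar y)).2]
    obtain ⟨z₀, hz₀⟩ := exists_round a x P
    have hpol := S.greedy _ S.realizes.1
    have hδ := S.delta_pos
    refine (S.run.integral_regret_le S.bounded S.base S.realizes S.elimination S.C_pos hpol.1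
      hpol.2 (fun t => by positivity) fun t ht =>
      S.lintegral_meanRegret_le hz₀ hγ hγ1 hmas ht).trans ?_
    set θ := (disagreementCoeff D G fstar pol).toReal
    rw [Finset.sum_add_distrib, ← Finset.mul_sum, Finset.sum_const, Nat.card_Icc, nsmul_eq_mul,
      Nat.add_sub_cancel, hδT]
    have h1 : 1632 * (θ * K ^ 2 * C * Real.log T / γ ^ 2) * ∑ t ∈ Finset.Icc 1 T, 1 / (t : ℝ)
        ≤ 1632 * (θ * K ^ 2 * C * Real.log T / γ ^ 2) * (3 * Real.log T) :=
      mul_le_mul_of_nonneg_left (sum_one_div_le hT) (by positivity)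
    have h2 : (T : ℝ) * (4 * θ / γ * (1 / T)) = 4 * θ / γ := by field_simp
    have h3 : 4 * θ / γ ≤ 16 * (θ * K ^ 2 * C * Real.log T ^ 2 / γ ^ 2) := by
      rw [← mul_div_assoc, div_le_div_iff₀ hγ (by positivity)]
      have h4 : (1 : ℝ) ≤ K ^ 2 * C * (4 * Real.log T ^ 2) :=
        one_le_mul_of_one_le_of_one_le (one_le_mul_of_one_le_of_one_le (by nlinarith) hC)
          (by nlinarith)
      have h5 : γ ^ 2 ≤ γ := by nlinarith
      calc 4 * θ * γ ^ 2 ≤ 4 * θ * γ * 1 := by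
            rw [mul_one]; exact mul_le_mul_of_nonneg_left h5 (by positivity)
        _ ≤ 4 * θ * γ * (K ^ 2 * C * (4 * Real.log T ^ 2)) :=
            mul_le_mul_of_nonneg_left h4 (by positivity)
        _ = _ := by ring
    have h6 : 1632 * (θ * K ^ 2 * C * Real.log T / γ ^ 2) * (3 * Real.log T)
        = 4896 * (θ * K ^ 2 * C * Real.log T ^ 2 / γ ^ 2) := by ring
    have h7 : 0 ≤ θ * K ^ 2 * C * Real.log T ^ 2 / γ ^ 2 := by positivity
    linarith

end Setup

end Bounds

end RegCB

namespace RegCB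

/-! ### Finite classes -/

section Finite

variable {X : Type*} {K : ℕ} {G : Set (X → ℝ)}

/-- This covers one-element classes, for which `log |G|` vanishes and could not dominate the radius;
the main term vanishes as well. -/
lemma disagreementCoeff_eq_zero_of_subsingleton [MeasurableSpace X] (hG : G.Subsingleton)
    (D : Measure (X × (Fin K → ℝ))) (fstar : X → Fin K → ℝ)
    (pol : (X → Fin K → ℝ) → X → Fin K) : disagreementCoeff D G fstar pol = 0 := by
  have h : ∀ ε, disagreementRegion (regretBall D G fstar pol ε) = ∅ := by
    intro ε
    refine Set.eq_empty_of_forall_notMem ?_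
    rintro y ⟨f, hf, f', hf', hne⟩
    refine hne ?_
    have : f = f' := by
      funext z b
      exact congrFun (hG (hf.1 b) (hf'.1 b)) z
    rw [this]
  simp [disagreementCoeff, h]

lemma two_le_ncard_of_coeff_ne_zero [MeasurableSpace X] (hG : G.Finite)
    {D : Measure (X × (Fin K → ℝ))} {fstar : X → Fin K → ℝ}
    {pol : (X → Fin K → ℝ) → X → Fin K} (h : disagreementCoeff D G fstar pol ≠ 0) :
    2 ≤ G.ncard := by
  by_contra hlt
  have := hG.to_subtype
  exact h (disagreementCoeff_eq_zero_of_subsingleton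
    (Set.ncard_le_one_iff_subsingleton.1 (by omega)) D fstar pol)

lemma log_radiusFinite_arg {N K T : ℕ} (hN : 1 ≤ N) (hK : 1 ≤ K) (hT : 2 ≤ T) {δ : ℝ}
    (hδ : 0 < δ) : Real.log (2 * (N : ℝ) * K * (T : ℝ) ^ 2 / δ)
      ≤ 1 + Real.log N + Real.log K + 2 * Real.log T + Real.log (1 / δ) := by
  have hN' : (N : ℝ) ≠ 0 := by positivity
  have hK' : (K : ℝ) ≠ 0 := by positivity
  have hT' : (T : ℝ) ≠ 0 := by positivity
  rw [div_eq_mul_one_div, Real.log_mul (by positivity) (by positivity),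
    Real.log_mul (by positivity) (by positivity), Real.log_mul (by positivity) hK',
    Real.log_mul two_ne_zero hN', Real.log_pow]
  push_cast
  linarith [Real.log_two_lt_d9]

/-- For at least two functions `log |G| ≥ 1/2`, so the additive logarithms can be absorbed into a
product. The constant is generous and has an integer fourth root. -/
lemma radiusFinite_le (hN : 2 ≤ G.ncard) {T : ℕ} (hK : 1 ≤ K) (hT : 2 ≤ T) {δ : ℝ} (hδ : 0 < δ)
    (hδ1 : δ < 1) :
    radiusFinite K G T δ
      ≤ 256 * ((1 + Real.log T) * (1 + Real.log K) * (1 + Real.log (1 / δ))) *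
        Real.log G.ncard := by
  have h1 := log_radiusFinite_arg (N := G.ncard) (by omega) hK hT hδ
  have hN := half_le_log hN
  have hT' := half_le_log hT
  have hK' : 0 ≤ Real.log K := Real.log_natCast_nonneg K
  have hδ' : 0 ≤ Real.log (1 / δ) := Real.log_nonneg (by rw [le_div_iff₀ hδ]; linarith)
  unfold radiusFinite
  set n := Real.log G.ncard
  set k := Real.log K
  set t := Real.log T
  set d := Real.log (1 / δ)
  set A := (1 + t) * (1 + k) * (1 + d) with hA
  have e : A = 1 + t + k + d + t * k + t * d + k * d + t * k * d := by rw [hA]; ring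
  have h2 : 1 + t + k + d ≤ A := by
    rw [e]
    have : 0 ≤ t * k + t * d + k * d + t * k * d := by positivity
    linarith
  have h3 : A ≤ 2 * (A * n) := by nlinarith
  have h4 : n ≤ A * n := by nlinarith
  nlinarith

lemma radiusFinite_one_div_le (hN : 1 ≤ G.ncard) {T : ℕ} (hK : 1 ≤ K) (hT : 2 ≤ T) :
    radiusFinite K G T (1 / T)
      ≤ 80 * ((1 + Real.log T) * (1 + Real.log K)) * Real.log (G.ncard * T) := by
  have hT0 : (0 : ℝ) < T := by exact_mod_cast (by omega : 0 < T)
  have h1 := log_radiusFinite_arg (N := G.ncard) hN hK hT (δ := 1 / T) (by positivity)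
  have hN0 : 0 ≤ Real.log G.ncard := Real.log_natCast_nonneg _
  have hT' := half_le_log hT
  have hK' : 0 ≤ Real.log K := Real.log_natCast_nonneg K
  rw [one_div_one_div] at h1
  rw [Real.log_mul (by positivity) hT0.ne']
  unfold radiusFinite
  set n := Real.log G.ncard
  set k := Real.log K
  set t := Real.log T
  have h2 : 1 + k ≤ (1 + t) * (1 + k) := by nlinarith
  have h3 : 1 ≤ (1 + t) * (1 + k) := by nlinarith
  set A := (1 + t) * (1 + k)
  have h4 : n + t ≤ A * (n + t) := by nlinarith
  have h5 : A ≤ 2 * (A * (n + t)) := by nlinarith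
  nlinarith

lemma rpow_quarter_mul_sqrt_le {A n C t θK : ℝ} (hA : 1 ≤ A) (hn : 0 ≤ n) (hC : 0 ≤ C)
    (ht : t ≤ A) (hCA : C ≤ 256 * A * n) (hθK : 0 ≤ θK) :
    C ^ (1 / 4 : ℝ) * √(θK * t) ≤ 4 * A ^ 2 * (n ^ (1 / 4 : ℝ) * √θK) := by
  have h1 : C ^ (1 / 4 : ℝ) ≤ 4 * A * n ^ (1 / 4 : ℝ) := by
    calc C ^ (1 / 4 : ℝ) ≤ (256 * A * n) ^ (1 / 4 : ℝ) := by gcongr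
      _ = 4 * A ^ (1 / 4 : ℝ) * n ^ (1 / 4 : ℝ) := by
        have h4 : (256 : ℝ) ^ (1 / 4 : ℝ) = 4 := by
          rw [show (256 : ℝ) = 4 ^ (4 : ℝ) by norm_num, ← Real.rpow_mul (by norm_num)]
          norm_num
        rw [Real.mul_rpow (by positivity) hn, Real.mul_rpow (by norm_num) (by positivity), h4]
      _ ≤ 4 * A * n ^ (1 / 4 : ℝ) := by
        have : A ^ (1 / 4 : ℝ) ≤ A ^ (1 : ℝ) := Real.rpow_le_rpow_of_exponent_le hA (by norm_num)
        rw [Real.rpow_one] at this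
        gcongr
  have h2 : √(θK * t) ≤ √θK * A := by
    rw [Real.sqrt_mul hθK]
    gcongr
    exact Real.sqrt_le_iff.2 ⟨by linarith, by nlinarith⟩
  calc C ^ (1 / 4 : ℝ) * √(θK * t) ≤ (4 * A * n ^ (1 / 4 : ℝ)) * (√θK * A) := by gcongr
    _ = _ := by ring

lemma sqrt_mul_le {A l t : ℝ} (hA : 1 ≤ A) (hl : l ≤ A) (ht : 0 ≤ t) : √(t * l) ≤ A * √t := by
  rw [mul_comm t, Real.sqrt_mul' _ ht]
  exact mul_le_mul_of_nonneg_right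
    (Real.sqrt_le_iff.2 ⟨by linarith, by nlinarith⟩) (Real.sqrt_nonneg t)

end Finite

end RegCB

/-! ### The theorem -/

open MeasureTheory RegCB in
theorem theorem2 :
    ∃ (c : ℝ) (p : ℕ), 0 < c ∧
      ∀ {X : Type*} [MeasurableSpace X] (K T : ℕ) (D : Measure (X × (Fin K → ℝ)))
        [IsProbabilityMeasure D] (G : Set (X → ℝ)) (fstar : X → Fin K → ℝ)
        (pol : (X → Fin K → ℝ) → X → Fin K) (δ C : ℝ)
        {Ω : Type*} [MeasurableSpace Ω] (P : Measure Ω) [IsProbabilityMeasure P]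
        (x : ℕ → Ω → X) (r : ℕ → Ω → Fin K → ℝ) (a : ℕ → Ω → Fin K),
        2 ≤ T → 0 < δ → δ < 1 →
        BoundedRewards D → IsBaseClass G → RegularClass K G →
        Realizes D G fstar → IsGreedyRule G pol →
        disagreementCoeff D G fstar pol ≠ ⊤ →
        (C = radius D G T δ ∨ (G.Finite ∧ C = radiusFinite K G T δ)) →
        IsRun D G T C P x r a →
        let θ : ℝ := (disagreementCoeff D G fstar pol).toReal
        let Reg : Ω → ℝ := regret T (pol fstar) x r a
        -- general classes, high-probability bound
        (1 - δ ≤ P.real {ω | Reg ω ≤ c * ((T : ℝ) ^ (3 / 4 : ℝ) * C ^ (1 / 4 : ℝ) *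
            √(θ * K * Real.log T) + √(T * Real.log (2 / δ)))}) ∧
        (1 ≤ θ * K * Real.log T →
          1 - δ ≤ P.real {ω | Reg ω ≤ c * ((T : ℝ) ^ (3 / 4 : ℝ) * C ^ (1 / 4 : ℝ) *
            √(θ * K * Real.log T) + Real.log (1 / δ))}) ∧
        -- finite classes, high-probability bound up to logarithmic factors
        (G.Finite →
          1 - δ ≤ P.real {ω | Reg ω ≤
            c * ((1 + Real.log T) * (1 + Real.log K) * (1 + Real.log (1 / δ))) ^ p *
              ((T : ℝ) ^ (3 / 4 : ℝ) * Real.log G.ncard ^ (1 / 4 : ℝ) * √(θ * K) + √T)}) ∧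
        (G.Finite → 1 ≤ θ * K * Real.log T →
          1 - δ ≤ P.real {ω | Reg ω ≤
            c * ((1 + Real.log T) * (1 + Real.log K) * (1 + Real.log (1 / δ))) ^ p *
              ((T : ℝ) ^ (3 / 4 : ℝ) * Real.log G.ncard ^ (1 / 4 : ℝ) * √(θ * K))}) ∧
        -- expected regret under the Massart condition
        (∀ γ : ℝ, 0 < γ → Massart D fstar (pol fstar) γ → δ = 1 / T →
          Integrable Reg P ∧
          ∫ ω, Reg ω ∂P ≤ c * (θ * (K : ℝ) ^ 2 * C * Real.log T ^ 2 / γ ^ 2) ∧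
          (G.Finite →
            ∫ ω, Reg ω ∂P ≤ c * ((1 + Real.log T) * (1 + Real.log K)) ^ p *
              (θ * (K : ℝ) ^ 2 * Real.log (G.ncard * T) / γ ^ 2))) := by
  -- The constant is `5000 · 80`, from the expected regret and the radius at `δ = 1/T`. In that
  -- bound the exponent is one logarithmic factor from the radius and two from `log T ^ 2`.
  refine ⟨400000, 3, by norm_num, ?_⟩
  intro X _ K T D _ G fstar pol δ C Ω _ P _ x r a hT hδ hδ1 hD hbase hreg hreal hpol hθtop hC hrun
    θ Reg
  obtain ⟨ω₀⟩ : Nonempty Ω := P.nonempty_of_neZero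
  have hK : 1 ≤ K := (a 0 ω₀).pos
  have hne : G.Nonempty := ⟨_, hreal.1 (a 0 ω₀)⟩
  obtain ⟨hsep, hext, hel⟩ := hreg.regular hne hbase
  have S : Setup D G fstar pol T δ C P x r a :=
    ⟨hT, hδ, hδ1, hD, hbase, hsep, hext, hel, hreal, hpol, hθtop,
      goodRadius hne hbase hT hK hδ hδ1 hC, hrun, hK⟩
  have hθ : 0 ≤ θ := ENNReal.toReal_nonneg
  have hθ_ne : θ ≠ 0 → disagreementCoeff D G fstar pol ≠ 0 := by
    intro h h0
    exact h (by simp [θ, h0])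
  have hC1 := S.radius.one_le
  have hlogT := half_le_log hT
  have hlogK : 0 ≤ Real.log K := Real.log_natCast_nonneg K
  have hlogδ : 0 ≤ Real.log (1 / δ) := Real.log_nonneg (by rw [le_div_iff₀ hδ]; linarith)
  set Q : ℝ := (T : ℝ) ^ (3 / 4 : ℝ) * C ^ (1 / 4 : ℝ) * √(θ * K * Real.log T) with hQ
  have hQ0 : 0 ≤ Q := by positivity
  set A : ℝ := (1 + Real.log T) * (1 + Real.log K) * (1 + Real.log (1 / δ)) with hA
  have hTK1 : 1 ≤ (1 + Real.log T) * (1 + Real.log K) := by nlinarith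
  have hTA : 1 + Real.log T ≤ A := by
    have : 1 + Real.log T ≤ (1 + Real.log T) * (1 + Real.log K) := by nlinarith
    exact this.trans (le_mul_of_one_le_right (by linarith) (by linarith))
  have hA1 : 1 ≤ A := by linarith
  have hδA : 1 + Real.log (1 / δ) ≤ A := le_mul_of_one_le_left (by linarith) hTK1
  have hA3 : A ^ 2 ≤ A ^ 3 := pow_le_pow_right₀ hA1 (by norm_num)
  have hA13 : A ≤ A ^ 3 := le_self_pow₀ hA1 (by norm_num)
  have hn0 : 0 ≤ Real.log G.ncard := Real.log_natCast_nonneg _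
  set Q' : ℝ := (T : ℝ) ^ (3 / 4 : ℝ) * Real.log G.ncard ^ (1 / 4 : ℝ) * √(θ * K) with hQ'
  have hQ'0 : 0 ≤ Q' := by positivity
  have hQQ' : G.Finite → Q ≤ 4 * A ^ 3 * Q' := by
    intro hG
    -- If `θ = 0` there is no main term; otherwise the class has at least two members and its
    -- logarithm absorbs the radius.
    by_cases h0 : θ = 0
    · have : Q = 0 := by rw [hQ, h0]; simp
      rw [this]
      positivity
    · have hN2 := two_le_ncard_of_coeff_ne_zero hG (hθ_ne h0)
      have h1 := rpow_quarter_mul_sqrt_le (t := Real.log T) hA1 hn0 S.C_pos.le (by linarith)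
        ((le_radiusFinite hG hC).trans (radiusFinite_le hN2 hK hT hδ hδ1))
        (mul_nonneg hθ (Nat.cast_nonneg K))
      calc Q = (T : ℝ) ^ (3 / 4 : ℝ) * (C ^ (1 / 4 : ℝ) * √(θ * K * Real.log T)) := by
            rw [hQ]; ring
        _ ≤ (T : ℝ) ^ (3 / 4 : ℝ) *
            (4 * A ^ 2 * (Real.log G.ncard ^ (1 / 4 : ℝ) * √(θ * K))) := by gcongr
        _ = 4 * A ^ 2 * Q' := by rw [hQ']; ring
        _ ≤ 4 * A ^ 3 * Q' := by gcongr
  have hsqrt : √(T * Real.log (2 / δ)) ≤ A ^ 3 * √T := by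
    have h1 : Real.log (2 / δ) ≤ A := by
      rw [div_eq_mul_one_div, Real.log_mul two_ne_zero (by positivity)]
      linarith [Real.log_two_lt_d9]
    exact (sqrt_mul_le hA1 h1 (Nat.cast_nonneg T)).trans
      (mul_le_mul_of_nonneg_right hA13 (Real.sqrt_nonneg _))
  refine ⟨?_, ?_, ?_, ?_, ?_⟩
  · refine S.le_measureReal_regret_le ?_ S.measure_lt_regret_le
    have := Real.sqrt_nonneg (T * Real.log (2 / δ))
    change 34 * Q + _ ≤ _
    linarith
  · intro h1
    refine S.le_measureReal_regret_le ?_ (S.measure_lt_regret_le_of_one_le h1)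
    change 36 * Q ≤ _
    linarith
  · intro hG
    refine S.le_measureReal_regret_le ?_ S.measure_lt_regret_le
    change 34 * Q + _ ≤ _
    have h1 := hQQ' hG
    have h2 : 0 ≤ A ^ 3 * Q' := by positivity
    have h3 : 0 ≤ A ^ 3 * √T := by positivity
    linarith
  · intro hG h1
    refine S.le_measureReal_regret_le ?_ (S.measure_lt_regret_le_of_one_le h1)
    change 36 * Q ≤ _
    have h1 := hQQ' hG
    have h2 : 0 ≤ A ^ 3 * Q' := by positivity
    linarith
  · intro γ hγ hmas hδT
    have hmain := S.integral_regret_le hγ hmas hδT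
    refine ⟨hrun.integrable_regret hD (hpol _ hreal.1).1, hmain.trans ?_, fun hG =>
      hmain.trans ?_⟩
    · have : 0 ≤ θ * (K : ℝ) ^ 2 * C * Real.log T ^ 2 / γ ^ 2 := by
        have := S.C_pos
        positivity
      linarith
    · have h1 := le_radiusFinite hG hC
      rw [hδT] at h1
      have h2 := h1.trans (radiusFinite_one_div_le ((Set.ncard_pos hG).2 hne) hK hT)
      set B := (1 + Real.log T) * (1 + Real.log K)
      set ℓ := Real.log (G.ncard * T)
      have hTB : Real.log T ≤ B := by nlinarith
      have hB2 : Real.log T ^ 2 ≤ B ^ 2 := pow_le_pow_left₀ (by linarith) hTB 2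
      have h3 : C * Real.log T ^ 2 ≤ 80 * B * ℓ * B ^ 2 :=
        mul_le_mul h2 hB2 (sq_nonneg _) (by linarith)
      have h4 : 0 ≤ θ * (K : ℝ) ^ 2 / γ ^ 2 := by positivity
      calc 5000 * (θ * K ^ 2 * C * Real.log T ^ 2 / γ ^ 2)
          = 5000 * (θ * (K : ℝ) ^ 2 / γ ^ 2) * (C * Real.log T ^ 2) := by ring
        _ ≤ 5000 * (θ * (K : ℝ) ^ 2 / γ ^ 2) * (80 * B * ℓ * B ^ 2) := by gcongr
        _ = _ := by ring
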